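/- **Setting.** Let $\Omega_0\subset\mathbb R^3$ be open, bounded and connected with smooth boundary $\Gamma_0$, let $T>0$, let $f:[0,T]\times\mathbb R^3\to\mathbb R$ be of class $C^1$, and let $v^\Gamma$ be a given boundary velocity. Let $(X,v,u)$ be a sufficiently smooth exact solution on $[0,T]$ of the diffusion equation on the harmonically evolving domain $\Omega(t)=X(\Omega_0,t)$, $\Gamma(t)=X(\Gamma_0,t)$: $$\partial_tX(p,t)=v(X(p,t),t),\quad X(p,0)=p\quad(p\in\overline{\Omega_0}),\qquad -\Delta v=0\ \text{in }\Omega(t),\quad v=v^\Gamma\ \text{on }\Gamma(t),$$ $$\frac{d}{dt}\int_{\Omega(t)}u\varphi+\int_{\Omega(t)}\nabla u\cdot\nabla\varphi=\int_{\Omega(t)}f\varphi+\int_{\Omega(t)}u\,(\partial_t\varphi+v\cdot\nabla\varphi)\quad\text{for all }\varphi\in C^1(\mathbb R\times\mathbb R^3)$$ (the weak form of $\partial^\bullet u+u\nabla\cdot v-\Delta u=f$ in $\Omega(t)$, $\partial u/\partial\mathrm n=0$ on $\Gamma(t)$; the equation for $v$ is also meant weakly). "Sufficiently smooth" means: $X$,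 $v(X(\cdot,t),t)$ and $u(X(\cdot,t),t)$ are of class $C^1$ on $[0,T]\times\overline{\Omega_0}$; $X(\cdot,t)$ is injective on $\overline{\Omega_0}$ with invertible differential; $v^\Gamma$ is of class $C^1$ in a neighbourhood of $\bigcup_t\{t\}\times\Gamma(t)$. **Discretization.** Fix $k\ge2$, $\sigma>0$ and $q<1$. Consider conforming triangulations by tetrahedra of maximal diameter $h$, such that every tetrahedron contains a ball of radius $h/\sigma$, together with a homeomorphism $G$ of the union $P$ of the tetrahedra onto $\overline{\Omega_0}$ which maps $\partial P$ onto $\Gamma_0$, fixes the vertices, and on each tetrahedron is differentiable with $\|DG-I\|\le q$ and with $DG$ Lipschitz with constant $\sigma$. For a tetrahedron $K$ let $\Phi_K$ be the affine map of the unit simplex $\widehat T$ onto $K$. The nodes $x_1^0,\dots,x_N^0\in\overline{\Omega_0}$ are the images under the curved parametrizations $G\circ\Phi_K$ of the Lagrange nodes of degree $k$ of $\widehat T$; the nodes on $\Gamma_0$ are the boundary nodes, the others the interior nodes. A nodal vector $\mathbf x=(x_j)_j$ with $x_j\in\mathbb R^3$ defines a domain $\Omega_h(\mathbf x)$, the union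 of the elements obtained as images of $\widehat T$ under the degree-$k$ Lagrange interpolants of the nodal positions, and isoparametric basis functions $\varphi_j[\mathbf x]$, whose pullbacks to $\widehat T$ are Lagrange basis polynomials of degree $k$ and which satisfy $\varphi_j[\mathbf x](x_l)=\delta_{jl}$. Put $$\mathbf M(\mathbf x)_{jl}=\int_{\Omega_h(\mathbf x)}\varphi_j[\mathbf x]\varphi_l[\mathbf x],\qquad \mathbf A(\mathbf x)_{jl}=\int_{\Omega_h(\mathbf x)}\nabla\varphi_j[\mathbf x]\cdot\nabla\varphi_l[\mathbf x],\qquad \mathbf f(\mathbf x)_j=\int_{\Omega_h(\mathbf x)}f(\cdot,t)\,\varphi_j[\mathbf x],$$ integrals over $\Omega_h(\mathbf x)$ being sums of integrals over the elements. Indices $1$ and $2$ denote the blocks of boundary and interior nodes, superscripts $\Gamma$ and $\Omega$ the corresponding parts of nodal vectors; matrices act componentwise on vectors with entries in $\mathbb R^3$. Write $\|\mathbf w\|_{\mathbf K}^2=\mathbf w^{\mathsf T}\mathbf K\mathbf w$. The semi-discrete solution consists of $\mathbf x(t),\mathbf v(t),\mathbf u(t)$, $t\in[0,T]$, with $$\dot{\mathbf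 x}=\mathbf v,\quad v_j(t)=v^\Gamma(x_j(t),t)\ \text{in the boundary nodes},\quad \mathbf A_{22}(\mathbf x)\mathbf v^\Omega=-\mathbf A_{21}(\mathbf x)\mathbf v^\Gamma,\quad \frac{d}{dt}\big(\mathbf M(\mathbf x)\mathbf u\big)+\mathbf A(\mathbf x)\mathbf u=\mathbf f(\mathbf x),$$ $x_j(0)=x_j^0$, $u_j(0)=u(x_j^0,0)$. Let $\mathbf x^*,\mathbf v^*,\mathbf u^*$ be the nodal vectors of the exact values $x^*_j(t)=X(x_j^0,t)$, $v^*_j(t)=v(x^*_j(t),t)$, $u_j^*(t)=u(x_j^*(t),t)$. The defects $\mathbf d_{\mathbf v}$ (with values in $\mathbb R^3$, in the interior nodes) and $\mathbf d_{\mathbf u}$ are defined by $$\mathbf A_{22}(\mathbf x^*)\mathbf v^{*,\Omega}=-\mathbf A_{21}(\mathbf x^*)\mathbf v^{*,\Gamma}+\mathbf M_{22}(\mathbf x^*)\mathbf d_{\mathbf v},\qquad \frac{d}{dt}\big(\mathbf M(\mathbf x^*)\mathbf u^*\big)+\mathbf A(\mathbf x^*)\mathbf u^*=\mathbf f(\mathbf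 x^*)+\mathbf M(\mathbf x^*)\mathbf d_{\mathbf u},$$ and measured in the dual norms $$\|\mathbf d_{\mathbf v}\|_{\star,\mathbf x^*}^2=\mathbf d_{\mathbf v}^{\mathsf T}\mathbf M_{22}\mathbf A_{22}^{-1}\mathbf M_{22}\mathbf d_{\mathbf v},\qquad \|\mathbf d_{\mathbf u}\|_{\star,\mathbf x^*}^2=\mathbf d_{\mathbf u}^{\mathsf T}\mathbf M(\mathbf M+\mathbf A)^{-1}\mathbf M\mathbf d_{\mathbf u}\qquad(\text{matrices at }\mathbf x^*).$$ Let $\mathbf e_{\mathbf u}=\mathbf u-\mathbf u^*$. **Lemma (stability of the semi-discrete diffusion equation).** Let $\kappa>3/2$ and $c\in\mathbb R$. There exist $h_0>0$ and $C$ such that for every triangulation as above with $h\le h_0$ and every semi-discrete solution on $[0,T]$: if $$\|\mathbf d_{\mathbf u}(t)\|_{\star,\mathbf x^*(t)}\le c\,h^\kappa,\qquad \|\mathbf d_{\mathbf v}(t)\|_{\star,\mathbf x^*(t)}\le c\,h^\kappa\qquad\text{for all }t\in[0,T],$$ then for all $t\in[0,T]$ $$\|\mathbf e_{\mathbf u}(t)\|_{\mathbf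 M(\mathbf x^*(t))}^2+\int_0^t\|\mathbf e_{\mathbf u}(s)\|_{\mathbf A(\mathbf x^*(s))}^2\,ds\le C\int_0^t\Big(\|\mathbf d_{\mathbf u}(s)\|_{\star,\mathbf x^*(s)}^2+\|\mathbf d_{\mathbf v}(s)\|_{\star,\mathbf x^*(s)}^2\Big)ds.$$ In particular $h_0$ and $C$ are independent of $h$ and of the triangulation (they may depend on the data, the exact solution, $T,k,\sigma,q,\kappa,c$). -/

import Mathlib

open Set MeasureTheory Matrix
open scoped RealInnerProductSpace

noncomputable section

namespace HarmonicFEM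

/-- Three-dimensional Euclidean space. -/
abbrev E3 : Type := EuclideanSpace ℝ (Fin 3)

/-! ### The exact problem -/

/-- `Ω` has a smooth boundary: near each boundary point, `Ω` is the negativity set of a smooth
function with non-vanishing differential. -/
def HasSmoothBoundary (Ω : Set E3) : Prop :=
  ∀ p ∈ frontier Ω, ∃ U : Set E3, IsOpen U ∧ p ∈ U ∧ ∃ ψ : E3 → ℝ,
    ContDiffOn ℝ ((⊤ : ℕ∞) : WithTop ℕ∞) ψ U ∧ (∀ x ∈ U, fderiv ℝ ψ x ≠ 0) ∧
    Ω ∩ U = {x ∈ U | ψ x < 0} ∧ frontier Ω ∩ U = {x ∈ U | ψ x = 0}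

/-- `(X, v, u)` is an exact solution, on the time interval `[0, T]`, of the diffusion equation on
the harmonically evolving domain `Ω(t) = X(t, Ω₀)` with boundary `Γ(t) = X(t, ∂Ω₀)`, for the right
hand side `f` and the boundary velocity `vΓ` (diffusion coefficient one, homogeneous Neumann
condition).  The equations are imposed in weak form.  The required regularity is only of first
order, jointly in time and the Lagrangian variable `p ∈ closure Ω₀`. -/
structure IsExactSolution (Ω₀ : Set E3) (T : ℝ) (f : ℝ → E3 → ℝ) (vΓ : ℝ → E3 → E3)
    (X v : ℝ → E3 → E3) (u : ℝ → E3 → ℝ) : Prop where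
  /-- regularity of the flow map -/
  contDiffOn_X : ContDiffOn ℝ 1 (fun z : ℝ × E3 => X z.1 z.2) (Icc 0 T ×ˢ closure Ω₀)
  /-- regularity of the velocity, transported to the initial domain -/
  contDiffOn_v : ContDiffOn ℝ 1 (fun z : ℝ × E3 => v z.1 (X z.1 z.2)) (Icc 0 T ×ˢ closure Ω₀)
  /-- regularity of `u`, transported to the initial domain; the time derivative of this function
  is the material derivative of `u` -/
  contDiffOn_u : ContDiffOn ℝ 1 (fun z : ℝ × E3 => u z.1 (X z.1 z.2)) (Icc 0 T ×ˢ closure Ω₀)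
  /-- regularity of the right-hand side -/
  contDiffOn_f : ContDiffOn ℝ 1 (fun z : ℝ × E3 => f z.1 z.2) (Icc 0 T ×ˢ univ)
  /-- regularity of the boundary velocity, on a neighbourhood of the space-time boundary -/
  contDiffOn_vΓ : ∃ U : Set (ℝ × E3), IsOpen U ∧
    (∀ t ∈ Icc 0 T, ∀ p ∈ frontier Ω₀, (t, X t p) ∈ U) ∧
    ContDiffOn ℝ 1 (fun z : ℝ × E3 => vΓ z.1 z.2) (U ∩ Icc 0 T ×ˢ univ)
  /-- the flow map is one-to-one -/
  injOn_X : ∀ t ∈ Icc 0 T, InjOn (X t) (closure Ω₀)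
  /-- the flow map is non-degenerate -/
  nondegenerate : ∀ t ∈ Icc 0 T, ∀ p ∈ closure Ω₀,
    ∃ D : E3 ≃L[ℝ] E3, HasFDerivWithinAt (X t) (D : E3 →L[ℝ] E3) (closure Ω₀) p
  /-- initial position -/
  X_zero : ∀ p ∈ closure Ω₀, X 0 p = p
  /-- the domain moves with velocity `v` -/
  position : ∀ p ∈ closure Ω₀, ∀ t ∈ Icc 0 T,
    HasDerivWithinAt (fun s => X s p) (v t (X t p)) (Icc 0 T) t
  /-- on the boundary the velocity is the prescribed one -/
  boundary_velocity : ∀ t ∈ Icc 0 T, ∀ p ∈ frontier Ω₀, v t (X t p) = vΓ t (X t p)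
  /-- every component of `v` is (weakly) harmonic in `Ω(t)` -/
  harmonic : ∀ t ∈ Icc 0 T, ∀ ψ : E3 → ℝ, ContDiff ℝ 1 ψ → HasCompactSupport ψ →
    tsupport ψ ⊆ X t '' Ω₀ →
      ∀ i, ∫ x in X t '' Ω₀, ⟪gradient (fun y => v t y i) x, gradient ψ x⟫ = 0
  /-- weak form of the diffusion equation with Neumann boundary condition:
  `d/dt ∫ u φ + ∫ ∇u · ∇φ = ∫ f φ + ∫ u (∂ₜ φ + v · ∇φ)` over `Ω(t)` -/
  diffusion : ∀ φ : ℝ → E3 → ℝ, ContDiff ℝ 1 (fun z : ℝ × E3 => φ z.1 z.2) → ∀ t ∈ Icc 0 T,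
    HasDerivWithinAt (fun s => ∫ x in X s '' Ω₀, u s x * φ s x)
      ((∫ x in X t '' Ω₀, f t x * φ t x)
        + (∫ x in X t '' Ω₀, u t x * (deriv (fun s => φ s x) t + ⟪gradient (φ t) x, v t x⟫))
        - ∫ x in X t '' Ω₀, ⟪gradient (u t) x, gradient (φ t) x⟫) (Icc 0 T) t

/-! ### The reference element -/

/-- Barycentric coordinates on the unit simplex. -/
def bary (x : E3) : Fin 4 → ℝ := Fin.cons (1 - ∑ i, x i) (fun i => x i)

/-- The closed unit simplex. -/
def refSimplex : Set E3 := {x | ∀ i, 0 ≤ bary x i}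

/-- Indices of the Lagrange nodes of degree `k`. -/
abbrev LocalNode (k : ℕ) : Type := {α : Fin 4 → Fin (k + 1) // ∑ i, (α i : ℕ) = k}

/-- The Lagrange node with barycentric coordinates `α i / k`. -/
def refNode {k : ℕ} (α : LocalNode k) : E3 :=
  WithLp.toLp 2 fun i => ((α.1 i.succ : ℕ) : ℝ) / k

/-- The Lagrange basis polynomial of degree `k` on the unit simplex attached to the node `α`: it
takes the value one at this node and zero at the other ones. -/
def shape {k : ℕ} (α : LocalNode k) (x : E3) : ℝ :=
  ∏ i, ∏ m ∈ Finset.range (α.1 i : ℕ), ((k : ℝ) * bary x i - m) / (((α.1 i : ℕ) : ℝ) - m)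

/-- The affine map of the unit simplex onto the simplex with vertices `S 0, …, S 3`. -/
def affineMap (S : Fin 4 → E3) (x : E3) : E3 := ∑ i, bary x i • S i

/-! ### Triangulations -/

/-- A conforming triangulation by tetrahedra, together with the map `G` which carries its simplices
to the curved simplices of an exact triangulation of `closure Ω₀`.  On a simplex with vertices `S`
the curved parametrisation over the unit simplex is `G ∘ affineMap S`. -/
structure ExactTriangulation (Ω₀ : Set E3) where
  /-- the simplices, as tuples of vertices -/
  simplices : Finset (Fin 4 → E3)
  /-- the map onto the exact domain -/
  G : E3 → E3
  affineIndependent : ∀ S ∈ simplices, AffineIndependent ℝ S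
  /-- different members are different simplices -/
  range_injOn : ∀ S ∈ simplices, ∀ S' ∈ simplices, range S = range S' → S = S'
  /-- two simplices meet in a common face (possibly empty) -/
  conforming : ∀ S ∈ simplices, ∀ S' ∈ simplices,
    convexHull ℝ (range S) ∩ convexHull ℝ (range S') = convexHull ℝ (range S ∩ range S')
  continuousOn_G : ContinuousOn G (⋃ S ∈ simplices, convexHull ℝ (range S))
  injOn_G : InjOn G (⋃ S ∈ simplices, convexHull ℝ (range S))
  image_G : G '' (⋃ S ∈ simplices, convexHull ℝ (range S)) = closure Ω₀
  image_frontier_G : G '' frontier (⋃ S ∈ simplices, convexHull ℝ (range S)) = frontier Ω₀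
  /-- the vertices are not moved; hence the boundary vertices lie on the exact boundary -/
  G_vertex : ∀ S ∈ simplices, ∀ i, G (S i) = S i

namespace ExactTriangulation

variable {Ω₀ : Set E3} (𝒯 : ExactTriangulation Ω₀)

/-- The mesh width: the maximal diameter of the simplices. -/
def width : ℝ := ⨆ S : 𝒯.simplices, Metric.diam (convexHull ℝ (range S.1))

/-- Quasi-uniformity with constant `σ`: every simplex contains a ball of radius `width / σ`, and
the curved simplices are uniformly regular, that is, on every simplex `G` differs from the identity
by a map whose differential is bounded by `q` and is Lipschitz with constant `σ`.  (In terms of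
`Φ = G ∘ affineMap S = affineMap S + ρ` and the linear part `B` of `affineMap S`, the conditions
on `G` say `‖Dρ B⁻¹‖ ≤ q` and `‖D²Φ[B⁻¹·, B⁻¹·]‖ ≤ σ`.) -/
def IsQuasiUniform (σ q : ℝ) : Prop :=
  ∀ S ∈ 𝒯.simplices,
    (∃ z, Metric.closedBall z (𝒯.width / σ) ⊆ convexHull ℝ (range S)) ∧
    ∃ D : E3 → E3 →L[ℝ] E3,
      (∀ y ∈ convexHull ℝ (range S), HasFDerivWithinAt 𝒯.G (D y) (convexHull ℝ (range S)) y ∧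
        ‖D y - ContinuousLinearMap.id ℝ E3‖ ≤ q) ∧
      ∀ y ∈ convexHull ℝ (range S), ∀ z ∈ convexHull ℝ (range S), ‖D y - D z‖ ≤ σ * ‖y - z‖

variable (k : ℕ)

/-- The initial finite element nodes of degree `k`: the images of the Lagrange nodes under the
curved parametrisations.  This finite set also serves as the index set of nodal vectors. -/
def Node : Set E3 :=
  range fun p : 𝒯.simplices × LocalNode k => 𝒯.G (affineMap p.1.1 (refNode p.2))

instance instFiniteNode : Finite (𝒯.Node k) := Set.finite_range _

instance instFintypeNode : Fintype (𝒯.Node k) := Fintype.ofFinite _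

instance instDecidableEqNode : DecidableEq (𝒯.Node k) := Classical.decEq _

/-- The nodes on the boundary. -/
abbrev BdryNode : Type := {p : 𝒯.Node k // (p : E3) ∈ frontier Ω₀}

/-- The interior nodes. -/
abbrev IntNode : Type := {p : 𝒯.Node k // (p : E3) ∉ frontier Ω₀}

instance instFintypeBdryNode : Fintype (𝒯.BdryNode k) := Fintype.ofFinite _

instance instFintypeIntNode : Fintype (𝒯.IntNode k) := Fintype.ofFinite _

instance instDecidableEqIntNode : DecidableEq (𝒯.IntNode k) := Classical.decEq _

variable {k}

/-- Local-to-global numbering of the nodes. -/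
def dof (S : 𝒯.simplices) (α : LocalNode k) : 𝒯.Node k :=
  ⟨𝒯.G (affineMap S.1 (refNode α)), mem_range_self (S, α)⟩

/-- The isoparametric element map defined by the nodal vector `x`: the polynomial map of degree `k`
on the unit simplex that takes the Lagrange nodes to the corresponding entries of `x`. -/
def elementMap (x : 𝒯.Node k → E3) (S : 𝒯.simplices) (y : E3) : E3 :=
  ∑ α : LocalNode k, shape α y • x (𝒯.dof S α)

/-- The (curved) element defined by the nodal vector `x`.  The union of these elements is the
computational domain `Ω_h(x)`. -/
def element (x : 𝒯.Node k → E3) (S : 𝒯.simplices) : Set E3 :=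
  𝒯.elementMap x S '' refSimplex

/-- The restriction to an element of the finite element basis function `φ_j[x]`: its pullback to
the unit simplex is the Lagrange basis polynomial of the node `j` (zero if `j` is not a node of the
element). -/
def basisFun (x : 𝒯.Node k → E3) (S : 𝒯.simplices) (j : 𝒯.Node k) (y : E3) : ℝ :=
  ∑ α : LocalNode k,
    if 𝒯.dof S α = j then shape α (Function.invFunOn (𝒯.elementMap x S) refSimplex y) else 0

/-! Integrals over `Ω_h(x)` are sums of the integrals over its elements. -/

/-- The mass matrix `M(x)`. -/
def massMatrix (x : 𝒯.Node k → E3) : Matrix (𝒯.Node k) (𝒯.Node k) ℝ :=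
  Matrix.of fun j l => ∑ S : 𝒯.simplices, ∫ y in 𝒯.element x S,
    𝒯.basisFun x S j y * 𝒯.basisFun x S l y

/-- The stiffness matrix `A(x)`. -/
def stiffMatrix (x : 𝒯.Node k → E3) : Matrix (𝒯.Node k) (𝒯.Node k) ℝ :=
  Matrix.of fun j l => ∑ S : 𝒯.simplices, ∫ y in 𝒯.element x S,
    ⟪gradient (𝒯.basisFun x S j) y, gradient (𝒯.basisFun x S l) y⟫

/-- The load vector of a function `g`. -/
def loadVector (g : E3 → ℝ) (x : 𝒯.Node k → E3) : 𝒯.Node k → ℝ :=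
  fun j => ∑ S : 𝒯.simplices, ∫ y in 𝒯.element x S, g y * 𝒯.basisFun x S j y

/-- The block `M₂₂(x)` of the mass matrix (interior nodes). -/
def massMatrix22 (x : 𝒯.Node k → E3) : Matrix (𝒯.IntNode k) (𝒯.IntNode k) ℝ :=
  (𝒯.massMatrix x).submatrix Subtype.val Subtype.val

/-- The block `A₂₂(x)` of the stiffness matrix (interior nodes). -/
def stiffMatrix22 (x : 𝒯.Node k → E3) : Matrix (𝒯.IntNode k) (𝒯.IntNode k) ℝ :=
  (𝒯.stiffMatrix x).submatrix Subtype.val Subtype.val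

/-- The block `A₂₁(x)` of the stiffness matrix (interior rows, boundary columns). -/
def stiffMatrix21 (x : 𝒯.Node k → E3) : Matrix (𝒯.IntNode k) (𝒯.BdryNode k) ℝ :=
  (𝒯.stiffMatrix x).submatrix Subtype.val Subtype.val

/-! ### Semi-discretisation, interpolated exact solution, defects -/

/-- `(x, w, u)` is a solution on `[0, T]` of the matrix-vector formulation of the semi-discrete
problem: `w = dx/dt` is the nodal velocity, equal to `vΓ` in the boundary nodes and discretely
harmonic, and `d/dt (M(x) u) + A(x) u = f(x)`; the initial values are `x₀` and `u₀`. -/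
structure IsSemidiscreteSolution (T : ℝ) (f : ℝ → E3 → ℝ) (vΓ : ℝ → E3 → E3) (u₀ : E3 → ℝ)
    (x w : ℝ → 𝒯.Node k → E3) (u : ℝ → 𝒯.Node k → ℝ) : Prop where
  x_zero : ∀ p : 𝒯.Node k, x 0 p = p
  u_zero : ∀ p : 𝒯.Node k, u 0 p = u₀ p
  position : ∀ t ∈ Icc 0 T, HasDerivWithinAt x (w t) (Icc 0 T) t
  boundary_velocity : ∀ t ∈ Icc 0 T, ∀ p : 𝒯.BdryNode k, w t p = vΓ t (x t p)
  velocity : ∀ t ∈ Icc 0 T, ∀ i : Fin 3,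
    𝒯.stiffMatrix22 (x t) *ᵥ (fun p => w t p i)
      = -(𝒯.stiffMatrix21 (x t) *ᵥ fun p => w t p i)
  diffusion : ∀ t ∈ Icc 0 T,
    HasDerivWithinAt (fun s => 𝒯.massMatrix (x s) *ᵥ u s)
      (𝒯.loadVector (f t) (x t) - 𝒯.stiffMatrix (x t) *ᵥ u t) (Icc 0 T) t

variable (k) in
/-- The nodal vector `x*(t)` of the exact positions of the nodes. -/
def exactPos (X : ℝ → E3 → E3) (t : ℝ) : 𝒯.Node k → E3 := fun p => X t p

variable (k) in
/-- The nodal vector `u*(t)` (or `v*(t)`) of the values of the exact solution in the exact nodes. -/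
def exactVal {F : Type} (X : ℝ → E3 → E3) (g : ℝ → E3 → F) (t : ℝ) : 𝒯.Node k → F :=
  fun p => g t (X t p)

/-- `d` is the defect of the interpolated exact velocity in the discrete velocity law:
`A₂₂(x*) v*^Ω = - A₂₁(x*) v*^Γ + M₂₂(x*) d`, componentwise. -/
def IsVelocityDefect (T : ℝ) (X v : ℝ → E3 → E3) (d : ℝ → 𝒯.IntNode k → E3) : Prop :=
  ∀ t ∈ Icc 0 T, ∀ i : Fin 3,
    𝒯.stiffMatrix22 (𝒯.exactPos k X t) *ᵥ (fun p => 𝒯.exactVal k X v t p i)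
      = -(𝒯.stiffMatrix21 (𝒯.exactPos k X t) *ᵥ fun p => 𝒯.exactVal k X v t p i)
        + 𝒯.massMatrix22 (𝒯.exactPos k X t) *ᵥ fun p => d t p i

/-- `d` is the defect of the interpolated exact solution in the discrete diffusion equation:
`d/dt (M(x*) u*) + A(x*) u* = f(x*) + M(x*) d`. -/
def IsDiffusionDefect (T : ℝ) (f : ℝ → E3 → ℝ) (X : ℝ → E3 → E3) (u : ℝ → E3 → ℝ)
    (d : ℝ → 𝒯.Node k → ℝ) : Prop :=
  ∀ t ∈ Icc 0 T,
    HasDerivWithinAt (fun s => 𝒯.massMatrix (𝒯.exactPos k X s) *ᵥ 𝒯.exactVal k X u s)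
      (𝒯.loadVector (f t) (𝒯.exactPos k X t) + 𝒯.massMatrix (𝒯.exactPos k X t) *ᵥ d t
        - 𝒯.stiffMatrix (𝒯.exactPos k X t) *ᵥ 𝒯.exactVal k X u t) (Icc 0 T) t

/-- The dual norm `(dᵀ M (M + A)⁻¹ M d)^(1/2)`, with matrices at `x`, of a nodal vector `d`. -/
def dualNorm (x : 𝒯.Node k → E3) (d : 𝒯.Node k → ℝ) : ℝ :=
  √(d ⬝ᵥ ((𝒯.massMatrix x * (𝒯.massMatrix x + 𝒯.stiffMatrix x)⁻¹ * 𝒯.massMatrix x) *ᵥ d))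

/-- The dual norm `(dᵀ M₂₂ A₂₂⁻¹ M₂₂ d)^(1/2)`, with matrices at `x`, of a nodal vector `d` with
three components that lives in the interior nodes. -/
def dualNorm₀ (x : 𝒯.Node k → E3) (d : 𝒯.IntNode k → E3) : ℝ :=
  √(∑ i : Fin 3, (fun p => d p i) ⬝ᵥ
    ((𝒯.massMatrix22 x * (𝒯.stiffMatrix22 x)⁻¹ * 𝒯.massMatrix22 x) *ᵥ fun p => d p i))

end ExactTriangulation

/-- The square `wᵀ K w` of the (semi-)norm induced by a matrix `K`. -/
def matNormSq {ι : Type} [Fintype ι] (K : Matrix ι ι ℝ) (w : ι → ℝ) : ℝ := w ⬝ᵥ (K *ᵥ w)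

end HarmonicFEM

end

open HarmonicFEM

set_option linter.unusedSectionVars false

noncomputable section

namespace HarmonicFEM

/-! All matrices are pulled back to one fixed reference space: a disjoint union of copies of the
unit simplex, weighted by the volumes of the flat tetrahedra. There the integrands depend on the
nodal vector `x` only through position and Jacobian at a point, gradients being taken with respect
to the flat mesh. Comparing the forms at the discrete positions `x` and the exact ones `x*` thus
reduces to perturbing determinants and inverses of well-conditioned linear maps of space
(`exists_formBounds`). The differences are controlled by the H¹ seminorm of `x - x*`, because the
other argument is an interpolant of the exact solution, with values and gradient bounded in the
maximum norm.

Positions: the velocity error vanishes at the boundary nodes, since these follow the same ODE as the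
exact ones. Testing with it bounds its energy by the position error and the dual norm of `d_v`
(`IsStable.jacSq_velocity_sub_le`), and Gronwall bounds the position error by the time integral of
the squared defect. This presupposes that the Jacobians of `x` and `x*` stay uniformly close. An
inverse estimate turns the energy bound into a pointwise one at the price `h⁻³` for squares, so the
squared pointwise error is of order `h^(2κ-3)`. Since `κ > 3/2`, this is small on fine meshes, and a
continuity argument carries the closeness through all of `[0, T]` (`IsStable.position_stability`).

Diffusion: the energy of the error in the mass matrix at `x` is differentiated. Young's inequality
absorbs error gradients into the dissipation, the rest consists of position errors, velocity errors
and defects, and Gronwall concludes (`IsStable.diffusion_stability`).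

Uniformity in the mesh: `exists_isStable` proves Poincaré's inequality on the flat mesh by
integrating along lines, and the inverse estimate by scaling. `exists_interpolation_error` shows
that interpolants of C¹ functions have nearly constant differential on each small simplex. Hence the
element maps at `x*`, and at positions near `x*`, are injective, and the matrices over the elements
do equal the reference integrals (`IsRegular`). -/

/-! ### Determinants, inverses and integrands near well-conditioned linear maps. -/

lemma contDiff_det {n : WithTop ℕ∞} : ContDiff ℝ n (fun H : E3 →L[ℝ] E3 => H.det) := by
  have h : (fun H : E3 →L[ℝ] E3 => H.det) = fun H => ∑ s : Equiv.Perm (Fin 3),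
      ((Equiv.Perm.sign s : ℤ) : ℝ) * ∏ i, (H (EuclideanSpace.basisFun (Fin 3) ℝ i)) (s i) := by
    funext H
    rw [ContinuousLinearMap.det,
      ← LinearMap.det_toMatrix (EuclideanSpace.basisFun (Fin 3) ℝ).toBasis, Matrix.det_apply']
    refine Finset.sum_congr rfl fun s _ => ?_
    congr 1
    refine Finset.prod_congr rfl fun i _ => ?_
    simp [LinearMap.toMatrix_apply]
  rw [h]
  refine ContDiff.sum fun s _ => contDiff_const.mul (contDiff_prod fun i _ => ?_)
  exact (EuclideanSpace.proj (s i) : E3 →L[ℝ] ℝ).contDiff.comp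
    (ContinuousLinearMap.apply ℝ E3 (EuclideanSpace.basisFun (Fin 3) ℝ i)).contDiff

/-- A `C¹` function on a finite-dimensional space is bounded and Lipschitz on balls. -/
lemma exists_bound_lipschitz_closedBall {E F : Type*} [NormedAddCommGroup E] [NormedSpace ℝ E]
    [FiniteDimensional ℝ E] [NormedAddCommGroup F] [NormedSpace ℝ F] {g : E → F}
    (hg : ContDiff ℝ 1 g) (R : ℝ) :
    ∃ C, 0 ≤ C ∧ (∀ x, ‖x‖ ≤ R → ‖g x‖ ≤ C) ∧
      ∀ x y, ‖x‖ ≤ R → ‖y‖ ≤ R → ‖g x - g y‖ ≤ C * ‖x - y‖ := by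
  have : ProperSpace E := FiniteDimensional.proper_real E
  obtain ⟨C₁, h₁⟩ := (isCompact_closedBall (0 : E) R).exists_bound_of_continuousOn
    hg.continuous.continuousOn
  obtain ⟨K, hK⟩ := ContDiffOn.exists_lipschitzOnWith (s := Metric.closedBall (0 : E) R)
    hg.contDiffOn one_ne_zero (convex_closedBall _ _) (isCompact_closedBall _ _)
  refine ⟨max (max C₁ K) 0, le_max_right _ _, fun x hx => ?_, fun x y hx hy => ?_⟩
  · exact (h₁ x (by simpa using hx)).trans ((le_max_left _ _).trans (le_max_left _ _))
  · have := hK.dist_le_mul x (by simpa using hx) y (by simpa using hy)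
    rw [dist_eq_norm, dist_eq_norm] at this
    exact this.trans (mul_le_mul_of_nonneg_right
      ((le_max_right _ _).trans (le_max_left _ _)) (norm_nonneg _))

/-- The derivative of the absolute value of the determinant. -/
def dabsDet (H : E3 →L[ℝ] E3) (K : E3 →L[ℝ] E3) : ℝ :=
  (SignType.sign H.det : ℝ) * fderiv ℝ (fun H : E3 →L[ℝ] E3 => H.det) H K

/-- The integrand of the stiffness form in the coordinates given by a map with differential `H`. -/
def stiffInt (H : E3 →L[ℝ] E3) (p p' : StrongDual ℝ E3) : ℝ :=
  ⟪(InnerProductSpace.toDual ℝ E3).symm (p ∘L H.inverse),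
    (InnerProductSpace.toDual ℝ E3).symm (p' ∘L H.inverse)⟫ * |H.det|

/-- Invertible maps with bounded norm and bounded inverse. -/
structure GoodMap (Λ : ℝ) (H : E3 →L[ℝ] E3) : Prop where
  inv : H.IsInvertible
  norm_le : ‖H‖ ≤ Λ
  norm_inverse_le : ‖H.inverse‖ ≤ Λ

/-- The lower bound gives injectivity, hence bijectivity in finite dimension; applied to a preimage
it bounds the inverse. -/
lemma isInvertible_of_antilipschitz {H : E3 →L[ℝ] E3} {a : ℝ} (ha : 0 < a)
    (h : ∀ x, a * ‖x‖ ≤ ‖H x‖) : H.IsInvertible ∧ ‖H.inverse‖ ≤ 1 / a := by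
  have hinj : Function.Injective (H : E3 →ₗ[ℝ] E3) := by
    rw [injective_iff_map_eq_zero]
    intro x hx
    have h1 := h x
    have h2 : H x = 0 := hx
    rw [h2, norm_zero] at h1
    have : ‖x‖ ≤ 0 := by
      by_contra hc
      push Not at hc
      nlinarith [mul_pos ha hc]
    simpa using this
  have hinv : H.IsInvertible :=
    ⟨(LinearEquiv.ofInjectiveEndo (H : E3 →ₗ[ℝ] E3) hinj).toContinuousLinearEquiv, by ext x; simp⟩
  refine ⟨hinv, ContinuousLinearMap.opNorm_le_bound _ (by positivity) fun y => ?_⟩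
  have h1 := h (H.inverse y)
  rw [hinv.self_apply_inverse] at h1
  rw [one_div, inv_mul_eq_div, le_div_iff₀ ha]
  linarith

lemma GoodMap.le_norm_apply {Λ : ℝ} {H : E3 →L[ℝ] E3} (hΛ : 0 < Λ) (h : GoodMap Λ H) (x : E3) :
    Λ⁻¹ * ‖x‖ ≤ ‖H x‖ := by
  rw [inv_mul_le_iff₀ hΛ]
  calc ‖x‖ = ‖H.inverse (H x)‖ := by rw [h.inv.inverse_apply_self]
    _ ≤ ‖H.inverse‖ * ‖H x‖ := ContinuousLinearMap.le_opNorm _ _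
    _ ≤ Λ * ‖H x‖ := by gcongr; exact h.norm_inverse_le

/-- The radius is half of the lower bound `Λ⁻¹` of `H`, so half of that bound survives. -/
lemma GoodMap.perturb {Λ : ℝ} {H H' : E3 →L[ℝ] E3} (hΛ : 1 ≤ Λ) (h : GoodMap Λ H)
    (hd : ‖H' - H‖ ≤ (2 * Λ)⁻¹) : GoodMap (2 * Λ) H' := by
  have hΛ0 : 0 < Λ := by linarith
  have key : ∀ x, (2 * Λ)⁻¹ * ‖x‖ ≤ ‖H' x‖ := by
    intro x
    have h1 := h.le_norm_apply hΛ0 x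
    have h2 : ‖(H' - H) x‖ ≤ (2 * Λ)⁻¹ * ‖x‖ :=
      ((H' - H).le_opNorm x).trans (by gcongr)
    have h3 : ‖H x‖ ≤ ‖H' x‖ + ‖(H' - H) x‖ := by
      have : H x = H' x - (H' - H) x := by simp
      rw [this]; exact norm_sub_le _ _
    have h4 : (2 * Λ)⁻¹ = Λ⁻¹ / 2 := by rw [mul_inv]; ring
    rw [h4] at h2 ⊢
    have h6 : Λ⁻¹ / 2 * ‖x‖ = Λ⁻¹ * ‖x‖ / 2 := by ring
    rw [h6] at *
    linarith
  obtain ⟨hi, hn⟩ := isInvertible_of_antilipschitz (by positivity) key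
  refine ⟨hi, ?_, by simpa using hn⟩
  have : ‖H'‖ ≤ ‖H' - H‖ + ‖H‖ := by simpa using norm_add_le (H' - H) H
  have h5 : (2 * Λ)⁻¹ ≤ 1 := inv_le_one_of_one_le₀ (by linarith)
  linarith [h.norm_le]

/-- Resolvent identity: `H'⁻¹ - H⁻¹ = H'⁻¹ (H - H') H⁻¹`. -/
lemma GoodMap.inverse_sub_le {Λ : ℝ} {H H' : E3 →L[ℝ] E3} (hΛ : 0 ≤ Λ) (h : GoodMap Λ H)
    (h' : GoodMap Λ H') : ‖H'.inverse - H.inverse‖ ≤ Λ ^ 2 * ‖H' - H‖ := by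
  have : H'.inverse - H.inverse = H'.inverse ∘L (H - H') ∘L H.inverse := by
    ext1 x
    simp only [_root_.sub_apply, ContinuousLinearMap.comp_apply, map_sub,
      h.inv.self_apply_inverse, h'.inv.inverse_apply_self]
  rw [this]
  calc _ ≤ ‖H'.inverse‖ * (‖H - H'‖ * ‖H.inverse‖) :=
        (ContinuousLinearMap.opNorm_comp_le _ _).trans
          (mul_le_mul_of_nonneg_left (ContinuousLinearMap.opNorm_comp_le _ _) (norm_nonneg _))
    _ ≤ Λ * (‖H - H'‖ * Λ) := by
        gcongr
        exacts [h'.norm_inverse_le, h.norm_inverse_le]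
    _ = _ := by rw [norm_sub_rev]; ring

lemma det_mul_det_inverse {H : E3 →L[ℝ] E3} (h : H.IsInvertible) :
    H.det * H.inverse.det = 1 := by
  have h1 := h.self_comp_inverse
  have h2 : (H ∘L H.inverse).det = 1 := by rw [h1]; simp [ContinuousLinearMap.det]
  rw [← h2, ContinuousLinearMap.det, ContinuousLinearMap.det, ContinuousLinearMap.det,
    ContinuousLinearMap.toLinearMap_comp, LinearMap.det_comp]

/-- Pointwise bounds for the integrands of the bilinear forms at `H'`, near a good map `H`. -/
structure FormBounds (C : ℝ) (H H' : E3 →L[ℝ] E3) : Prop where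
  inv : H'.IsInvertible
  det_le : |H'.det| ≤ C
  le_det : C⁻¹ ≤ |H'.det|
  det_sub : |(|H'.det| - |H.det|)| ≤ C * ‖H' - H‖
  dabsDet_le : ∀ K, |dabsDet H' K| ≤ C * ‖K‖
  dabsDet_sub : ∀ K K', |dabsDet H' K' - dabsDet H K| ≤ C * (‖H' - H‖ * ‖K‖ + ‖K' - K‖)
  stiff_le : ∀ p p', |stiffInt H' p p'| ≤ C * ‖p‖ * ‖p'‖
  le_stiff : ∀ p, C⁻¹ * ‖p‖ ^ 2 ≤ stiffInt H' p p
  stiff_sub : ∀ p p', |stiffInt H' p p' - stiffInt H p p'| ≤ C * ‖H' - H‖ * ‖p‖ * ‖p'‖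

lemma GoodMap.mono {Λ Λ' : ℝ} {H : E3 →L[ℝ] E3} (h : GoodMap Λ H) (hΛ : Λ ≤ Λ') :
    GoodMap Λ' H := ⟨h.inv, h.norm_le.trans hΛ, h.norm_inverse_le.trans hΛ⟩

/-- The determinant and its derivative are bounded and Lipschitz on bounded sets, and inversion is
Lipschitz on well-conditioned maps. The absolute value is the only non-smooth ingredient: `ε` is so
small that the determinant cannot change sign between `H` and `H'`. -/
lemma exists_formBounds {Λ : ℝ} (hΛ : 1 ≤ Λ) : ∃ C, 1 ≤ C ∧ ∃ ε, 0 < ε ∧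
    ∀ H, GoodMap Λ H → ∀ H', ‖H' - H‖ ≤ ε → FormBounds C H H' := by
  obtain ⟨D₁, hD₁, hdet₁, hdetL₁⟩ := exists_bound_lipschitz_closedBall
    (contDiff_det (n := 1)) (2 * Λ)
  obtain ⟨D₂, hD₂, hfd₂, hfdL₂⟩ := exists_bound_lipschitz_closedBall
    ((contDiff_det (n := 2)).fderiv_right (m := 1) (by norm_num)) (2 * Λ)
  set R := 2 * Λ with hR
  have hR1 : 1 ≤ R := by linarith
  set D := max (max D₁ D₂) 1 with hD
  have hD1 : 1 ≤ D := le_max_right _ _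
  have hDD₁ : D₁ ≤ D := (le_max_left _ _).trans (le_max_left _ _)
  have hDD₂ : D₂ ≤ D := (le_max_right _ _).trans (le_max_left _ _)
  have hdet : ∀ H : E3 →L[ℝ] E3, ‖H‖ ≤ R → |H.det| ≤ D := fun H h => (hdet₁ H h).trans hDD₁
  have hdetL : ∀ H H' : E3 →L[ℝ] E3, ‖H‖ ≤ R → ‖H'‖ ≤ R → |H.det - H'.det| ≤ D * ‖H - H'‖ :=
    fun H H' h h' => (hdetL₁ H H' h h').trans (by gcongr)
  have hfd : ∀ H : E3 →L[ℝ] E3, ‖H‖ ≤ R →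
      ‖fderiv ℝ (fun H : E3 →L[ℝ] E3 => H.det) H‖ ≤ D := fun H h => (hfd₂ H h).trans hDD₂
  have hfdL : ∀ H H' : E3 →L[ℝ] E3, ‖H‖ ≤ R → ‖H'‖ ≤ R →
      ‖fderiv ℝ (fun H : E3 →L[ℝ] E3 => H.det) H - fderiv ℝ (fun H : E3 →L[ℝ] E3 => H.det) H'‖
        ≤ D * ‖H - H'‖ := fun H H' h h' => (hfdL₂ H H' h h').trans (by gcongr)
  have hC1 : (1 : ℝ) ≤ 2 * R ^ 3 + R ^ 2 := by
    nlinarith [one_le_pow₀ hR1 (n := 3), one_le_pow₀ hR1 (n := 2)]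
  have hC2 : R ^ 2 ≤ 2 * R ^ 3 + R ^ 2 := by nlinarith [one_le_pow₀ hR1 (n := 3)]
  -- Dictated by the product rule for `stiffInt`: each of the two inverses contributes `D * R ^ 3`,
  -- the determinant contributes `D * R ^ 2`.
  set C := D * (2 * R ^ 3 + R ^ 2) with hC
  have hDC : D ≤ C := le_mul_of_one_le_right (by linarith) hC1
  have hRC : D * R ^ 2 ≤ C := by rw [hC]; gcongr
  refine ⟨C, hD1.trans hDC, min (2 * Λ)⁻¹ (2 * D ^ 2)⁻¹, by positivity, fun H hH H' hd => ?_⟩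
  have hH' : GoodMap R H' := hH.perturb hΛ (hd.trans (min_le_left _ _))
  replace hH : GoodMap R H := hH.mono (by linarith)
  -- A determinant is bounded below because the determinant of the inverse is bounded above.
  have hlow : ∀ K, GoodMap R K → D⁻¹ ≤ |K.det| := fun K hK => by
    have h1 := det_mul_det_inverse hK.inv
    have h2 := hdet _ hK.norm_inverse_le
    rw [inv_le_iff_one_le_mul₀ (by linarith)]
    calc 1 = |K.det| * |K.inverse.det| := by rw [← abs_mul, h1, abs_one]
      _ ≤ _ := by gcongr
  have hsub := hdetL H' H hH'.norm_le hH.norm_le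
  -- The determinant moves by at most `D⁻¹ / 2`, less than its distance `D⁻¹` from zero, so the sign
  -- is preserved.
  have hpos : 0 < H.det * H'.det := by
    have h1 : |H'.det - H.det| < |H.det| := by
      calc |H'.det - H.det| ≤ D * (2 * D ^ 2)⁻¹ :=
            hsub.trans (mul_le_mul_of_nonneg_left (hd.trans (min_le_right _ _)) (by linarith))
        _ = D⁻¹ / 2 := by field_simp
        _ < D⁻¹ := by have : 0 < D⁻¹ := by positivity
                      linarith
        _ ≤ _ := hlow H hH
    rcases lt_or_ge H.det 0 with h | h
    · rw [abs_of_neg h, abs_lt] at h1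
      nlinarith
    · rw [abs_of_nonneg h, abs_lt] at h1
      nlinarith
  have hsign : (SignType.sign H'.det : ℝ) = SignType.sign H.det := by
    rcases pos_and_pos_or_neg_and_neg_of_mul_pos hpos with h | h
    · simp [sign_pos h.1, sign_pos h.2]
    · simp [sign_neg h.1, sign_neg h.2]
  have hsign1 : |(SignType.sign H.det : ℝ)| ≤ 1 := by
    rcases pos_and_pos_or_neg_and_neg_of_mul_pos hpos with h | h
    · simp [sign_pos h.1]
    · simp [sign_neg h.1]
  have hcomp : ∀ K : E3 →L[ℝ] E3, GoodMap R K → ∀ p : StrongDual ℝ E3,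
      ‖p ∘L K.inverse‖ ≤ ‖p‖ * R := fun K hK p =>
    (ContinuousLinearMap.opNorm_comp_le _ _).trans (by gcongr; exact hK.norm_inverse_le)
  have hinner : ∀ K : E3 →L[ℝ] E3, GoodMap R K → ∀ p p' : StrongDual ℝ E3,
      |⟪(InnerProductSpace.toDual ℝ E3).symm (p ∘L K.inverse),
        (InnerProductSpace.toDual ℝ E3).symm (p' ∘L K.inverse)⟫| ≤ R ^ 2 * ‖p‖ * ‖p'‖ :=
    fun K hK p p' => by
      refine (abs_real_inner_le_norm _ _).trans ?_
      rw [LinearIsometryEquiv.norm_map, LinearIsometryEquiv.norm_map]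
      calc _ ≤ (‖p‖ * R) * (‖p'‖ * R) := by
            gcongr
            exacts [hcomp K hK p, hcomp K hK p']
        _ = _ := by ring
  refine ⟨hH'.inv, (hdet _ hH'.norm_le).trans hDC,
    (inv_anti₀ (by linarith) hDC).trans (hlow _ hH'),
    (abs_abs_sub_abs_le _ _).trans (hsub.trans (by gcongr)), fun K => ?_, fun K K' => ?_,
    fun p p' => ?_, fun p => ?_, fun p p' => ?_⟩
  · rw [dabsDet, hsign, abs_mul]
    calc _ ≤ 1 * (‖fderiv ℝ (fun H : E3 →L[ℝ] E3 => H.det) H'‖ * ‖K‖) := by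
          gcongr
          exact (fderiv ℝ (fun H : E3 →L[ℝ] E3 => H.det) H').le_opNorm K
      _ ≤ C * ‖K‖ := by
          rw [one_mul]; gcongr; exact (hfd _ hH'.norm_le).trans hDC
  · rw [dabsDet, dabsDet, hsign, ← mul_sub, abs_mul]
    have e : fderiv ℝ (fun H : E3 →L[ℝ] E3 => H.det) H' K' -
        fderiv ℝ (fun H : E3 →L[ℝ] E3 => H.det) H K =
        (fderiv ℝ (fun H : E3 →L[ℝ] E3 => H.det) H' -
          fderiv ℝ (fun H : E3 →L[ℝ] E3 => H.det) H) K +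
        fderiv ℝ (fun H : E3 →L[ℝ] E3 => H.det) H' (K' - K) := by
      simp only [_root_.sub_apply, map_sub]; ring
    rw [e]
    calc _ ≤ 1 * ((D * ‖H' - H‖) * ‖K‖ + D * ‖K' - K‖) := by
          gcongr
          refine (abs_add_le _ _).trans (add_le_add ?_ ?_)
          · exact (ContinuousLinearMap.le_opNorm _ _).trans
              (mul_le_mul_of_nonneg_right (hfdL _ _ hH'.norm_le hH.norm_le) (norm_nonneg _))
          · exact (ContinuousLinearMap.le_opNorm _ _).trans
              (mul_le_mul_of_nonneg_right (hfd _ hH'.norm_le) (norm_nonneg _))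
      _ = D * (‖H' - H‖ * ‖K‖ + ‖K' - K‖) := by ring
      _ ≤ _ := by gcongr
  · rw [stiffInt, abs_mul, abs_abs]
    calc _ ≤ (R ^ 2 * ‖p‖ * ‖p'‖) * D := by
          gcongr
          exacts [hinner _ hH' _ _, hdet _ hH'.norm_le]
      _ = D * R ^ 2 * ‖p‖ * ‖p'‖ := by ring
      _ ≤ _ := by gcongr
  · rw [stiffInt, real_inner_self_eq_norm_sq, LinearIsometryEquiv.norm_map]
    have h1 : ‖p‖ ≤ ‖p ∘L H'.inverse‖ * R := by
      have : p = (p ∘L H'.inverse) ∘L H' := by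
        ext x; simp [hH'.inv.inverse_apply_self]
      conv_lhs => rw [this]
      exact (ContinuousLinearMap.opNorm_comp_le _ _).trans (by gcongr; exact hH'.norm_le)
    calc C⁻¹ * ‖p‖ ^ 2 ≤ (D * R ^ 2)⁻¹ * (‖p ∘L H'.inverse‖ * R) ^ 2 := by
          gcongr
      _ = ‖p ∘L H'.inverse‖ ^ 2 * D⁻¹ := by field_simp
      _ ≤ _ := by gcongr; exact hlow _ hH'
  · have hdiff : ∀ p : StrongDual ℝ E3, ‖p ∘L H'.inverse - p ∘L H.inverse‖ ≤
        ‖p‖ * (R ^ 2 * ‖H' - H‖) := fun p => by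
      rw [← ContinuousLinearMap.comp_sub]
      exact (ContinuousLinearMap.opNorm_comp_le _ _).trans
        (by gcongr; exact hH.inverse_sub_le (by linarith) hH')
    have e : stiffInt H' p p' - stiffInt H p p' =
        (⟪(InnerProductSpace.toDual ℝ E3).symm (p ∘L H'.inverse - p ∘L H.inverse),
            (InnerProductSpace.toDual ℝ E3).symm (p' ∘L H'.inverse)⟫ +
          ⟪(InnerProductSpace.toDual ℝ E3).symm (p ∘L H.inverse),
            (InnerProductSpace.toDual ℝ E3).symm (p' ∘L H'.inverse - p' ∘L H.inverse)⟫) * |H'.det|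
        + ⟪(InnerProductSpace.toDual ℝ E3).symm (p ∘L H.inverse),
            (InnerProductSpace.toDual ℝ E3).symm (p' ∘L H.inverse)⟫ * (|H'.det| - |H.det|) := by
      simp only [stiffInt, map_sub, inner_sub_left, inner_sub_right]; ring
    rw [e]
    have i1 : |⟪(InnerProductSpace.toDual ℝ E3).symm (p ∘L H'.inverse - p ∘L H.inverse),
            (InnerProductSpace.toDual ℝ E3).symm (p' ∘L H'.inverse)⟫| ≤
        (‖p‖ * (R ^ 2 * ‖H' - H‖)) * (‖p'‖ * R) := by
      refine (abs_real_inner_le_norm _ _).trans ?_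
      rw [LinearIsometryEquiv.norm_map, LinearIsometryEquiv.norm_map]
      gcongr
      exacts [hdiff p, hcomp _ hH' _]
    have i2 : |⟪(InnerProductSpace.toDual ℝ E3).symm (p ∘L H.inverse),
            (InnerProductSpace.toDual ℝ E3).symm (p' ∘L H'.inverse - p' ∘L H.inverse)⟫| ≤
        (‖p‖ * R) * (‖p'‖ * (R ^ 2 * ‖H' - H‖)) := by
      refine (abs_real_inner_le_norm _ _).trans ?_
      rw [LinearIsometryEquiv.norm_map, LinearIsometryEquiv.norm_map]
      gcongr
      exacts [hcomp _ hH _, hdiff p']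
    have i3 := hinner _ hH p p'
    have i4 : |(|H'.det| - |H.det|)| ≤ D * ‖H' - H‖ :=
      (abs_abs_sub_abs_le _ _).trans hsub
    refine (abs_add_le _ _).trans ?_
    rw [abs_mul, abs_mul, abs_abs]
    calc _ ≤ ((‖p‖ * (R ^ 2 * ‖H' - H‖)) * (‖p'‖ * R) +
          (‖p‖ * R) * (‖p'‖ * (R ^ 2 * ‖H' - H‖))) * D +
          (R ^ 2 * ‖p‖ * ‖p'‖) * (D * ‖H' - H‖) := by
          gcongr
          · exact (abs_add_le _ _).trans (add_le_add i1 i2)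
          · exact hdet _ hH'.norm_le
      _ = C * ‖H' - H‖ * ‖p‖ * ‖p'‖ := by rw [hC]; ring

/-! ### A differential inequality -/

/-- Gronwall's lemma, with an integrated dissipation term. -/
lemma gronwall_dissipation {T C : ℝ} (hT : 0 ≤ T) (hC : 0 ≤ C) {y y' m δ : ℝ → ℝ}
    (hy : ∀ t ∈ Icc 0 T, HasDerivWithinAt y (y' t) (Icc 0 T) t)
    (hm : ContinuousOn m (Icc 0 T)) (hδ : ContinuousOn δ (Icc 0 T))
    (hm0 : ∀ t ∈ Icc 0 T, 0 ≤ m t) (hδ0 : ∀ t ∈ Icc 0 T, 0 ≤ δ t) (hy0 : y 0 = 0)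
    (h : ∀ t ∈ Icc 0 T, y' t ≤ C * (y t + δ t) - m t) :
    y T + ∫ s in (0 : ℝ)..T, m s ≤ C * Real.exp (C * T) * ∫ s in (0 : ℝ)..T, δ s := by
  have hexp : Continuous fun s : ℝ => Real.exp (-(C * s)) := by fun_prop
  have hm' : ContinuousOn (fun s => Real.exp (-(C * s)) * m s) (Icc 0 T) :=
    hexp.continuousOn.mul hm
  have hδ' : ContinuousOn (fun s => Real.exp (-(C * s)) * δ s) (Icc 0 T) :=
    hexp.continuousOn.mul hδ
  have huIcc : uIcc 0 T = Icc 0 T := uIcc_of_le hT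
  have hint : ∀ {g : ℝ → ℝ}, ContinuousOn g (Icc 0 T) → IntervalIntegrable g volume 0 T :=
    fun hg => ContinuousOn.intervalIntegrable (by rwa [huIcc])
  have hprim : ∀ {g : ℝ → ℝ}, ContinuousOn g (Icc 0 T) →
      ContinuousOn (fun t => ∫ s in (0 : ℝ)..t, g s) (Icc 0 T) := fun {g} hg => by
    have := intervalIntegral.continuousOn_primitive_interval (μ := volume) (f := g)
      (a := 0) (b := T) (by rw [huIcc]; exact hg.integrableOn_Icc)
    rwa [huIcc] at this
  have hderiv : ∀ {g : ℝ → ℝ}, ContinuousOn g (Icc 0 T) → ∀ t ∈ Ioo 0 T,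
      HasDerivAt (fun t => ∫ s in (0 : ℝ)..t, g s) (g t) t := fun {g} hg t ht => by
    refine intervalIntegral.integral_hasDerivAt_right ?_ ?_ ?_
    · refine (hint hg).mono_set ?_
      rw [huIcc, uIcc_of_le ht.1.le]
      exact Icc_subset_Icc_right ht.2.le
    · exact ContinuousOn.stronglyMeasurableAtFilter isOpen_Ioo (hg.mono Ioo_subset_Icc_self) t ht
    · exact hg.continuousAt (Icc_mem_nhds ht.1 ht.2)
  -- With the integrating factor, `Ψ' = exp (-C t) * (y' - C y + m - C δ)`, which the hypothesis
  -- makes nonpositive.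
  set Ψ : ℝ → ℝ := fun t => Real.exp (-(C * t)) * y t
    + (∫ s in (0 : ℝ)..t, Real.exp (-(C * s)) * m s)
    - C * ∫ s in (0 : ℝ)..t, Real.exp (-(C * s)) * δ s with hΨ
  have hder : ∀ t ∈ Ioo 0 T, HasDerivAt Ψ (Real.exp (-(C * t)) * (-C) * y t
      + Real.exp (-(C * t)) * y' t + Real.exp (-(C * t)) * m t
      - C * (Real.exp (-(C * t)) * δ t)) t := fun t ht => by
    have h1 : HasDerivAt (fun s : ℝ => Real.exp (-(C * s))) (Real.exp (-(C * t)) * (-C)) t := by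
      have := ((hasDerivAt_id t).const_mul C).neg.exp
      simpa using this
    have h2 : HasDerivAt y (y' t) t :=
      (hy t (Ioo_subset_Icc_self ht)).hasDerivAt (Icc_mem_nhds ht.1 ht.2)
    exact ((h1.mul h2).add (hderiv hm' t ht)).sub ((hderiv hδ' t ht).const_mul C)
  have hanti : AntitoneOn Ψ (Icc 0 T) := by
    refine antitoneOn_of_deriv_nonpos (convex_Icc 0 T) ?_ ?_ ?_
    · exact ((hexp.continuousOn.mul fun t ht => (hy t ht).continuousWithinAt).add
        (hprim hm')).sub (continuousOn_const.mul (hprim hδ'))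
    · rw [interior_Icc]
      exact fun t ht => (hder t ht).differentiableAt.differentiableWithinAt
    · rw [interior_Icc]
      intro t ht
      rw [(hder t ht).deriv]
      have h1 := h t (Ioo_subset_Icc_self ht)
      have h2 := Real.exp_pos (-(C * t))
      nlinarith [mul_le_mul_of_nonneg_left h1 h2.le]
  have hfin := hanti (left_mem_Icc.2 hT) (right_mem_Icc.2 hT) hT
  simp only [hΨ, hy0, mul_zero, intervalIntegral.integral_same, add_zero, sub_zero] at hfin
  -- The weight `exp (-C s)` is at least `exp (-C T)` under the dissipation and at most one under
  -- the source.
  have h1 : Real.exp (-(C * T)) * ∫ s in (0 : ℝ)..T, m s ≤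
      ∫ s in (0 : ℝ)..T, Real.exp (-(C * s)) * m s := by
    rw [← intervalIntegral.integral_const_mul]
    refine intervalIntegral.integral_mono_on hT ((hint hm).const_mul _) (hint hm') fun s hs => ?_
    exact mul_le_mul_of_nonneg_right (Real.exp_le_exp.2 (by nlinarith [hs.2])) (hm0 s hs)
  have h2 : ∫ s in (0 : ℝ)..T, Real.exp (-(C * s)) * δ s ≤ ∫ s in (0 : ℝ)..T, δ s := by
    refine intervalIntegral.integral_mono_on hT (hint hδ') (hint hδ) fun s hs => ?_
    refine mul_le_of_le_one_left (hδ0 s hs) (Real.exp_le_one_iff.2 ?_)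
    nlinarith [hs.1]
  have h3 : Real.exp (-(C * T)) * (y T + ∫ s in (0 : ℝ)..T, m s) ≤
      C * ∫ s in (0 : ℝ)..T, δ s := by
    nlinarith [mul_le_mul_of_nonneg_left h2 hC]
  calc y T + ∫ s in (0 : ℝ)..T, m s
      = Real.exp (C * T) * (Real.exp (-(C * T)) * (y T + ∫ s in (0 : ℝ)..T, m s)) := by
        rw [← mul_assoc, ← Real.exp_add]; simp
    _ ≤ Real.exp (C * T) * (C * ∫ s in (0 : ℝ)..T, δ s) := by gcongr
    _ = _ := by ring

/-! ### Matrices -/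

/-- Young's inequality for the pairing of the norm of a matrix and the dual norm. -/
lemma posDef_young {ι : Type*} [Fintype ι] [DecidableEq ι] {K : Matrix ι ι ℝ} (hK : K.PosDef)
    (z b : ι → ℝ) {η : ℝ} (hη : 0 < η) :
    |z ⬝ᵥ b| ≤ η * (z ⬝ᵥ (K *ᵥ z)) + (4 * η)⁻¹ * (b ⬝ᵥ (K⁻¹ *ᵥ b)) := by
  have hdet : IsUnit K.det := (Matrix.isUnit_iff_isUnit_det K).1 hK.isUnit
  have hsymm : Kᵀ = K := by simpa using hK.1.eq
  set w := K⁻¹ *ᵥ b with hw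
  have hKw : K *ᵥ w = b := by
    rw [hw, Matrix.mulVec_mulVec, Matrix.mul_nonsing_inv _ hdet, Matrix.one_mulVec]
  have hwz : w ⬝ᵥ (K *ᵥ z) = z ⬝ᵥ b := by
    rw [Matrix.dotProduct_mulVec, ← Matrix.mulVec_transpose, hsymm, hKw, dotProduct_comm]
  -- The quadratic form is nonnegative at `z - r K⁻¹ b`. The choices `r = ±1 / (2 η)`, multiplied by
  -- `η`, give the two halves of the absolute value.
  have key : ∀ r : ℝ, 0 ≤ z ⬝ᵥ (K *ᵥ z) - 2 * r * (z ⬝ᵥ b) + r ^ 2 * (b ⬝ᵥ w) := fun r => by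
    have h := hK.posSemidef.dotProduct_mulVec_nonneg (z - r • w)
    simp only [star_trivial, Matrix.mulVec_sub, Matrix.mulVec_smul, sub_dotProduct,
      dotProduct_sub, smul_dotProduct, dotProduct_smul, smul_eq_mul, hKw, hwz] at h
    rw [dotProduct_comm b w]
    nlinarith
  have h1 := key (2 * η)⁻¹
  have h2 := key (-(2 * η)⁻¹)
  have e1 : η * (2 * (2 * η)⁻¹ * (z ⬝ᵥ b)) = z ⬝ᵥ b := by field_simp
  have e2 : η * (((2 * η)⁻¹) ^ 2 * (b ⬝ᵥ w)) = (4 * η)⁻¹ * (b ⬝ᵥ w) := by field_simp; ring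
  rw [abs_le]
  constructor
  · have := mul_nonneg hη.le h2
    nlinarith
  · have := mul_nonneg hη.le h1
    nlinarith

/-! ### Finite element spaces over a reference space -/

/-- Basis functions, and their gradients, as continuous functions on a reference space. -/
structure FESpace (Y N : Type) [TopologicalSpace Y] where
  φ : N → Y → ℝ
  g : N → Y → StrongDual ℝ E3
  continuous_φ : ∀ j, Continuous (φ j)
  continuous_g : ∀ j, Continuous (g j)

attribute [fun_prop] FESpace.continuous_φ FESpace.continuous_g

namespace FESpace

variable {Y N : Type} [TopologicalSpace Y] [Fintype N] (𝔽 : FESpace Y N)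

/-- The function with nodal values `z`. -/
def val (z : N → ℝ) (y : Y) : ℝ := ∑ j, z j * 𝔽.φ j y

/-- The gradient of the function with nodal values `z`. -/
def grad (z : N → ℝ) (y : Y) : StrongDual ℝ E3 := ∑ j, z j • 𝔽.g j y

/-- The vector-valued function with nodal values `x`. -/
def pos (x : N → E3) (y : Y) : E3 := ∑ j, 𝔽.φ j y • x j

/-- The differential of the vector-valued function with nodal values `x`, as a linear function
of `x`. -/
def jacL (y : Y) : (N → E3) →L[ℝ] E3 →L[ℝ] E3 :=
  ∑ j, (ContinuousLinearMap.smulRightL ℝ E3 E3 (𝔽.g j y)) ∘L ContinuousLinearMap.proj j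

/-- The differential of the vector-valued function with nodal values `x`. -/
def jac (x : N → E3) (y : Y) : E3 →L[ℝ] E3 := 𝔽.jacL y x

/-- The square of the Frobenius norm of the differential. -/
def frobSq (x : N → E3) (y : Y) : ℝ := ∑ i, ‖𝔽.grad (fun j => x j i) y‖ ^ 2

lemma jac_apply (x : N → E3) (y : Y) (e : E3) : 𝔽.jac x y e = ∑ j, 𝔽.g j y e • x j := by
  simp [jac, jacL]

lemma jac_apply_apply (x : N → E3) (y : Y) (e : E3) (i : Fin 3) :
    𝔽.jac x y e i = 𝔽.grad (fun j => x j i) y e := by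
  simp [jac_apply, grad, mul_comm]

lemma pos_apply (x : N → E3) (y : Y) (i : Fin 3) :
    𝔽.pos x y i = 𝔽.val (fun j => x j i) y := by
  simp [pos, val, mul_comm]

lemma pos_sub (x x' : N → E3) (y : Y) : 𝔽.pos (x - x') y = 𝔽.pos x y - 𝔽.pos x' y := by
  simp [pos, smul_sub, Finset.sum_sub_distrib]

lemma jac_sub (x x' : N → E3) (y : Y) : 𝔽.jac (x - x') y = 𝔽.jac x y - 𝔽.jac x' y := by
  simp [jac]

lemma norm_grad_le (x : N → E3) (y : Y) (i : Fin 3) :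
    ‖𝔽.grad (fun j => x j i) y‖ ≤ ‖𝔽.jac x y‖ := by
  refine ContinuousLinearMap.opNorm_le_bound _ (norm_nonneg _) fun e => ?_
  rw [← jac_apply_apply]
  exact (PiLp.norm_apply_le _ i).trans (ContinuousLinearMap.le_opNorm _ _)

lemma sq_norm_jac_le (x : N → E3) (y : Y) : ‖𝔽.jac x y‖ ^ 2 ≤ 𝔽.frobSq x y := by
  have h0 : 0 ≤ 𝔽.frobSq x y := Finset.sum_nonneg fun i _ => by positivity
  have : ‖𝔽.jac x y‖ ≤ √(𝔽.frobSq x y) := by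
    refine ContinuousLinearMap.opNorm_le_bound _ (Real.sqrt_nonneg _) fun e => ?_
    rw [EuclideanSpace.norm_eq, ← Real.sqrt_sq (norm_nonneg e), ← Real.sqrt_mul h0]
    refine Real.sqrt_le_sqrt ?_
    rw [frobSq, Finset.sum_mul]
    refine Finset.sum_le_sum fun i _ => ?_
    rw [jac_apply_apply, ← mul_pow]
    exact pow_le_pow_left₀ (norm_nonneg _) (ContinuousLinearMap.le_opNorm _ _) 2
  calc _ ≤ √(𝔽.frobSq x y) ^ 2 := by gcongr
    _ = _ := Real.sq_sqrt h0

lemma sq_norm_pos (x : N → E3) (y : Y) :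
    ‖𝔽.pos x y‖ ^ 2 = ∑ i, 𝔽.val (fun j => x j i) y ^ 2 := by
  rw [EuclideanSpace.norm_eq, Real.sq_sqrt (Finset.sum_nonneg fun i _ => by positivity)]
  simp [pos_apply]

@[fun_prop]
lemma continuous_val (z : N → ℝ) : Continuous (𝔽.val z) := by unfold val; fun_prop

@[fun_prop]
lemma continuous_grad (z : N → ℝ) : Continuous (𝔽.grad z) := by unfold grad; fun_prop

@[fun_prop]
lemma continuous_pos (x : N → E3) : Continuous (𝔽.pos x) := by unfold pos; fun_prop

@[fun_prop]
lemma continuous_jacL : Continuous 𝔽.jacL := by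
  rw [continuous_clm_apply]
  intro x
  rw [continuous_clm_apply]
  intro e
  change Continuous fun y => 𝔽.jac x y e
  simp only [jac_apply]
  fun_prop

@[fun_prop]
lemma continuous_jac (x : N → E3) : Continuous (𝔽.jac x) := by unfold jac; fun_prop

@[fun_prop]
lemma continuous_frobSq (x : N → E3) : Continuous (𝔽.frobSq x) := by unfold frobSq; fun_prop

end FESpace

/-! ### Continuity of the integrands -/

lemma continuousAt_inverse {H : E3 →L[ℝ] E3} (h : H.IsInvertible) :
    ContinuousAt (ContinuousLinearMap.inverse : (E3 →L[ℝ] E3) → E3 →L[ℝ] E3) H :=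
  (h.contDiffAt_map_inverse (n := 1)).continuousAt

lemma det_ne_zero_of_isInvertible {H : E3 →L[ℝ] E3} (h : H.IsInvertible) : H.det ≠ 0 := by
  intro h0
  simpa [h0] using det_mul_det_inverse h

lemma continuousAt_stiffInt {H : E3 →L[ℝ] E3} (h : H.IsInvertible) (p p' : StrongDual ℝ E3) :
    ContinuousAt (fun z : (E3 →L[ℝ] E3) × StrongDual ℝ E3 × StrongDual ℝ E3 =>
      stiffInt z.1 z.2.1 z.2.2) (H, p, p') := by
  have hi : ContinuousAt (fun z : (E3 →L[ℝ] E3) × StrongDual ℝ E3 × StrongDual ℝ E3 =>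
      z.1.inverse) (H, p, p') :=
    ContinuousAt.comp (g := ContinuousLinearMap.inverse) (continuousAt_inverse h)
      continuousAt_fst
  have h1 : ContinuousAt (fun z : (E3 →L[ℝ] E3) × StrongDual ℝ E3 × StrongDual ℝ E3 =>
      (InnerProductSpace.toDual ℝ E3).symm (z.2.1 ∘L z.1.inverse)) (H, p, p') :=
    (InnerProductSpace.toDual ℝ E3).symm.continuous.continuousAt.comp
      (ContinuousAt.clm_comp (by fun_prop) hi)
  have h2 : ContinuousAt (fun z : (E3 →L[ℝ] E3) × StrongDual ℝ E3 × StrongDual ℝ E3 =>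
      (InnerProductSpace.toDual ℝ E3).symm (z.2.2 ∘L z.1.inverse)) (H, p, p') :=
    (InnerProductSpace.toDual ℝ E3).symm.continuous.continuousAt.comp
      (ContinuousAt.clm_comp (by fun_prop) hi)
  refine (h1.inner h2).mul ?_
  exact ((ContinuousLinearMap.continuous_det.comp continuous_fst).abs).continuousAt

/-- The sign factor is locally constant where the determinant does not vanish. -/
lemma continuousAt_dabsDet {H : E3 →L[ℝ] E3} (h : H.det ≠ 0) (K : E3 →L[ℝ] E3) :
    ContinuousAt (fun z : (E3 →L[ℝ] E3) × (E3 →L[ℝ] E3) => dabsDet z.1 z.2) (H, K) := by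
  have hdet : Continuous fun z : (E3 →L[ℝ] E3) × (E3 →L[ℝ] E3) => z.1.det :=
    ContinuousLinearMap.continuous_det.comp continuous_fst
  have hs : ContinuousAt (fun z : (E3 →L[ℝ] E3) × (E3 →L[ℝ] E3) =>
      (SignType.sign z.1.det : ℝ)) (H, K) := by
    have : ContinuousAt (fun z : (E3 →L[ℝ] E3) × (E3 →L[ℝ] E3) => SignType.sign z.1.det) (H, K) :=
      ContinuousAt.comp (g := SignType.sign) (f := fun z : (E3 →L[ℝ] E3) × (E3 →L[ℝ] E3) => z.1.det)
        (continuousAt_sign_of_ne_zero h) hdet.continuousAt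
    exact (continuous_of_discreteTopology (f := fun s : SignType => (s : ℝ))).continuousAt.comp this
  refine hs.mul ?_
  have := (contDiff_det (n := 1)).continuous_fderiv one_ne_zero
  exact ((this.comp continuous_fst).clm_apply continuous_snd).continuousAt

lemma stiffInt_sum_left {N : Type} (s : Finset N) (H : E3 →L[ℝ] E3) (z : N → ℝ)
    (g : N → StrongDual ℝ E3) (p : StrongDual ℝ E3) :
    stiffInt H (∑ j ∈ s, z j • g j) p = ∑ j ∈ s, z j * stiffInt H (g j) p := by
  have : (∑ j ∈ s, z j • g j) ∘L H.inverse = ∑ j ∈ s, z j • (g j ∘L H.inverse) := by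
    ext x; simp
  simp only [stiffInt, this, map_sum, map_smul, sum_inner, Finset.sum_mul]
  refine Finset.sum_congr rfl fun j _ => ?_
  simp [inner_smul_left]; ring

lemma stiffInt_comm (H : E3 →L[ℝ] E3) (p p' : StrongDual ℝ E3) :
    stiffInt H p p' = stiffInt H p' p := by
  simp only [stiffInt, real_inner_comm]

lemma stiffInt_sum_right {N : Type} (s : Finset N) (H : E3 →L[ℝ] E3) (z : N → ℝ)
    (g : N → StrongDual ℝ E3) (p : StrongDual ℝ E3) :
    stiffInt H p (∑ j ∈ s, z j • g j) = ∑ j ∈ s, stiffInt H p (g j) * z j := by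
  rw [stiffInt_comm, stiffInt_sum_left]
  exact Finset.sum_congr rfl fun j _ => by rw [stiffInt_comm, mul_comm]

/-! ### Mass, stiffness and load as integrals over the reference space, and their perturbation. -/

namespace FESpace

variable {Y N : Type} [TopologicalSpace Y] [Fintype N] (𝔽 : FESpace Y N)
  [CompactSpace Y] [MeasurableSpace Y] [OpensMeasurableSpace Y] (ν : Measure Y) [IsFiniteMeasure ν]

/-- The mass matrix of the domain with nodal vector `x`. -/
def mass (x : N → E3) : Matrix N N ℝ :=
  Matrix.of fun j l => ∫ y, 𝔽.φ j y * 𝔽.φ l y * |(𝔽.jac x y).det| ∂ν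

/-- The stiffness matrix of the domain with nodal vector `x`. -/
def stiff (x : N → E3) : Matrix N N ℝ :=
  Matrix.of fun j l => ∫ y, stiffInt (𝔽.jac x y) (𝔽.g j y) (𝔽.g l y) ∂ν

/-- The load vector of the domain with nodal vector `x`. -/
def load (f : E3 → ℝ) (x : N → E3) : N → ℝ :=
  fun j => ∫ y, f (𝔽.pos x y) * 𝔽.φ j y * |(𝔽.jac x y).det| ∂ν

/-- The derivative of the mass matrix in the direction `w`. -/
def dmass (x w : N → E3) : Matrix N N ℝ :=
  Matrix.of fun j l => ∫ y, 𝔽.φ j y * 𝔽.φ l y * dabsDet (𝔽.jac x y) (𝔽.jac w y) ∂ν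

/-- The square of the `L²` norm on the reference space. -/
def normSq (z : N → ℝ) : ℝ := ∫ y, 𝔽.val z y ^ 2 ∂ν

/-- The square of the `H¹` seminorm on the reference space. -/
def gradSq (z : N → ℝ) : ℝ := ∫ y, ‖𝔽.grad z y‖ ^ 2 ∂ν

/-- The square of the `H¹` seminorm of vector-valued functions on the reference space. -/
def jacSq (x : N → E3) : ℝ := ∫ y, 𝔽.frobSq x y ∂ν

end FESpace

lemma integrable_of_continuous {Y : Type} [TopologicalSpace Y] [CompactSpace Y]
    [MeasurableSpace Y] [OpensMeasurableSpace Y] (ν : Measure Y) [IsFiniteMeasure ν] {F : Y → ℝ}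
    (hF : Continuous F) : Integrable F ν := by
  obtain ⟨C, hC⟩ := isCompact_univ.exists_bound_of_continuousOn hF.continuousOn
  exact Integrable.of_bound hF.aestronglyMeasurable C
    (Filter.Eventually.of_forall fun y => hC y (mem_univ y))

lemma dotProduct_integral_mulVec {Y N : Type} [MeasurableSpace Y] [Fintype N] (ν : Measure Y)
    (B : N → N → Y → ℝ) (hB : ∀ j l, Integrable (B j l) ν) (z z' : N → ℝ) :
    z ⬝ᵥ ((Matrix.of fun j l => ∫ y, B j l y ∂ν) *ᵥ z') =
      ∫ y, ∑ j, ∑ l, z j * (B j l y * z' l) ∂ν := by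
  have h : ∀ j l, Integrable (fun y => z j * (B j l y * z' l)) ν :=
    fun j l => ((hB j l).mul_const _).const_mul _
  rw [integral_finsetSum _ fun j _ => integrable_finsetSum _ fun l _ => h j l]
  simp only [dotProduct, mulVec, Finset.mul_sum, Matrix.of_apply]
  refine Finset.sum_congr rfl fun j _ => ?_
  rw [integral_finsetSum _ fun l _ => h j l]
  refine Finset.sum_congr rfl fun l _ => ?_
  rw [integral_const_mul, integral_mul_const]

lemma abs_integral_le_add {Y : Type} [TopologicalSpace Y] [CompactSpace Y] [MeasurableSpace Y]
    [OpensMeasurableSpace Y] (ν : Measure Y) [IsFiniteMeasure ν] {F A B : Y → ℝ} {a b : ℝ}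
    (hA : Continuous A) (hB : Continuous B)
    (h : ∀ y, |F y| ≤ a * A y + b * B y) : |∫ y, F y ∂ν| ≤ a * ∫ y, A y ∂ν + b * ∫ y, B y ∂ν := by
  have hAi := (integrable_of_continuous ν hA).const_mul a
  have hBi := (integrable_of_continuous ν hB).const_mul b
  rw [← integral_const_mul, ← integral_const_mul, ← integral_add hAi hBi, ← Real.norm_eq_abs]
  exact norm_integral_le_of_norm_le (hAi.add hBi) (Filter.Eventually.of_forall h)

namespace FESpace

variable {Y N : Type} [TopologicalSpace Y] [Fintype N] (𝔽 : FESpace Y N)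
  [CompactSpace Y] [MeasurableSpace Y] [OpensMeasurableSpace Y] (ν : Measure Y) [IsFiniteMeasure ν]

@[fun_prop]
lemma continuous_absDet (x : N → E3) : Continuous fun y => |(𝔽.jac x y).det| :=
  (ContinuousLinearMap.continuous_det.comp (𝔽.continuous_jac x)).abs

lemma continuous_stiffInt {x : N → E3} (hx : ∀ y, (𝔽.jac x y).IsInvertible)
    {p p' : Y → StrongDual ℝ E3} (hp : Continuous p) (hp' : Continuous p') :
    Continuous fun y => stiffInt (𝔽.jac x y) (p y) (p' y) :=
  continuous_iff_continuousAt.2 fun y =>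
    ContinuousAt.comp (f := fun y => (𝔽.jac x y, p y, p' y)) (continuousAt_stiffInt (hx y) _ _)
      (by fun_prop)

lemma continuous_dabsDet {x : N → E3} (hx : ∀ y, (𝔽.jac x y).IsInvertible) (w : N → E3) :
    Continuous fun y => dabsDet (𝔽.jac x y) (𝔽.jac w y) :=
  continuous_iff_continuousAt.2 fun y =>
    ContinuousAt.comp (f := fun y => (𝔽.jac x y, 𝔽.jac w y))
      (continuousAt_dabsDet (det_ne_zero_of_isInvertible (hx y)) _) (by fun_prop)

lemma dot_mass (x : N → E3) (z z' : N → ℝ) : z ⬝ᵥ (𝔽.mass ν x *ᵥ z') =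
    ∫ y, 𝔽.val z y * 𝔽.val z' y * |(𝔽.jac x y).det| ∂ν := by
  rw [mass, dotProduct_integral_mulVec _ _ fun j l => integrable_of_continuous ν (by fun_prop)]
  congr 1; funext y
  rw [val, val, Finset.sum_mul_sum, Finset.sum_mul]
  simp only [Finset.sum_mul]
  exact Finset.sum_congr rfl fun j _ => Finset.sum_congr rfl fun l _ => by ring

lemma dot_dmass {x : N → E3} (hx : ∀ y, (𝔽.jac x y).IsInvertible) (w : N → E3) (z z' : N → ℝ) :
    z ⬝ᵥ (𝔽.dmass ν x w *ᵥ z') =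
      ∫ y, 𝔽.val z y * 𝔽.val z' y * dabsDet (𝔽.jac x y) (𝔽.jac w y) ∂ν := by
  have := 𝔽.continuous_dabsDet hx w
  rw [dmass, dotProduct_integral_mulVec _ _ fun j l => integrable_of_continuous ν (by fun_prop)]
  congr 1; funext y
  rw [val, val, Finset.sum_mul_sum, Finset.sum_mul]
  simp only [Finset.sum_mul]
  exact Finset.sum_congr rfl fun j _ => Finset.sum_congr rfl fun l _ => by ring

lemma dot_stiff {x : N → E3} (hx : ∀ y, (𝔽.jac x y).IsInvertible) (z z' : N → ℝ) :
    z ⬝ᵥ (𝔽.stiff ν x *ᵥ z') = ∫ y, stiffInt (𝔽.jac x y) (𝔽.grad z y) (𝔽.grad z' y) ∂ν := by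
  rw [stiff, dotProduct_integral_mulVec _ _ fun j l => integrable_of_continuous ν
    (𝔽.continuous_stiffInt hx (𝔽.continuous_g j) (𝔽.continuous_g l))]
  congr 1; funext y
  simp only [grad, stiffInt_sum_left, stiffInt_sum_right, Finset.sum_mul]
  rw [Finset.sum_comm]
  exact Finset.sum_congr rfl fun j _ => Finset.sum_congr rfl fun l _ => by ring

lemma dot_load {x : N → E3} {f : E3 → ℝ} (hf : Continuous fun y => f (𝔽.pos x y)) (z : N → ℝ) :
    z ⬝ᵥ 𝔽.load ν f x = ∫ y, f (𝔽.pos x y) * 𝔽.val z y * |(𝔽.jac x y).det| ∂ν := by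
  simp only [dotProduct, load]
  have : ∀ j, Continuous fun y => f (𝔽.pos x y) * 𝔽.φ j y * |(𝔽.jac x y).det| :=
    fun j => (hf.mul (by fun_prop)).mul (by fun_prop)
  rw [← Finset.sum_congr rfl fun j _ => integral_const_mul (z j) _,
    ← integral_finsetSum _ fun j _ => (integrable_of_continuous ν (this j)).const_mul _]
  congr 1; funext y
  simp only [val, Finset.mul_sum, Finset.sum_mul]
  exact Finset.sum_congr rfl fun j _ => by ring

lemma mass_transpose (x : N → E3) : (𝔽.mass ν x)ᵀ = 𝔽.mass ν x := by
  ext j l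
  simp only [mass, Matrix.transpose_apply, Matrix.of_apply]
  congr 1; funext y; ring

lemma stiff_transpose (x : N → E3) : (𝔽.stiff ν x)ᵀ = 𝔽.stiff ν x := by
  ext j l
  simp only [stiff, Matrix.transpose_apply, Matrix.of_apply]
  congr 1; funext y; rw [stiffInt_comm]

lemma normSq_nonneg (z : N → ℝ) : 0 ≤ 𝔽.normSq ν z := integral_nonneg fun _ => sq_nonneg _

lemma gradSq_nonneg (z : N → ℝ) : 0 ≤ 𝔽.gradSq ν z := integral_nonneg fun _ => sq_nonneg _

lemma jacSq_eq_sum (x : N → E3) : 𝔽.jacSq ν x = ∑ i, 𝔽.gradSq ν fun j => x j i := by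
  simp only [jacSq, frobSq, gradSq]
  exact integral_finsetSum _ fun i _ => integrable_of_continuous ν (by fun_prop)

lemma jacSq_nonneg (x : N → E3) : 0 ≤ 𝔽.jacSq ν x := by
  rw [jacSq_eq_sum]; exact Finset.sum_nonneg fun i _ => 𝔽.gradSq_nonneg ν _

variable {C : ℝ} {x xs : N → E3} (h : ∀ y, FormBounds C (𝔽.jac xs y) (𝔽.jac x y))
include h

lemma mass_le (z : N → ℝ) : z ⬝ᵥ (𝔽.mass ν x *ᵥ z) ≤ C * 𝔽.normSq ν z := by
  rw [dot_mass, normSq, ← integral_const_mul]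
  refine integral_mono (integrable_of_continuous ν (by fun_prop))
    (integrable_of_continuous ν (by fun_prop)) fun y => ?_
  have := (h y).det_le
  simp only
  nlinarith [sq_nonneg (𝔽.val z y)]

lemma le_mass (z : N → ℝ) : C⁻¹ * 𝔽.normSq ν z ≤ z ⬝ᵥ (𝔽.mass ν x *ᵥ z) := by
  rw [dot_mass, normSq, ← integral_const_mul]
  refine integral_mono (integrable_of_continuous ν (by fun_prop))
    (integrable_of_continuous ν (by fun_prop)) fun y => ?_
  have := (h y).le_det
  simp only
  nlinarith [sq_nonneg (𝔽.val z y)]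

lemma stiff_le (z : N → ℝ) : z ⬝ᵥ (𝔽.stiff ν x *ᵥ z) ≤ C * 𝔽.gradSq ν z := by
  rw [dot_stiff _ _ fun y => (h y).inv, gradSq, ← integral_const_mul]
  refine integral_mono (integrable_of_continuous ν (𝔽.continuous_stiffInt (fun y => (h y).inv)
    (by fun_prop) (by fun_prop))) (integrable_of_continuous ν (by fun_prop)) fun y => ?_
  have := (le_abs_self _).trans ((h y).stiff_le (𝔽.grad z y) (𝔽.grad z y))
  simpa [sq, mul_assoc] using this

lemma le_stiff (z : N → ℝ) : C⁻¹ * 𝔽.gradSq ν z ≤ z ⬝ᵥ (𝔽.stiff ν x *ᵥ z) := by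
  rw [dot_stiff _ _ fun y => (h y).inv, gradSq, ← integral_const_mul]
  exact integral_mono (integrable_of_continuous ν (by fun_prop))
    (integrable_of_continuous ν (𝔽.continuous_stiffInt (fun y => (h y).inv)
    (by fun_prop) (by fun_prop))) fun y => (h y).le_stiff _

variable (hs : ∀ y, (𝔽.jac xs y).IsInvertible)

/-- The vector `z'` will come from the exact solution, so a maximum bound for it is available and
the determinant difference may be measured in L². The term `normSq` of the error is harmless, since
Gronwall absorbs it. -/
lemma mass_sub_le {K : ℝ} {z' : N → ℝ} (hK : ∀ y, |𝔽.val z' y| ≤ K)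
    (z : N → ℝ) : |z ⬝ᵥ (𝔽.mass ν x *ᵥ z') - z ⬝ᵥ (𝔽.mass ν xs *ᵥ z')| ≤
      𝔽.normSq ν z + (C * K) ^ 2 * 𝔽.jacSq ν (x - xs) := by
  rw [dot_mass, dot_mass, ← integral_sub (integrable_of_continuous ν (by fun_prop))
    (integrable_of_continuous ν (by fun_prop)), ← one_mul (𝔽.normSq ν z), normSq, jacSq]
  refine abs_integral_le_add ν (by fun_prop) (by fun_prop) fun y => ?_
  rw [← mul_sub, abs_mul, abs_mul]
  have h1 := (h y).det_sub
  have h2 := 𝔽.sq_norm_jac_le (x - xs) y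
  rw [jac_sub] at h2
  have hK0 := (abs_nonneg _).trans (hK y)
  calc _ ≤ |𝔽.val z y| * K * (C * ‖𝔽.jac x y - 𝔽.jac xs y‖) := by gcongr; exact hK y
    _ ≤ 1 * |𝔽.val z y| ^ 2 + (C * K) ^ 2 * ‖𝔽.jac x y - 𝔽.jac xs y‖ ^ 2 := by
      nlinarith [sq_nonneg (|𝔽.val z y| - (C * K) * ‖𝔽.jac x y - 𝔽.jac xs y‖),
        sq_nonneg (|𝔽.val z y|), sq_nonneg ((C * K) * ‖𝔽.jac x y - 𝔽.jac xs y‖)]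
    _ ≤ _ := by rw [sq_abs]; gcongr

include hs in
-- In contrast to the mass term, the gradient of `z` is controlled only by the dissipation; the free
-- parameter `η` allows it to be absorbed there.
lemma stiff_sub_le {K : ℝ} {z' : N → ℝ} (hK : ∀ y, ‖𝔽.grad z' y‖ ≤ K) {η : ℝ} (hη : 0 < η)
    (z : N → ℝ) : |z ⬝ᵥ (𝔽.stiff ν x *ᵥ z') - z ⬝ᵥ (𝔽.stiff ν xs *ᵥ z')| ≤
      η * 𝔽.gradSq ν z + (4 * η)⁻¹ * (C * K) ^ 2 * 𝔽.jacSq ν (x - xs) := by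
  have hi := fun y => (h y).inv
  rw [dot_stiff _ _ hi, dot_stiff _ _ hs, ← integral_sub
    (integrable_of_continuous ν (𝔽.continuous_stiffInt hi (by fun_prop) (by fun_prop)))
    (integrable_of_continuous ν (𝔽.continuous_stiffInt hs (by fun_prop) (by fun_prop))), gradSq,
    jacSq]
  refine abs_integral_le_add ν (by fun_prop) (by fun_prop) fun y => ?_
  have h1 := (h y).stiff_sub (𝔽.grad z y) (𝔽.grad z' y)
  have h2 := 𝔽.sq_norm_jac_le (x - xs) y
  rw [jac_sub] at h2
  have hC : 0 ≤ C := (abs_nonneg _).trans (h y).det_le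
  set a := ‖𝔽.grad z y‖
  set b := C * K * ‖𝔽.jac x y - 𝔽.jac xs y‖ with hb
  calc _ ≤ C * ‖𝔽.jac x y - 𝔽.jac xs y‖ * a * K := h1.trans (by gcongr; exact hK y)
    _ = a * b := by rw [hb]; ring
    _ ≤ η * a ^ 2 + (4 * η)⁻¹ * b ^ 2 := by
      have : η * a ^ 2 + (4 * η)⁻¹ * b ^ 2 - a * b = η * (a - (2 * η)⁻¹ * b) ^ 2 := by
        field_simp; ring
      nlinarith [mul_nonneg hη.le (sq_nonneg (a - (2 * η)⁻¹ * b))]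
    _ = η * a ^ 2 + (4 * η)⁻¹ * (C * K) ^ 2 * ‖𝔽.jac x y - 𝔽.jac xs y‖ ^ 2 := by rw [hb]; ring
    _ ≤ _ := by gcongr

/-- Both arguments are the error here, so the velocity gradient has to be bounded in the maximum
norm. This is why pointwise control of the discrete velocity is needed later. -/
lemma dmass_le {K : ℝ} {w : N → E3} (hK : ∀ y, ‖𝔽.jac w y‖ ≤ K) (z : N → ℝ) :
    |z ⬝ᵥ (𝔽.dmass ν x w *ᵥ z)| ≤ C * K * 𝔽.normSq ν z := by
  rw [dot_dmass _ _ fun y => (h y).inv, normSq]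
  have := abs_integral_le_add ν (A := fun y => 𝔽.val z y ^ 2) (B := fun _ => 0) (a := C * K)
    (b := 0) (F := fun y => 𝔽.val z y * 𝔽.val z y * dabsDet (𝔽.jac x y) (𝔽.jac w y))
    (by fun_prop) (by fun_prop) fun y => ?_
  · simpa using this
  have hC : 0 ≤ C := (abs_nonneg _).trans (h y).det_le
  have h1 := ((h y).dabsDet_le (𝔽.jac w y)).trans (mul_le_mul_of_nonneg_left (hK y) hC)
  rw [abs_mul, ← sq, abs_of_nonneg (sq_nonneg (𝔽.val z y))]
  nlinarith [sq_nonneg (𝔽.val z y)]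

include hs in
-- `dabsDet` is linear in its second argument, so the velocity error enters next to the position
-- error, which is multiplied by the bound for the exact velocity gradient.
lemma dmass_sub_le {K : ℝ} {z' : N → ℝ} {w ws : N → E3} (hK : ∀ y, |𝔽.val z' y| ≤ K)
    (hK' : ∀ y, ‖𝔽.jac ws y‖ ≤ K) (z : N → ℝ) :
    |z ⬝ᵥ (𝔽.dmass ν x w *ᵥ z') - z ⬝ᵥ (𝔽.dmass ν xs ws *ᵥ z')| ≤
      𝔽.normSq ν z + (C * K) ^ 2 * (K ^ 2 * 𝔽.jacSq ν (x - xs) + 𝔽.jacSq ν (w - ws)) := by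
  have hi := fun y => (h y).inv
  have c1 := 𝔽.continuous_dabsDet hi w
  have c2 := 𝔽.continuous_dabsDet hs ws
  have e : K ^ 2 * 𝔽.jacSq ν (x - xs) + 𝔽.jacSq ν (w - ws) =
      ∫ y, K ^ 2 * 𝔽.frobSq (x - xs) y + 𝔽.frobSq (w - ws) y ∂ν := by
    rw [jacSq, jacSq, integral_add (integrable_of_continuous ν (by fun_prop))
      (integrable_of_continuous ν (by fun_prop)), integral_const_mul]
  rw [dot_dmass _ _ hi, dot_dmass _ _ hs, ← integral_sub
    (integrable_of_continuous ν (by fun_prop)) (integrable_of_continuous ν (by fun_prop)), e,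
    ← one_mul (𝔽.normSq ν z), normSq]
  refine abs_integral_le_add ν (by fun_prop) (by fun_prop) fun y => ?_
  have h1 := (h y).dabsDet_sub (𝔽.jac ws y) (𝔽.jac w y)
  have h2 := 𝔽.sq_norm_jac_le (x - xs) y
  have h3 := 𝔽.sq_norm_jac_le (w - ws) y
  rw [jac_sub] at h2 h3
  rw [← mul_sub, abs_mul, abs_mul]
  have hC : 0 ≤ C := (abs_nonneg _).trans (h y).det_le
  have hK0 := (abs_nonneg _).trans (hK y)
  set a := |𝔽.val z y| with ha
  set E := ‖𝔽.jac x y - 𝔽.jac xs y‖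
  set F := ‖𝔽.jac w y - 𝔽.jac ws y‖
  calc _ ≤ a * K * (C * (E * K + F)) := by
        gcongr
        · exact hK y
        · exact h1.trans (by gcongr; exact hK' y)
    _ ≤ 1 * a ^ 2 + (C * K) ^ 2 * (K ^ 2 * E ^ 2 + F ^ 2) := by
      nlinarith [sq_nonneg (a - C * K * (E * K + F) / 2), mul_nonneg (sq_nonneg (C * K)) (sq_nonneg (E * K - F)),
        mul_nonneg (sq_nonneg (C * K)) (sq_nonneg (E * K + F)), sq_nonneg (C * K * (E * K)),
        sq_nonneg (C * K * F)]
    _ ≤ _ := by rw [ha, sq_abs]; gcongr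

/-- Moving the nodes changes both the point where `f` is evaluated and the volume element; hence the
position error appears in L² as well as in the H¹ seminorm. -/
lemma load_sub_le {K : ℝ} {f : E3 → ℝ} (hf : Continuous f)
    (hK : ∀ y, |f (𝔽.pos xs y)| ≤ K)
    (hK' : ∀ y, |f (𝔽.pos x y) - f (𝔽.pos xs y)| ≤ K * ‖𝔽.pos x y - 𝔽.pos xs y‖) (z : N → ℝ) :
    |z ⬝ᵥ 𝔽.load ν f x - z ⬝ᵥ 𝔽.load ν f xs| ≤ 𝔽.normSq ν z +
      (C * K) ^ 2 * ((∑ i, 𝔽.normSq ν fun j => (x - xs) j i) + 𝔽.jacSq ν (x - xs)) := by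
  have e : (∑ i, 𝔽.normSq ν fun j => (x - xs) j i) + 𝔽.jacSq ν (x - xs) =
      ∫ y, ‖𝔽.pos (x - xs) y‖ ^ 2 + 𝔽.frobSq (x - xs) y ∂ν := by
    simp only [sq_norm_pos, normSq]
    rw [jacSq, integral_add (integrable_of_continuous ν (by fun_prop))
      (integrable_of_continuous ν (by fun_prop)),
      integral_finsetSum _ fun i _ => integrable_of_continuous ν (by fun_prop)]
  rw [dot_load _ _ (by fun_prop), dot_load _ _ (by fun_prop), ← integral_sub
    (integrable_of_continuous ν (by fun_prop)) (integrable_of_continuous ν (by fun_prop)), e,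
    ← one_mul (𝔽.normSq ν z), normSq]
  refine abs_integral_le_add ν (by fun_prop) (by fun_prop) fun y => ?_
  have h1 := (h y).det_sub
  have h2 := 𝔽.sq_norm_jac_le (x - xs) y
  have h3 := (h y).det_le
  have h4 := hK y
  have h5 := hK' y
  rw [jac_sub] at h2
  rw [pos_sub]
  have hC : 0 ≤ C := (abs_nonneg _).trans h3
  have hK0 := (abs_nonneg _).trans (hK y)
  have e2 : f (𝔽.pos x y) * 𝔽.val z y * |(𝔽.jac x y).det| -
      f (𝔽.pos xs y) * 𝔽.val z y * |(𝔽.jac xs y).det| =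
      𝔽.val z y * ((f (𝔽.pos x y) - f (𝔽.pos xs y)) * |(𝔽.jac x y).det| +
      f (𝔽.pos xs y) * (|(𝔽.jac x y).det| - |(𝔽.jac xs y).det|)) := by ring
  rw [e2, abs_mul]
  set a := |𝔽.val z y| with ha
  set E := ‖𝔽.jac x y - 𝔽.jac xs y‖
  set F := ‖𝔽.pos x y - 𝔽.pos xs y‖
  calc _ ≤ a * (K * F * C + K * (C * E)) := by
        gcongr
        refine (abs_add_le _ _).trans ?_
        rw [abs_mul, abs_mul, abs_abs]
        gcongr
    _ ≤ 1 * a ^ 2 + (C * K) ^ 2 * (F ^ 2 + E ^ 2) := by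
      nlinarith [sq_nonneg (a - C * K * (E + F) / 2), mul_nonneg (sq_nonneg (C * K)) (sq_nonneg (E - F)),
        mul_nonneg (sq_nonneg (C * K)) (sq_nonneg (E + F)), sq_nonneg (C * K * E),
        sq_nonneg (C * K * F)]
    _ ≤ _ := by rw [ha, sq_abs]; gcongr

end FESpace
/-! ### Calculus of time-dependent matrices -/

section MatrixCalculus

variable {ι : Type} [Fintype ι] {s : Set ℝ} {t : ℝ}

lemma hasDerivWithinAt_dotProduct {z b : ℝ → ι → ℝ} {z' b' : ι → ℝ}
    (hz : HasDerivWithinAt z z' s t) (hb : HasDerivWithinAt b b' s t) :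
    HasDerivWithinAt (fun t => z t ⬝ᵥ b t) (z' ⬝ᵥ b t + z t ⬝ᵥ b') s t := by
  simp only [dotProduct, ← Finset.sum_add_distrib]
  exact HasDerivWithinAt.fun_sum fun i _ =>
    (hasDerivWithinAt_pi.1 hz i).mul (hasDerivWithinAt_pi.1 hb i)

lemma hasDerivWithinAt_mulVec {A : ℝ → Matrix ι ι ℝ} {A' : Matrix ι ι ℝ} {z : ℝ → ι → ℝ}
    {z' : ι → ℝ} (hA : ∀ j l, HasDerivWithinAt (fun t => A t j l) (A' j l) s t)
    (hz : HasDerivWithinAt z z' s t) :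
    HasDerivWithinAt (fun t => A t *ᵥ z t) (A' *ᵥ z t + A t *ᵥ z') s t := by
  refine hasDerivWithinAt_pi.2 fun j => ?_
  exact hasDerivWithinAt_dotProduct (z := fun t => A t j) (z' := A' j)
    (hasDerivWithinAt_pi.2 fun l => hA j l) hz

lemma continuousOn_inv {ι : Type} [Fintype ι] [DecidableEq ι] {A : ℝ → Matrix ι ι ℝ}
    (hA : ContinuousOn A s) (h : ∀ t ∈ s, (A t).det ≠ 0) : ContinuousOn (fun t => (A t)⁻¹) s := by
  simp only [Matrix.inv_def, Ring.inverse_eq_inv']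
  have h1 : ContinuousOn (fun t => (A t).det) s :=
    (Continuous.matrix_det continuous_id).comp_continuousOn hA
  have h2 : ContinuousOn (fun t => (A t).adjugate) s :=
    (Continuous.matrix_adjugate continuous_id).comp_continuousOn hA
  exact (h1.inv₀ h).smul h2

lemma continuousOn_mulVec {ι ι' : Type} [Fintype ι'] {A : ℝ → Matrix ι ι' ℝ} {b : ℝ → ι' → ℝ}
    (hA : ContinuousOn A s) (hb : ContinuousOn b s) : ContinuousOn (fun t => A t *ᵥ b t) s :=
  (Continuous.matrix_mulVec continuous_fst continuous_snd).comp_continuousOn (hA.prodMk hb)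

lemma continuousOn_dotProduct {a b : ℝ → ι → ℝ}
    (ha : ContinuousOn a s) (hb : ContinuousOn b s) : ContinuousOn (fun t => a t ⬝ᵥ b t) s :=
  (Continuous.dotProduct continuous_fst continuous_snd).comp_continuousOn (ha.prodMk hb)

/-- The solution of a linear system with differentiable data is differentiable. -/
lemma hasDerivWithinAt_of_mulVec [DecidableEq ι] {A : ℝ → Matrix ι ι ℝ} {A' : Matrix ι ι ℝ}
    {z : ℝ → ι → ℝ} {r' : ι → ℝ} (hA : ∀ j l, HasDerivWithinAt (fun t => A t j l) (A' j l) s t)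
    (hdet : ∀ t ∈ s, (A t).det ≠ 0) (ht : t ∈ s)
    (hr : HasDerivWithinAt (fun t => A t *ᵥ z t) r' s t) :
    HasDerivWithinAt z ((A t)⁻¹ *ᵥ (r' - A' *ᵥ z t)) s t := by
  have hAc : ContinuousWithinAt A s t := by
    refine continuousWithinAt_pi.2 fun j => continuousWithinAt_pi.2 fun l => (hA j l).continuousWithinAt
  have hdc : ContinuousWithinAt (fun t => (A t)⁻¹) s t := by
    simp only [Matrix.inv_def, Ring.inverse_eq_inv']
    have h1 : ContinuousWithinAt (fun t => (A t).det) s t :=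
      (Continuous.matrix_det continuous_id).continuousAt.comp_continuousWithinAt hAc
    have h2 : ContinuousWithinAt (fun t => (A t).adjugate) s t :=
      (Continuous.matrix_adjugate continuous_id).continuousAt.comp_continuousWithinAt hAc
    exact (h1.inv₀ (hdet t ht)).smul h2
  have hconst : HasDerivWithinAt (fun τ => A τ *ᵥ z t) (A' *ᵥ z t) s t := by
    simpa using hasDerivWithinAt_mulVec hA (hasDerivWithinAt_const t s (z t))
  -- The function being differentiated is `A τ (z τ - z t)`, which vanishes at `τ = t`. Applying `(A
  -- τ)⁻¹` to its slopes yields the slopes of `z`, so differentiability of `z` need not be known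
  -- beforehand.
  have hd := hr.sub hconst
  rw [hasDerivWithinAt_iff_tendsto_slope] at hd ⊢
  have hi : Filter.Tendsto (fun t => (A t)⁻¹) (nhdsWithin t (s \ {t})) (nhds (A t)⁻¹) :=
    hdc.mono_left (nhdsWithin_mono _ sdiff_subset)
  have := ((Continuous.matrix_mulVec continuous_fst continuous_snd).tendsto
    ((A t)⁻¹, r' - A' *ᵥ z t)).comp (hi.prodMk_nhds hd)
  refine this.congr' ?_
  filter_upwards [self_mem_nhdsWithin] with τ hτ
  have hu : IsUnit (A τ).det := isUnit_iff_ne_zero.2 (hdet τ hτ.1)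
  simp only [Function.comp, slope, vsub_eq_sub, Pi.sub_apply]
  rw [sub_self, sub_zero, ← Matrix.mulVec_sub, Matrix.mulVec_smul, Matrix.mulVec_mulVec,
    Matrix.nonsing_inv_mul _ hu, Matrix.one_mulVec]

end MatrixCalculus

lemma dotProduct_subtype {N : Type} [Fintype N] {int : N → Prop} [Fintype {j // int j}]
    {z : N → ℝ} (hz : ∀ j, ¬ int j → z j = 0) (b : N → ℝ) :
    z ⬝ᵥ b = (fun j : {j // int j} => z j) ⬝ᵥ fun j : {j // int j} => b j := by
  classical
  simp only [dotProduct]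
  rw [← Finset.sum_subtype (Finset.univ.filter int) (by simp) fun j => z j * b j]
  refine (Finset.sum_filter_of_ne fun j _ hj => ?_).symm
  by_contra h
  simp [hz j h] at hj

/-! ### Vector-valued derivative of the mass matrix -/

namespace FESpace

variable {Y N : Type} [TopologicalSpace Y] [Fintype N] (𝔽 : FESpace Y N)
  [CompactSpace Y] [MeasurableSpace Y] [OpensMeasurableSpace Y] (ν : Measure Y) [IsFiniteMeasure ν]

lemma continuous_jac_uncurry : Continuous fun z : (N → E3) × Y => 𝔽.jac z.1 z.2 :=
  (𝔽.continuous_jacL.comp continuous_snd).clm_apply continuous_fst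

lemma hasFDerivAt_absDet {x : N → E3} {y : Y} (h : (𝔽.jac x y).det ≠ 0) :
    HasFDerivAt (fun x => |(𝔽.jac x y).det|) ((SignType.sign (𝔽.jac x y).det : ℝ) •
      (fderiv ℝ (fun H : E3 →L[ℝ] E3 => H.det) (𝔽.jac x y) ∘L 𝔽.jacL y)) x := by
  have h1 : HasFDerivAt (fun x => (𝔽.jac x y).det)
      (fderiv ℝ (fun H : E3 →L[ℝ] E3 => H.det) (𝔽.jac x y) ∘L 𝔽.jacL y) x :=
    HasFDerivAt.comp x ((contDiff_det (n := 1)).differentiable one_ne_zero _).hasFDerivAt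
      (𝔽.jacL y).hasFDerivAt
  exact (hasDerivAt_abs h).comp_hasFDerivAt x h1

/-- Differentiation under the integral sign. The modulus of the determinant is differentiable only
off zero, and compactness of `Y` provides a neighbourhood of `x t` on which no determinant vanishes
at any point. -/
lemma hasDerivWithinAt_mass [SecondCountableTopology Y] {s : Set ℝ} {t : ℝ} {x : ℝ → N → E3}
    {w : N → E3} (hx : HasDerivWithinAt x w s t) (hinv : ∀ y, (𝔽.jac (x t) y).IsInvertible)
    (j l : N) :
    HasDerivWithinAt (fun t => 𝔽.mass ν (x t) j l) (𝔽.dmass ν (x t) w j l) s t := by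
  set G : (N → E3) × Y → (N → E3) →L[ℝ] ℝ := fun z => (𝔽.φ j z.2 * 𝔽.φ l z.2) •
    (fderiv ℝ (fun H : E3 →L[ℝ] E3 => H.det) (𝔽.jac z.1 z.2) ∘L 𝔽.jacL z.2) with hG
  set F' : (N → E3) → Y → (N → E3) →L[ℝ] ℝ := fun x y =>
    (SignType.sign (𝔽.jac x y).det : ℝ) • G (x, y) with hF'
  have hcd : Continuous fun H : E3 →L[ℝ] E3 => fderiv ℝ (fun H : E3 →L[ℝ] E3 => H.det) H :=
    (contDiff_det (n := 1)).continuous_fderiv one_ne_zero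
  have hcG : Continuous G := by
    have h1 := hcd.comp 𝔽.continuous_jac_uncurry
    have h2 := 𝔽.continuous_jacL.comp (continuous_snd (X := N → E3))
    exact (((𝔽.continuous_φ j).comp continuous_snd).mul
      ((𝔽.continuous_φ l).comp continuous_snd)).smul (h1.clm_comp h2)
  have hcdet : Continuous fun z : (N → E3) × Y => (𝔽.jac z.1 z.2).det :=
    ContinuousLinearMap.continuous_det.comp 𝔽.continuous_jac_uncurry
  have hev : ∀ᶠ x' in nhds (x t), ∀ y ∈ (univ : Set Y), (𝔽.jac x' y).det ≠ 0 := by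
    refine isCompact_univ.eventually_forall_of_forall_eventually fun y _ => ?_
    exact hcdet.continuousAt.eventually_ne (det_ne_zero_of_isInvertible (hinv y))
  obtain ⟨B, hB⟩ := ((isCompact_closedBall (x t) 1).prod
    (isCompact_univ (X := Y))).exists_bound_of_continuousOn hcG.continuousOn
  have hmeas : AEStronglyMeasurable (F' (x t)) ν := by
    refine Continuous.aestronglyMeasurable ?_
    have h1 : Continuous fun y => (SignType.sign (𝔽.jac (x t) y).det : ℝ) := by
      rw [continuous_iff_continuousAt]
      intro y
      have h2 : ContinuousAt (fun y => SignType.sign (𝔽.jac (x t) y).det) y :=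
        ContinuousAt.comp (g := SignType.sign) (f := fun y => (𝔽.jac (x t) y).det)
          (continuousAt_sign_of_ne_zero (det_ne_zero_of_isInvertible (hinv y)))
          (ContinuousLinearMap.continuous_det.comp (𝔽.continuous_jac _)).continuousAt
      exact (continuous_of_discreteTopology
        (f := fun s : SignType => (s : ℝ))).continuousAt.comp h2
    exact h1.smul (hcG.comp (continuous_const.prodMk continuous_id))
  -- The sign factor has modulus at most one, so the bound for the continuous function `G` on a
  -- compact set is a dominating constant.
  have hbound : ∀ y, ∀ x' ∈ Metric.closedBall (x t) 1, ‖F' x' y‖ ≤ B := fun y x' hx' => by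
    refine le_trans ?_ (hB (x', y) ⟨hx', mem_univ _⟩)
    rw [hF', norm_smul]
    refine mul_le_of_le_one_left (norm_nonneg _) ?_
    rcases lt_trichotomy (𝔽.jac x' y).det 0 with hd | hd | hd
    · simp [sign_neg hd]
    · simp [hd]
    · simp [sign_pos hd]
  have hmain : HasFDerivAt (fun x => 𝔽.mass ν x j l) (∫ y, F' (x t) y ∂ν) (x t) := by
    refine hasFDerivAt_integral_of_dominated_of_fderiv_le
      (s := {x' | ∀ y ∈ (univ : Set Y), (𝔽.jac x' y).det ≠ 0} ∩ Metric.closedBall (x t) 1)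
      (bound := fun _ => B) (Filter.inter_mem hev (Metric.closedBall_mem_nhds _ one_pos))
      (Filter.Eventually.of_forall fun x' => ?_) (integrable_of_continuous ν (by fun_prop)) hmeas
      (Filter.Eventually.of_forall fun y x' hx' => hbound y x' hx'.2) (integrable_const _)
      (Filter.Eventually.of_forall fun y x' hx' => ?_)
    · exact Continuous.aestronglyMeasurable (by fun_prop)
    · have := (𝔽.hasFDerivAt_absDet (hx'.1 y (mem_univ _))).const_mul (𝔽.φ j y * 𝔽.φ l y)
      rwa [smul_comm] at this
  have hint : Integrable (F' (x t)) ν := Integrable.of_bound hmeas B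
    (Filter.Eventually.of_forall fun y => hbound y _ (Metric.mem_closedBall_self zero_le_one))
  have h := hmain.comp_hasDerivWithinAt t hx
  rw [ContinuousLinearMap.integral_apply hint] at h
  have e : 𝔽.dmass ν (x t) w j l = ∫ y, F' (x t) y w ∂ν := by
    change ∫ y, 𝔽.φ j y * 𝔽.φ l y * dabsDet (𝔽.jac (x t) y) (𝔽.jac w y) ∂ν = _
    congr 1; funext y
    simp only [hF', hG, dabsDet, jac, FunLike.coe_smul, Pi.smul_apply, smul_eq_mul,
      ContinuousLinearMap.comp_apply]
    ring
  rw [e]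
  exact h

end FESpace
end HarmonicFEM

/-! ### Abstract stability inequalities and the discrete velocity law. -/

namespace HarmonicFEM
namespace FESpace

variable {Y N : Type} [TopologicalSpace Y] [Fintype N] (𝔽 : FESpace Y N)
  [CompactSpace Y] [MeasurableSpace Y] [OpensMeasurableSpace Y] (ν : Measure Y) [IsFiniteMeasure ν]

/-- The inequalities for finite element functions on the reference space that are used in the
stability proof; `int` singles out the interior nodes. -/
structure IsStable (int : N → Prop) (CP J : ℝ) : Prop where
  definite : ∀ z, 𝔽.normSq ν z = 0 → z = 0
  poincare : ∀ z, (∀ j, ¬ int j → z j = 0) → 𝔽.normSq ν z ≤ CP * 𝔽.gradSq ν z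
  sup_le : ∀ z, (∀ j, ¬ int j → z j = 0) → ∀ ε, (∀ y, ‖𝔽.grad z y‖ ≤ ε) →
    ∀ y, |𝔽.val z y| ≤ CP * ε
  inverse : ∀ z y, ‖𝔽.grad z y‖ ^ 2 ≤ J * 𝔽.gradSq ν z

variable (int : N → Prop) [Fintype {j // int j}] [DecidableEq {j // int j}]

/-- The block of the stiffness matrix for the interior nodes. -/
def stiffBlock (x : N → E3) : Matrix {j // int j} {j // int j} ℝ :=
  (𝔽.stiff ν x).submatrix Subtype.val Subtype.val

/-- The residual of a velocity in the discrete Laplace equation. -/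
def velResidual (x v : N → E3) (i : Fin 3) : {j // int j} → ℝ :=
  fun j => (𝔽.stiff ν x *ᵥ fun p => v p i) j

/-- The square of the dual norm of the residual. -/
def velDefectSq (x v : N → E3) : ℝ :=
  ∑ i, 𝔽.velResidual ν int x v i ⬝ᵥ ((𝔽.stiffBlock ν int x)⁻¹ *ᵥ 𝔽.velResidual ν int x v i)

variable {int} {CP J : ℝ} (hS : 𝔽.IsStable ν int CP J)

lemma dot_stiffBlock (x : N → E3) {z : N → ℝ} (hz : ∀ j, ¬ int j → z j = 0) :
    (fun j : {j // int j} => z j) ⬝ᵥ (𝔽.stiffBlock ν int x *ᵥ fun j : {j // int j} => z j) =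
      z ⬝ᵥ (𝔽.stiff ν x *ᵥ z) := by
  rw [dotProduct_subtype hz]
  congr 1
  funext j
  simp only [mulVec, stiffBlock]
  rw [dotProduct_comm _ z, dotProduct_subtype hz, dotProduct_comm]
  rfl

include hS in
-- The passage from energy bounds to pointwise bounds on Jacobians; it costs the factor `J`, which
-- will be of order `h⁻³`.
lemma IsStable.sq_norm_jac_le (x : N → E3) (y : Y) : ‖𝔽.jac x y‖ ^ 2 ≤ J * 𝔽.jacSq ν x := by
  rw [jacSq_eq_sum, Finset.mul_sum]
  exact (𝔽.sq_norm_jac_le x y).trans (Finset.sum_le_sum fun i _ => hS.inverse _ y)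

variable {C : ℝ} {x xs : N → E3}

include hS in
-- Extended by zero to the boundary nodes, an interior vector satisfies Poincaré's inequality, so
-- zero energy forces it to vanish.
lemma IsStable.stiffBlock_posDef (hC : 0 < C)
    (h : ∀ y, FormBounds C (𝔽.jac xs y) (𝔽.jac x y)) : (𝔽.stiffBlock ν int x).PosDef := by
  refine PosDef.of_dotProduct_mulVec_pos ?_ fun z hz => ?_
  · rw [IsHermitian, conjTranspose_eq_transpose_of_trivial, stiffBlock, transpose_submatrix,
      stiff_transpose]
  classical
  set Z : N → ℝ := fun j => if hj : int j then z ⟨j, hj⟩ else 0 with hZ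
  have hZ0 : ∀ j, ¬ int j → Z j = 0 := fun j hj => by simp [hZ, hj]
  have hzZ : z = fun j : {j // int j} => Z j := by
    funext j; simp [hZ, j.2]
  rw [star_trivial, hzZ, dot_stiffBlock _ _ _ hZ0]
  refine lt_of_lt_of_le ?_ (𝔽.le_stiff ν h Z)
  refine mul_pos (inv_pos.2 hC) (lt_of_le_of_ne (𝔽.gradSq_nonneg ν Z) fun h0 => hz ?_)
  have h1 := hS.poincare Z hZ0
  rw [← h0, mul_zero] at h1
  have h2 := hS.definite Z (le_antisymm h1 (𝔽.normSq_nonneg ν Z))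
  rw [hzZ, h2]; rfl

include hS in
lemma IsStable.mass_posDef (hC : 0 < C)
    (h : ∀ y, FormBounds C (𝔽.jac xs y) (𝔽.jac x y)) : (𝔽.mass ν x).PosDef := by
  refine PosDef.of_dotProduct_mulVec_pos ?_ fun z hz => ?_
  · rw [IsHermitian, conjTranspose_eq_transpose_of_trivial, mass_transpose]
  rw [star_trivial]
  refine lt_of_lt_of_le ?_ (𝔽.le_mass ν h z)
  exact mul_pos (inv_pos.2 hC) (lt_of_le_of_ne (𝔽.normSq_nonneg ν z)
    fun h0 => hz (hS.definite z h0.symm))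

lemma stiff_posSemidef (hC : 0 < C)
    (h : ∀ y, FormBounds C (𝔽.jac xs y) (𝔽.jac x y)) : (𝔽.stiff ν x).PosSemidef := by
  refine PosSemidef.of_dotProduct_mulVec_nonneg ?_ fun z => ?_
  · rw [IsHermitian, conjTranspose_eq_transpose_of_trivial, stiff_transpose]
  rw [star_trivial]
  exact (mul_nonneg (inv_nonneg.2 hC.le) (𝔽.gradSq_nonneg ν z)).trans (𝔽.le_stiff ν h z)

include hS in
lemma IsStable.velDefectSq_nonneg (hC : 0 < C)
    (h : ∀ y, FormBounds C (𝔽.jac xs y) (𝔽.jac x y)) (v : N → E3) :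
    0 ≤ 𝔽.velDefectSq ν int x v := by
  refine Finset.sum_nonneg fun i _ => ?_
  simpa using (hS.stiffBlock_posDef 𝔽 ν hC h).posSemidef.inv.dotProduct_mulVec_nonneg
    (𝔽.velResidual ν int x v i)

include hS in
/-- Stability of the discrete velocity law. -/
lemma IsStable.jacSq_velocity_sub_le {K : ℝ} {w vs : N → E3} (hC : 0 < C)
    (h : ∀ y, FormBounds C (𝔽.jac xs y) (𝔽.jac x y))
    (hs : ∀ y, FormBounds C (𝔽.jac xs y) (𝔽.jac xs y)) (hK : ∀ y, ‖𝔽.jac vs y‖ ≤ K)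
    (hvel : ∀ i j, int j → (𝔽.stiff ν x *ᵥ fun p => w p i) j = 0)
    (hbd : ∀ j, ¬ int j → w j = vs j) :
    𝔽.jacSq ν (w - vs) ≤ 6 * C ^ 4 * K ^ 2 * 𝔽.jacSq ν (x - xs) +
      2 * C ^ 3 * 𝔽.velDefectSq ν int xs vs := by
  have key : ∀ i, 𝔽.gradSq ν (fun j => (w - vs) j i) ≤ 2 * C ^ 4 * K ^ 2 * 𝔽.jacSq ν (x - xs) +
      2 * C ^ 3 * (𝔽.velResidual ν int xs vs i ⬝ᵥ
        ((𝔽.stiffBlock ν int xs)⁻¹ *ᵥ 𝔽.velResidual ν int xs vs i)) := fun i => by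
    set z : N → ℝ := fun j => (w - vs) j i with hz
    have hz0 : ∀ j, ¬ int j → z j = 0 := fun j hj => by simp [hz, hbd j hj]
    set D := 𝔽.velResidual ν int xs vs i ⬝ᵥ
      ((𝔽.stiffBlock ν int xs)⁻¹ *ᵥ 𝔽.velResidual ν int xs vs i)
    have e1 : z ⬝ᵥ (𝔽.stiff ν x *ᵥ z) = -(z ⬝ᵥ (𝔽.stiff ν x *ᵥ fun p => vs p i)) := by
      have hz' : z = (fun p => w p i) - fun p => vs p i := by funext j; simp [hz]
      -- `w` is discretely harmonic in the interior rows, and the test vector vanishes in the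
      -- boundary rows.
      have h0 : z ⬝ᵥ (𝔽.stiff ν x *ᵥ fun p => w p i) = 0 := by
        refine Finset.sum_eq_zero fun j _ => ?_
        by_cases hj : int j
        · rw [hvel i j hj, mul_zero]
        · rw [hz0 j hj, zero_mul]
      conv_lhs => rw [hz', mulVec_sub, ← hz', dotProduct_sub, h0, zero_sub]
    -- Both Young parameters, here and in `h2`, are chosen so that the term costs `(4 C)⁻¹` times
    -- `gradSq`; half of the coercivity constant `C⁻¹` remains.
    have h1 := 𝔽.stiff_sub_le ν h (fun y => (hs y).inv)
      (z' := fun p => vs p i) (fun y => (𝔽.norm_grad_le vs y i).trans (hK y))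
      (η := (4 * C)⁻¹) (by positivity) z
    have h2 := posDef_young (hS.stiffBlock_posDef 𝔽 ν hC hs) (fun j : {j // int j} => z j)
      (𝔽.velResidual ν int xs vs i) (η := (4 * C ^ 2)⁻¹) (by positivity)
    rw [dot_stiffBlock _ _ _ hz0] at h2
    have e2 : (fun j : {j // int j} => z j) ⬝ᵥ 𝔽.velResidual ν int xs vs i =
        z ⬝ᵥ (𝔽.stiff ν xs *ᵥ fun p => vs p i) := by
      rw [dotProduct_subtype hz0]; rfl
    rw [e2] at h2
    have h3 := 𝔽.stiff_le ν hs z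
    have h4 := 𝔽.le_stiff ν h z
    have h5 : z ⬝ᵥ (𝔽.stiff ν x *ᵥ z) ≤
        (4 * C)⁻¹ * 𝔽.gradSq ν z + (4 * (4 * C)⁻¹)⁻¹ * (C * K) ^ 2 * 𝔽.jacSq ν (x - xs) +
        ((4 * C ^ 2)⁻¹ * (C * 𝔽.gradSq ν z) + (4 * (4 * C ^ 2)⁻¹)⁻¹ * D) := by
      rw [e1]
      have h6 := neg_abs_le (z ⬝ᵥ (𝔽.stiff ν xs *ᵥ fun p => vs p i))
      have h7 := neg_abs_le (z ⬝ᵥ (𝔽.stiff ν x *ᵥ fun p => vs p i) -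
        z ⬝ᵥ (𝔽.stiff ν xs *ᵥ fun p => vs p i))
      have h8 : (4 * C ^ 2)⁻¹ * (z ⬝ᵥ (𝔽.stiff ν xs *ᵥ z)) ≤ (4 * C ^ 2)⁻¹ * (C * 𝔽.gradSq ν z) :=
        mul_le_mul_of_nonneg_left h3 (by positivity)
      linarith
    have h6 := mul_le_mul_of_nonneg_left (h4.trans h5) (by positivity : 0 ≤ 2 * C)
    have e3 : 2 * C * (C⁻¹ * 𝔽.gradSq ν z) = 2 * 𝔽.gradSq ν z := by field_simp
    have e4 : 2 * C * ((4 * C)⁻¹ * 𝔽.gradSq ν z +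
        (4 * (4 * C)⁻¹)⁻¹ * (C * K) ^ 2 * 𝔽.jacSq ν (x - xs) +
        ((4 * C ^ 2)⁻¹ * (C * 𝔽.gradSq ν z) + (4 * (4 * C ^ 2)⁻¹)⁻¹ * D)) =
        𝔽.gradSq ν z + (2 * C ^ 4 * K ^ 2 * 𝔽.jacSq ν (x - xs) + 2 * C ^ 3 * D) := by
      field_simp; ring
    linarith
  rw [jacSq_eq_sum]
  refine (Finset.sum_le_sum fun i _ => key i).trans (le_of_eq ?_)
  rw [Finset.sum_add_distrib, Finset.sum_const, velDefectSq, Finset.mul_sum (a := 2 * C ^ 3)]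
  simp only [Finset.card_univ, Fintype.card_fin, nsmul_eq_mul, Nat.cast_ofNat]
  ring

/-! ### Continuity in time -/

lemma continuousOn_integral {s : Set ℝ} {F : ℝ → Y → ℝ}
    (hF : ContinuousOn (fun z : ℝ × Y => F z.1 z.2) (s ×ˢ univ)) :
    ContinuousOn (fun t => ∫ y, F t y ∂ν) s :=
  continuousOn_integral_of_compact_support isCompact_univ hF fun _ _ _ h => (h (mem_univ _)).elim

variable {s : Set ℝ} {X V : ℝ → N → E3}

lemma continuousOn_jac (hX : ContinuousOn X s) :
    ContinuousOn (fun z : ℝ × Y => 𝔽.jac (X z.1) z.2) (s ×ˢ univ) := by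
  have h1 : ContinuousOn (fun z : ℝ × Y => X z.1) (s ×ˢ univ) :=
    hX.comp continuousOn_fst fun z hz => hz.1
  have h2 : ContinuousOn (fun z : ℝ × Y => (X z.1, z.2)) (s ×ˢ univ) := h1.prodMk continuousOn_snd
  exact 𝔽.continuous_jac_uncurry.comp_continuousOn (f := fun z : ℝ × Y => (X z.1, z.2)) h2

lemma continuousOn_pos (hX : ContinuousOn X s) :
    ContinuousOn (fun z : ℝ × Y => 𝔽.pos (X z.1) z.2) (s ×ˢ univ) := by
  refine continuousOn_finsetSum _ fun j _ => ?_
  refine (((𝔽.continuous_φ j).comp continuous_snd).continuousOn).smul ?_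
  exact ((continuous_apply j).comp_continuousOn hX).comp continuousOn_fst fun _ hz => hz.1

lemma continuousOn_stiff (hX : ContinuousOn X s)
    (hinv : ∀ t ∈ s, ∀ y, (𝔽.jac (X t) y).IsInvertible) :
    ContinuousOn (fun t => 𝔽.stiff ν (X t)) s := by
  refine continuousOn_pi.2 fun j => continuousOn_pi.2 fun l => ?_
  refine continuousOn_integral (F := fun t y => stiffInt (𝔽.jac (X t) y) (𝔽.g j y) (𝔽.g l y)) ν
    fun z hz => ?_
  refine ContinuousAt.comp_continuousWithinAt
    (f := fun z : ℝ × Y => (𝔽.jac (X z.1) z.2, 𝔽.g j z.2, 𝔽.g l z.2))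
    (continuousAt_stiffInt (hinv z.1 hz.1 z.2) _ _) ?_
  exact (𝔽.continuousOn_jac hX z hz).prodMk (Continuous.continuousWithinAt (by fun_prop))

lemma continuousOn_mass (hX : ContinuousOn X s) : ContinuousOn (fun t => 𝔽.mass ν (X t)) s := by
  refine continuousOn_pi.2 fun j => continuousOn_pi.2 fun l => ?_
  refine continuousOn_integral (F := fun t y => 𝔽.φ j y * 𝔽.φ l y * |(𝔽.jac (X t) y).det|) ν ?_
  refine ContinuousOn.mul (Continuous.continuousOn (by fun_prop)) ?_
  exact (ContinuousLinearMap.continuous_det.comp_continuousOn (𝔽.continuousOn_jac hX)).abs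

lemma continuousOn_dmass (hX : ContinuousOn X s) (hV : ContinuousOn V s)
    (hinv : ∀ t ∈ s, ∀ y, (𝔽.jac (X t) y).IsInvertible) :
    ContinuousOn (fun t => 𝔽.dmass ν (X t) (V t)) s := by
  refine continuousOn_pi.2 fun j => continuousOn_pi.2 fun l => ?_
  refine continuousOn_integral
    (F := fun t y => 𝔽.φ j y * 𝔽.φ l y * dabsDet (𝔽.jac (X t) y) (𝔽.jac (V t) y)) ν ?_
  refine ContinuousOn.mul (Continuous.continuousOn (by fun_prop)) fun z hz => ?_
  refine ContinuousAt.comp_continuousWithinAt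
    (f := fun z : ℝ × Y => (𝔽.jac (X z.1) z.2, 𝔽.jac (V z.1) z.2))
    (continuousAt_dabsDet (det_ne_zero_of_isInvertible (hinv z.1 hz.1 z.2)) _) ?_
  exact (𝔽.continuousOn_jac hX z hz).prodMk (𝔽.continuousOn_jac hV z hz)

lemma continuousOn_load {f : ℝ → E3 → ℝ} (hX : ContinuousOn X s)
    (hf : ContinuousOn (fun z : ℝ × E3 => f z.1 z.2) (s ×ˢ univ)) :
    ContinuousOn (fun t => 𝔽.load ν (f t) (X t)) s := by
  refine continuousOn_pi.2 fun j => ?_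
  refine continuousOn_integral
    (F := fun t y => f t (𝔽.pos (X t) y) * 𝔽.φ j y * |(𝔽.jac (X t) y).det|) ν ?_
  refine (ContinuousOn.mul ?_ (Continuous.continuousOn (by fun_prop))).mul
    (ContinuousLinearMap.continuous_det.comp_continuousOn (𝔽.continuousOn_jac hX)).abs
  exact hf.comp (f := fun z : ℝ × Y => (z.1, 𝔽.pos (X z.1) z.2))
    (continuousOn_fst.prodMk (𝔽.continuousOn_pos hX)) fun z hz => ⟨hz.1, mem_univ _⟩

include hS in
lemma IsStable.continuousOn_velDefectSq (hC : 0 < C) (hX : ContinuousOn X s)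
    (hV : ContinuousOn V s) (h : ∀ t ∈ s, ∀ y, FormBounds C (𝔽.jac (X t) y) (𝔽.jac (X t) y)) :
    ContinuousOn (fun t => 𝔽.velDefectSq ν int (X t) (V t)) s := by
  have hA := 𝔽.continuousOn_stiff ν hX fun t ht y => (h t ht y).inv
  refine continuousOn_finsetSum _ fun i _ => ?_
  have hres : ContinuousOn (fun t => 𝔽.velResidual ν int (X t) (V t) i) s := by
    refine continuousOn_pi.2 fun j => ?_
    have hVi : ContinuousOn (fun t => fun p => V t p i) s :=
      continuousOn_pi.2 fun p => by
        have := (continuous_apply p).comp_continuousOn hV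
        exact (EuclideanSpace.proj (𝕜 := ℝ) i).continuous.comp_continuousOn this
    exact (continuous_apply (j : N)).comp_continuousOn (continuousOn_mulVec hA hVi)
  refine continuousOn_dotProduct hres (continuousOn_mulVec (continuousOn_inv ?_ fun t ht => ?_) hres)
  · refine continuousOn_pi.2 fun j => continuousOn_pi.2 fun l => ?_
    exact continuousOn_pi.1 (continuousOn_pi.1 hA j) l
  · exact (hS.stiffBlock_posDef 𝔽 ν hC (h t ht)).det_pos.ne'

/-! ### Stability of the positions -/

/-- The squared `H¹` seminorm of a differentiable curve. -/
lemma hasDerivWithinAt_jacSq {t : ℝ} {v : N → E3} (hX : HasDerivWithinAt X v s t) :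
    ∃ d ≤ 𝔽.jacSq ν (X t) + 𝔽.jacSq ν v,
      HasDerivWithinAt (fun t => 𝔽.jacSq ν (X t)) d s t := by
  -- At the identity `stiffInt` is the plain inner product, so the H¹ seminorm is the quadratic form
  -- of a constant symmetric matrix and is differentiated as such.
  set Gm : Matrix N N ℝ := Matrix.of fun j l =>
    ∫ y, stiffInt (ContinuousLinearMap.id ℝ E3) (𝔽.g j y) (𝔽.g l y) ∂ν with hGm
  have hid : (ContinuousLinearMap.id ℝ E3).IsInvertible := ⟨ContinuousLinearEquiv.refl ℝ E3, rfl⟩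
  have hcont : ∀ j l, Continuous fun y =>
      stiffInt (ContinuousLinearMap.id ℝ E3) (𝔽.g j y) (𝔽.g l y) := fun j l =>
    continuous_iff_continuousAt.2 fun y =>
      ContinuousAt.comp (f := fun y => (ContinuousLinearMap.id ℝ E3, 𝔽.g j y, 𝔽.g l y))
        (continuousAt_stiffInt hid _ _) (by fun_prop)
  have hG : ∀ z, 𝔽.gradSq ν z = z ⬝ᵥ (Gm *ᵥ z) := fun z => by
    rw [hGm, dotProduct_integral_mulVec _ _ fun j l => integrable_of_continuous ν (hcont j l),
      gradSq]
    congr 1; funext y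
    have : ‖𝔽.grad z y‖ ^ 2 = stiffInt (ContinuousLinearMap.id ℝ E3) (𝔽.grad z y)
        (𝔽.grad z y) := by
      rw [stiffInt, real_inner_self_eq_norm_sq, LinearIsometryEquiv.norm_map]
      simp [ContinuousLinearMap.det]
    rw [this]
    simp only [grad, stiffInt_sum_left, stiffInt_sum_right, Finset.sum_mul]
    rw [Finset.sum_comm]
    exact Finset.sum_congr rfl fun j _ => Finset.sum_congr rfl fun l _ => by ring
  have hsymm : ∀ a b : N → ℝ, a ⬝ᵥ (Gm *ᵥ b) = b ⬝ᵥ (Gm *ᵥ a) := fun a b => by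
    have : Gmᵀ = Gm := by
      ext j l
      simp only [hGm, Matrix.transpose_apply, Matrix.of_apply]
      congr 1; funext y; rw [stiffInt_comm]
    rw [Matrix.dotProduct_mulVec, ← Matrix.mulVec_transpose, this, dotProduct_comm]
  have hi : ∀ i, HasDerivWithinAt (fun t p => X t p i) (fun p => v p i) s t := fun i =>
    hasDerivWithinAt_pi.2 fun p =>
      (EuclideanSpace.proj (𝕜 := ℝ) i).hasFDerivAt.comp_hasDerivWithinAt t
        (hasDerivWithinAt_pi.1 hX p)
  refine ⟨∑ i, ((fun p => v p i) ⬝ᵥ (Gm *ᵥ fun p => X t p i) +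
    (fun p => X t p i) ⬝ᵥ (Gm *ᵥ fun p => v p i)), ?_, ?_⟩
  · rw [jacSq_eq_sum, jacSq_eq_sum, ← Finset.sum_add_distrib]
    refine Finset.sum_le_sum fun i _ => ?_
    -- Nonnegativity at `X - v` is the inequality `2⟨X, v⟩ ≤ ‖X‖² + ‖v‖²` for this seminorm.
    have h1 := 𝔽.gradSq_nonneg ν ((fun p => X t p i) - fun p => v p i)
    rw [hG, mulVec_sub, sub_dotProduct, dotProduct_sub, dotProduct_sub] at h1
    rw [hG, hG]
    linarith
  · simp only [jacSq_eq_sum, hG]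
    refine HasDerivWithinAt.fun_sum fun i _ => ?_
    have h2 := hasDerivWithinAt_mulVec (A := fun _ => Gm) (A' := 0)
      (fun j l => hasDerivWithinAt_const t s (Gm j l)) (hi i)
    have h3 := hasDerivWithinAt_dotProduct (hi i) h2
    simpa using h3

end FESpace
/-- A continuity argument: a bound that improves itself persists. -/
lemma bootstrap {T b : ℝ} {g : ℝ → ℝ} (hg : ContinuousOn g (Icc 0 T)) (h0 : g 0 < b)
    (h : ∀ t ∈ Icc 0 T, (∀ s ∈ Icc 0 t, g s ≤ b) → g t < b) : ∀ t ∈ Icc 0 T, g t < b := by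
  intro t₁ ht₁
  by_contra hlt
  push Not at hlt
  -- The infimum of `S` is the first time at which `g` reaches `b`. Up to then `g ≤ b`, so the
  -- hypothesis gives strict inequality at that very time.
  set S : Set ℝ := {t ∈ Icc 0 T | g t = b} with hS
  have hit : ∀ t ∈ Icc 0 T, b ≤ g t → ∃ s ∈ S, s ≤ t := fun t ht hbt => by
    obtain ⟨s, hs, hgs⟩ := intermediate_value_Icc ht.1
      (hg.mono (Icc_subset_Icc_right ht.2)) ⟨h0.le, hbt⟩
    exact ⟨s, ⟨⟨hs.1, hs.2.trans ht.2⟩, hgs⟩, hs.2⟩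
  have hcl : IsClosed S := by
    have := hg.preimage_isClosed_of_isClosed isClosed_Icc (isClosed_singleton (x := b))
    exact this
  have hne : S.Nonempty := let ⟨s, hs, _⟩ := hit t₁ ht₁ hlt; ⟨s, hs⟩
  have hbdd : BddBelow S := ⟨0, fun t ht => ht.1.1⟩
  have hmem := hcl.csInf_mem hne hbdd
  refine (h _ hmem.1 fun s hs => ?_).ne hmem.2
  by_contra hgs
  push Not at hgs
  obtain ⟨r, hr, hrs⟩ := hit s ⟨hs.1, hs.2.trans hmem.1.2⟩ hgs.le
  have h1 := csInf_le hbdd hr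
  have h2 : s = sInf S := le_antisymm hs.2 (h1.trans hrs)
  rw [h2, hmem.2] at hgs
  exact lt_irrefl _ hgs

namespace FESpace

variable {Y N : Type} [TopologicalSpace Y] [Fintype N] {𝔽 : FESpace Y N}
  [CompactSpace Y] [MeasurableSpace Y] [OpensMeasurableSpace Y] {ν : Measure Y} [IsFiniteMeasure ν]
  {int : N → Prop} [Fintype {j // int j}] [DecidableEq {j // int j}] {CP J : ℝ}

/-- The constant in the estimate of the velocity error by the position error and the defect. -/
def velConst (C K : ℝ) : ℝ := 1 + 6 * C ^ 4 * K ^ 2 + 2 * C ^ 3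

/-- The constant in the estimate of the position error. -/
def posConst (T C K : ℝ) : ℝ := (1 + velConst C K) * Real.exp ((1 + velConst C K) * T)

lemma velConst_pos {C K : ℝ} (hC : 0 < C) : 0 < velConst C K := by unfold velConst; positivity

lemma posConst_pos {T C K : ℝ} (hC : 0 < C) : 0 < posConst T C K := by
  have := velConst_pos (K := K) hC
  unfold posConst; positivity

/-- Stability of the positions: as long as the defects are small, the discrete positions stay close
to the interpolated exact ones. -/
theorem IsStable.position_stability (hS : 𝔽.IsStable ν int CP J) {T K C ε : ℝ} (hT : 0 < T)
    (hC : 1 ≤ C) (hε : 0 < ε) (hJ : 0 ≤ J) {xs vs x w : ℝ → N → E3}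
    (hxs : ∀ t ∈ Icc 0 T, HasDerivWithinAt xs (vs t) (Icc 0 T) t)
    (hvs : ContinuousOn vs (Icc 0 T))
    (hx : ∀ t ∈ Icc 0 T, HasDerivWithinAt x (w t) (Icc 0 T) t) (h0 : x 0 = xs 0)
    (hK : ∀ t ∈ Icc 0 T, ∀ y, ‖𝔽.jac (vs t) y‖ ≤ K)
    (hFB : ∀ t ∈ Icc 0 T, ∀ x', (∀ y, ‖𝔽.jac x' y - 𝔽.jac (xs t) y‖ ≤ ε) →
      ∀ y, FormBounds C (𝔽.jac (xs t) y) (𝔽.jac x' y))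
    (hvel : ∀ t ∈ Icc 0 T, (∀ y, ‖𝔽.jac (x t) y - 𝔽.jac (xs t) y‖ ≤ ε) →
      ∀ i j, int j → (𝔽.stiff ν (x t) *ᵥ fun p => w t p i) j = 0)
    (hbd : ∀ t ∈ Icc 0 T, ∀ j, ¬ int j → w t j = vs t j)
    (hδ : ∀ t ∈ Icc 0 T, J * 𝔽.velDefectSq ν int (xs t) (vs t) ≤
      ε ^ 2 / (2 * (posConst T C K * T))) :
    ∀ t ∈ Icc 0 T, (∀ y, ‖𝔽.jac (x t) y - 𝔽.jac (xs t) y‖ ≤ ε) ∧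
      𝔽.jacSq ν (x t - xs t) ≤
        posConst T C K * ∫ s in (0 : ℝ)..t, 𝔽.velDefectSq ν int (xs s) (vs s) ∧
      𝔽.jacSq ν (w t - vs t) ≤
        velConst C K * (𝔽.jacSq ν (x t - xs t) + 𝔽.velDefectSq ν int (xs t) (vs t)) := by
  have hC0 : 0 < C := by linarith
  have ha := velConst_pos (K := K) hC0
  have hB := posConst_pos (T := T) (K := K) hC0
  set a := velConst C K with hadef
  set δ : ℝ → ℝ := fun t => 𝔽.velDefectSq ν int (xs t) (vs t) with hδdef
  set ρ : ℝ → ℝ := fun t => 𝔽.jacSq ν (x t - xs t) with hρdef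
  have hFBs : ∀ t ∈ Icc 0 T, ∀ y, FormBounds C (𝔽.jac (xs t) y) (𝔽.jac (xs t) y) :=
    fun t ht => hFB t ht _ fun y => by simpa using hε.le
  have hδc : ContinuousOn δ (Icc 0 T) := hS.continuousOn_velDefectSq 𝔽 ν hC0
    (fun t ht => (hxs t ht).continuousWithinAt) hvs hFBs
  have hδ0 : ∀ t ∈ Icc 0 T, 0 ≤ δ t := fun t ht =>
    hS.velDefectSq_nonneg 𝔽 ν hC0 (hFBs t ht) _
  have hder : ∀ t ∈ Icc 0 T, HasDerivWithinAt (fun t => x t - xs t) (w t - vs t) (Icc 0 T) t :=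
    fun t ht => (hx t ht).sub (hxs t ht)
  choose! ρ' hρ'le hρ' using fun t ht => 𝔽.hasDerivWithinAt_jacSq ν (hder t ht)
  have hρc : ContinuousOn ρ (Icc 0 T) := fun t ht => (hρ' t ht).continuousWithinAt
  have hρ00 : ρ 0 = 0 := by
    simp [hρdef, h0, jacSq, frobSq, grad]
  have hclose : ∀ t, J * ρ t ≤ ε ^ 2 → ∀ y, ‖𝔽.jac (x t) y - 𝔽.jac (xs t) y‖ ≤ ε :=
    fun t ht y => by
      have := (hS.sq_norm_jac_le 𝔽 ν (x t - xs t) y).trans ht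
      rw [jac_sub] at this
      exact le_of_sq_le_sq this hε.le
  -- Closeness has to be known before the velocity can be estimated: both the form bounds and the
  -- reference form of the discrete Laplace equation at `x` are available only near `xs`.
  have hvelerr : ∀ t ∈ Icc 0 T, J * ρ t ≤ ε ^ 2 → 𝔽.jacSq ν (w t - vs t) ≤ a * (ρ t + δ t) :=
    fun t ht hsm => by
      have hcl := hclose t hsm
      have h1 := hS.jacSq_velocity_sub_le 𝔽 ν hC0 (hFB t ht _ hcl) (hFBs t ht) (hK t ht)
        (hvel t ht hcl) (hbd t ht)
      have h2 : 0 ≤ ρ t := 𝔽.jacSq_nonneg ν _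
      have h3 := hδ0 t ht
      refine h1.trans ?_
      rw [hadef, velConst]
      have h4 : 0 ≤ 6 * C ^ 4 * K ^ 2 := by positivity
      have h5 : 0 ≤ 2 * C ^ 3 := by positivity
      change 6 * C ^ 4 * K ^ 2 * ρ t + 2 * C ^ 3 * δ t ≤ _
      nlinarith [mul_nonneg h4 h3, mul_nonneg h5 h2]
  -- The constant `1 + a` arises from `ρ' ≤ ρ + jacSq (w - vs)` and the velocity estimate.
  have hgron : ∀ t ∈ Icc 0 T, (∀ s ∈ Icc 0 t, J * ρ s ≤ ε ^ 2) →
      ρ t ≤ posConst T C K * ∫ s in (0 : ℝ)..t, δ s := fun t ht hsm => by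
    have hsub : Icc 0 t ⊆ Icc 0 T := Icc_subset_Icc_right ht.2
    have h1 := gronwall_dissipation (C := 1 + a) (m := fun _ => 0) ht.1 (by positivity)
      (fun s hs => (hρ' s (hsub hs)).mono hsub) continuousOn_const (hδc.mono hsub)
      (fun _ _ => le_rfl) (fun s hs => hδ0 s (hsub hs)) hρ00 fun s hs => by
        have h2 := hρ'le s (hsub hs)
        have h3 := hvelerr s (hsub hs) (hsm s hs)
        have h4 := hδ0 s (hsub hs)
        change ρ' s ≤ ρ s + _ at h2
        change ρ' s ≤ (1 + a) * (ρ s + δ s) - 0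
        linarith
    simp only [intervalIntegral.integral_zero, add_zero] at h1
    refine h1.trans ?_
    have h5 : 0 ≤ ∫ s in (0 : ℝ)..t, δ s :=
      intervalIntegral.integral_nonneg ht.1 fun s hs => hδ0 s (hsub hs)
    rw [posConst]
    gcongr
    exact ht.2
  -- Assuming `J * ρ ≤ ε ^ 2` up to time `t`, Gronwall and the smallness of the defect return `ε ^ 2
  -- / 2`, so the assumption improves itself.
  have hsmall : ∀ t ∈ Icc 0 T, J * ρ t < ε ^ 2 := by
    refine bootstrap (continuousOn_const.mul hρc) (by rw [hρ00, mul_zero]; positivity) fun t ht hsm => ?_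
    have h1 := hgron t ht hsm
    have hsub : Icc 0 t ⊆ Icc 0 T := Icc_subset_Icc_right ht.2
    have h2 : J * ∫ s in (0 : ℝ)..t, δ s ≤ ε ^ 2 / (2 * (posConst T C K * T)) * T := by
      rw [← intervalIntegral.integral_const_mul]
      calc _ ≤ ∫ _ in (0 : ℝ)..t, ε ^ 2 / (2 * (posConst T C K * T)) := by
            refine intervalIntegral.integral_mono_on ht.1 ?_ intervalIntegrable_const
              fun s hs => hδ s (hsub hs)
            refine ContinuousOn.intervalIntegrable ?_
            rw [uIcc_of_le ht.1]
            exact continuousOn_const.mul (hδc.mono hsub)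
        _ ≤ _ := by
            rw [intervalIntegral.integral_const, smul_eq_mul, sub_zero, mul_comm]
            gcongr
            exact ht.2
    calc J * ρ t ≤ J * (posConst T C K * ∫ s in (0 : ℝ)..t, δ s) := by gcongr
      _ = posConst T C K * (J * ∫ s in (0 : ℝ)..t, δ s) := by ring
      _ ≤ posConst T C K * (ε ^ 2 / (2 * (posConst T C K * T)) * T) := by gcongr
      _ = ε ^ 2 / 2 := by field_simp
      _ < ε ^ 2 := by have : 0 < ε ^ 2 := by positivity
                      linarith
  intro t ht
  exact ⟨hclose t (hsmall t ht).le, hgron t ht fun s hs =>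
    (hsmall s ⟨hs.1, hs.2.trans ht.2⟩).le, hvelerr t ht (hsmall t ht).le⟩

/-! ### Stability of the diffusion equation -/

variable (𝔽 ν) in
/-- The residual of the curve `us`, with derivative `us'`, in the discrete diffusion equation on
the domain with positions `x` and velocities `v`. -/
def diffResidual (f : E3 → ℝ) (x v : N → E3) (us us' : N → ℝ) : N → ℝ :=
  𝔽.dmass ν x v *ᵥ us + 𝔽.mass ν x *ᵥ us' - (𝔽.load ν f x - 𝔽.stiff ν x *ᵥ us)

variable (𝔽 ν) in
/-- The square of the dual norm of the residual in the discrete diffusion equation. -/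
def diffDefectSq [DecidableEq N] (f : E3 → ℝ) (x v : N → E3) (us us' : N → ℝ) : ℝ :=
  𝔽.diffResidual ν f x v us us' ⬝ᵥ
    ((𝔽.mass ν x + 𝔽.stiff ν x)⁻¹ *ᵥ 𝔽.diffResidual ν f x v us us')

/-- The constant in the differential inequality for the error in the diffusion equation. -/
def diffConst (CP C K : ℝ) : ℝ :=
  C * (C * (K + 1) + 7) + 2 * (C * K) ^ 2 * (CP + C + K ^ 2 + 2 + velConst C K) + 2 * C ^ 2

/-- The differential inequality for the energy of the error in the diffusion equation. -/
lemma IsStable.energy_inequality [DecidableEq N]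
    (hS : 𝔽.IsStable ν int CP J) {K C : ℝ} (hC : 1 ≤ C) (hCP : 0 ≤ CP) (hK0 : 0 ≤ K)
    {xs vs x w : N → E3} {e e' us us' : N → ℝ} {f : E3 → ℝ} (hft : Continuous f)
    (hFBs : ∀ y, FormBounds C (𝔽.jac xs y) (𝔽.jac xs y))
    (hFB : ∀ y, FormBounds C (𝔽.jac xs y) (𝔽.jac x y))
    (hKvs : ∀ y, ‖𝔽.jac vs y‖ ≤ K) (hKw : ∀ y, ‖𝔽.jac w y‖ ≤ K + 1)
    (hKus : ∀ y, |𝔽.val us y| ≤ K) (hKus' : ∀ y, |𝔽.val us' y| ≤ K)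
    (hKgus : ∀ y, ‖𝔽.grad us y‖ ≤ K) (hKf : ∀ y, |f (𝔽.pos xs y)| ≤ K)
    (hLf : ∀ y, |f (𝔽.pos x y) - f (𝔽.pos xs y)| ≤ K * ‖𝔽.pos x y - 𝔽.pos xs y‖)
    (hbd : ∀ j, ¬ int j → x j = xs j)
    (hvel : 𝔽.jacSq ν (w - vs) ≤
      velConst C K * (𝔽.jacSq ν (x - xs) + 𝔽.velDefectSq ν int xs vs))
    (he' : 𝔽.mass ν x *ᵥ e' = 𝔽.load ν f x - 𝔽.stiff ν x *ᵥ (e + us)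
      - 𝔽.dmass ν x w *ᵥ (e + us) - 𝔽.mass ν x *ᵥ us') :
    2 * (e ⬝ᵥ (𝔽.mass ν x *ᵥ e')) + e ⬝ᵥ (𝔽.dmass ν x w *ᵥ e) ≤
      diffConst CP C K * (e ⬝ᵥ (𝔽.mass ν x *ᵥ e) + (𝔽.jacSq ν (x - xs) +
        𝔽.velDefectSq ν int xs vs + 𝔽.diffDefectSq ν f xs vs us us')) - C⁻¹ * 𝔽.gradSq ν e := by
  have hC0 : 0 < C := by linarith
  have ha := velConst_pos (K := K) hC0
  have hMAs : (𝔽.mass ν xs + 𝔽.stiff ν xs).PosDef :=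
    (hS.mass_posDef 𝔽 ν hC0 hFBs).add_posSemidef (𝔽.stiff_posSemidef ν hC0 hFBs)
  have hδv0 : 0 ≤ 𝔽.velDefectSq ν int xs vs := hS.velDefectSq_nonneg 𝔽 ν hC0 hFBs _
  have hδu0 : 0 ≤ 𝔽.diffDefectSq ν f xs vs us us' := by
    have := hMAs.posSemidef.inv.dotProduct_mulVec_nonneg (𝔽.diffResidual ν f xs vs us us')
    rwa [star_trivial] at this
  have hn0 : 0 ≤ 𝔽.normSq ν e := 𝔽.normSq_nonneg ν _
  have hnE : 𝔽.normSq ν e ≤ C * (e ⬝ᵥ (𝔽.mass ν x *ᵥ e)) := by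
    have := 𝔽.le_mass ν hFB e
    rwa [inv_mul_le_iff₀ hC0] at this
  set a := velConst C K with hadef
  set Q := diffConst CP C K with hQ
  set δv := 𝔽.velDefectSq ν int xs vs with hδv
  set δu := 𝔽.diffDefectSq ν f xs vs us us' with hδu
  set n := 𝔽.normSq ν e with hn
  set g := 𝔽.gradSq ν e with hg
  set E := e ⬝ᵥ (𝔽.mass ν x *ᵥ e) with hE
  set ρ := 𝔽.jacSq ν (x - xs) with hρ
  set σ := 𝔽.jacSq ν (w - vs) with hσ
  have hρ0 : 0 ≤ ρ := 𝔽.jacSq_nonneg ν _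
  have b1 := 𝔽.dmass_le ν hFB hKw e
  have b2 := 𝔽.load_sub_le ν hFB hft hKf hLf e
  have b3 := 𝔽.le_stiff ν hFB e
  -- The estimates `b4` and `b7` each consume a quarter of `C⁻¹ * g`. In the energy identity
  -- everything is doubled, so of the dissipation `2 * C⁻¹ * g` the amount `C⁻¹ * g` survives.
  have b4 := 𝔽.stiff_sub_le ν hFB (fun y => (hFBs y).inv) hKgus
    (η := (4 * C)⁻¹) (by positivity) e
  have b5 := 𝔽.dmass_sub_le ν hFB (fun y => (hFBs y).inv) (w := w) hKus
    hKvs e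
  have b6 := 𝔽.mass_sub_le ν hFB hKus' e
  have b7 := posDef_young hMAs e
    (𝔽.diffResidual ν f xs vs us us') (η := (4 * C ^ 2)⁻¹) (by positivity)
  have b8 : e ⬝ᵥ ((𝔽.mass ν xs + 𝔽.stiff ν xs) *ᵥ e) ≤ C * (n + g) := by
    rw [Matrix.add_mulVec, dotProduct_add, mul_add]
    exact add_le_add (𝔽.mass_le ν hFBs _) (𝔽.stiff_le ν hFBs _)
  -- The positions agree at the boundary nodes, so Poincaré's inequality removes the L² norm
  -- produced by the load term.
  have b9 : (∑ i, 𝔽.normSq ν fun j => (x - xs) j i) ≤ CP * ρ := by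
    rw [hρ, jacSq_eq_sum, Finset.mul_sum]
    exact Finset.sum_le_sum fun i _ => hS.poincare _ fun j hj => by simp [hbd j hj]
  have b10 := hvel
  -- Adding and subtracting the forms of the exact data at `xs` produces differences of forms and
  -- the residual of the exact data. The terms quadratic in `e` are estimated directly at `x`.
  have hid : e ⬝ᵥ (𝔽.mass ν x *ᵥ e') =
      (e ⬝ᵥ 𝔽.load ν f x - e ⬝ᵥ 𝔽.load ν f xs)
      - e ⬝ᵥ (𝔽.stiff ν x *ᵥ e)
      - (e ⬝ᵥ (𝔽.stiff ν x *ᵥ us) - e ⬝ᵥ (𝔽.stiff ν xs *ᵥ us))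
      - e ⬝ᵥ (𝔽.dmass ν x w *ᵥ e)
      - (e ⬝ᵥ (𝔽.dmass ν x w *ᵥ us) - e ⬝ᵥ (𝔽.dmass ν xs vs *ᵥ us))
      - (e ⬝ᵥ (𝔽.mass ν x *ᵥ us') - e ⬝ᵥ (𝔽.mass ν xs *ᵥ us'))
      - e ⬝ᵥ 𝔽.diffResidual ν f xs vs us us' := by
    rw [he', diffResidual]
    simp only [dotProduct_sub, dotProduct_add, mulVec_add]
    ring
  have c1 : (4 * C ^ 2)⁻¹ * (e ⬝ᵥ ((𝔽.mass ν xs + 𝔽.stiff ν xs) *ᵥ e)) ≤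
      (4 * C)⁻¹ * (n + g) :=
    (mul_le_mul_of_nonneg_left b8 (by positivity)).trans (le_of_eq (by field_simp))
  have c2 : (4 * (4 * C ^ 2)⁻¹)⁻¹ = C ^ 2 := by field_simp
  have c3 : (4 * (4 * C)⁻¹)⁻¹ = C := by field_simp
  have c4 : (4 * C)⁻¹ = C⁻¹ / 4 := by rw [mul_inv]; ring
  have c5 : C⁻¹ ≤ 1 := inv_le_one_of_one_le₀ hC
  rw [c2] at b7
  rw [c3] at b4
  rw [c4] at b4 c1
  have b7' : |e ⬝ᵥ 𝔽.diffResidual ν f xs vs us us'| ≤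
      C⁻¹ / 4 * (n + g) + C ^ 2 * δu := b7.trans (add_le_add c1 le_rfl)
  have b3' : C⁻¹ * g ≤ e ⬝ᵥ (𝔽.stiff ν x *ᵥ e) := b3
  have b2' := b2.trans (add_le_add_right (mul_le_mul_of_nonneg_left
    (add_le_add_left b9 _) (by positivity)) _)
  have b5' : _ ≤ n + (C * K) ^ 2 * (K ^ 2 * ρ + a * (ρ + δv)) :=
    b5.trans (add_le_add_right (mul_le_mul_of_nonneg_left
      (add_le_add_right b10 _) (by positivity)) _)
  have d1 := neg_abs_le (e ⬝ᵥ (𝔽.dmass ν x w *ᵥ e))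
  have d2 := le_abs_self (e ⬝ᵥ 𝔽.load ν f x - e ⬝ᵥ 𝔽.load ν f xs)
  have d3 := neg_abs_le
    (e ⬝ᵥ (𝔽.stiff ν x *ᵥ us) - e ⬝ᵥ (𝔽.stiff ν xs *ᵥ us))
  have d4 := neg_abs_le (e ⬝ᵥ (𝔽.dmass ν x w *ᵥ us) -
    e ⬝ᵥ (𝔽.dmass ν xs vs *ᵥ us))
  have d5 := neg_abs_le
    (e ⬝ᵥ (𝔽.mass ν x *ᵥ us') - e ⬝ᵥ (𝔽.mass ν xs *ᵥ us'))
  have d6 := neg_abs_le (e ⬝ᵥ 𝔽.diffResidual ν f xs vs us us')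
  have main : 2 * (e ⬝ᵥ (𝔽.mass ν x *ᵥ e')) +
      e ⬝ᵥ (𝔽.dmass ν x w *ᵥ e) ≤
      C * (K + 1) * n + 2 * ((n + (C * K) ^ 2 * (CP * ρ + ρ)) - C⁻¹ * g +
        (C⁻¹ / 4 * g + C * (C * K) ^ 2 * ρ) +
        (n + (C * K) ^ 2 * (K ^ 2 * ρ + a * (ρ + δv))) + (n + (C * K) ^ 2 * ρ) +
        (C⁻¹ / 4 * (n + g) + C ^ 2 * δu)) := by
    rw [hid]
    linarith only [b1, b2', b3', b4, b5', b6, b7', d1, d2, d3, d4, d5, d6]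
  refine main.trans ?_
  have p1 : C⁻¹ * n ≤ n := mul_le_of_le_one_left (hn0) c5
  have p2 : (C * (K + 1) + 7) * n ≤ (C * (K + 1) + 7) * (C * E) := by gcongr
  have p3 : 0 ≤ E := by
    have h1 := hn0
    by_contra hneg
    push Not at hneg
    linarith only [mul_neg_of_pos_of_neg hC0 hneg, hnE, h1]
  set W := (C * K) ^ 2 with hW
  have hW0 : 0 ≤ W := by positivity
  -- `diffConst` adds up the coefficients of the individual sources. The first line and a half of
  -- the right side is what is needed; the bracket is a nonnegative surplus.
  have hQe : Q * (E + (ρ + δv + δu)) =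
      (C * (C * (K + 1) + 7)) * E + (2 * W * (CP + C + K ^ 2 + 2 + a)) * ρ +
      (2 * W * a) * δv + (2 * C ^ 2) * δu +
      ((2 * W * (CP + C + K ^ 2 + 2 + a) + 2 * C ^ 2) * E +
       (C * (C * (K + 1) + 7) + 2 * C ^ 2) * ρ +
       (C * (C * (K + 1) + 7) + 2 * W * (CP + C + K ^ 2 + 2) + 2 * C ^ 2) * δv +
       (C * (C * (K + 1) + 7) + 2 * W * (CP + C + K ^ 2 + 2 + a)) * δu) := by
    rw [hQ, diffConst, ← hadef, ← hW]; ring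
  have hrest : 0 ≤ (2 * W * (CP + C + K ^ 2 + 2 + a) + 2 * C ^ 2) * E +
       (C * (C * (K + 1) + 7) + 2 * C ^ 2) * ρ +
       (C * (C * (K + 1) + 7) + 2 * W * (CP + C + K ^ 2 + 2) + 2 * C ^ 2) * δv +
       (C * (C * (K + 1) + 7) + 2 * W * (CP + C + K ^ 2 + 2 + a)) * δu := by positivity
  rw [hQe]
  have hid2 : C * (K + 1) * n + 2 * ((n + W * (CP * ρ + ρ)) - C⁻¹ * g +
        (C⁻¹ / 4 * g + C * W * ρ) +
        (n + W * (K ^ 2 * ρ + a * (ρ + δv))) + (n + W * ρ) +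
        (C⁻¹ / 4 * (n + g) + C ^ 2 * δu)) =
      (C * (K + 1) + 6) * n + C⁻¹ * n / 2 - C⁻¹ * g +
      (2 * W * (CP + C + K ^ 2 + 2 + a)) * ρ + (2 * W * a) * δv + (2 * C ^ 2) * δu := by ring
  rw [hid2]
  linarith only [p1, p2, hrest, hn0]

/-- If `M`, `M u` are differentiable and `M` is invertible then `u` is differentiable. -/
lemma exists_hasDerivWithinAt_of_mulVec [DecidableEq N] {M M' : ℝ → Matrix N N ℝ}
    {u r : ℝ → N → ℝ} {s : Set ℝ}
    (hM : ∀ t ∈ s, ∀ j l, HasDerivWithinAt (fun t => M t j l) (M' t j l) s t)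
    (hdet : ∀ t ∈ s, (M t).det ≠ 0)
    (hr : ∀ t ∈ s, HasDerivWithinAt (fun t => M t *ᵥ u t) (r t) s t) :
    ∃ u' : ℝ → N → ℝ, (∀ t ∈ s, HasDerivWithinAt u (u' t) s t) ∧
      ∀ t ∈ s, M t *ᵥ u' t = r t - M' t *ᵥ u t := by
  refine ⟨fun t => (M t)⁻¹ *ᵥ (r t - M' t *ᵥ u t),
    fun t ht => hasDerivWithinAt_of_mulVec (hM t ht) hdet ht (hr t ht), fun t ht => ?_⟩
  rw [Matrix.mulVec_mulVec, Matrix.mul_nonsing_inv _ (isUnit_iff_ne_zero.2 (hdet t ht)),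
    Matrix.one_mulVec]

/-- Gronwall argument for an energy `E` with dissipation `g`, sources `δv`, `δu`, and a source `j`
that is controlled by the time integral of `δv`. -/
lemma gronwall_sources {T C Q B : ℝ} (hC : 0 < C) (hQ0 : 0 ≤ Q) (hB : 0 ≤ B) (hT : 0 ≤ T)
    {E E' g δv δu j m s : ℝ → ℝ}
    (hEd : ∀ t ∈ Icc 0 T, HasDerivWithinAt E (E' t) (Icc 0 T) t)
    (hE0 : E 0 = 0)
    (hgc : ContinuousOn g (Icc 0 T)) (hδvc : ContinuousOn δv (Icc 0 T))
    (hδuc : ContinuousOn δu (Icc 0 T)) (hsc : ContinuousOn s (Icc 0 T))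
    (hg0 : ∀ t ∈ Icc 0 T, 0 ≤ g t) (hδv0 : ∀ t ∈ Icc 0 T, 0 ≤ δv t)
    (hδu0 : ∀ t ∈ Icc 0 T, 0 ≤ δu t)
    (hineq : ∀ t ∈ Icc 0 T, E' t ≤ Q * (E t + (j t + δv t + δu t)) - C⁻¹ * g t)
    (hpos : ∀ t ∈ Icc 0 T, j t ≤ B * ∫ s in (0 : ℝ)..t, δv s)
    (hm : ∀ t ∈ Icc 0 T, m t ≤ C ^ 2 * E t) (hs : ∀ t ∈ Icc 0 T, s t ≤ C * g t) :
    ∀ t ∈ Icc 0 T, m t + ∫ r in (0 : ℝ)..t, s r ≤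
      C ^ 2 * (Q * Real.exp (Q * T)) * (B * T + 1) * ∫ r in (0 : ℝ)..t, (δu r + δv r) := by
  intro τ hτ
  have hsub : Icc 0 τ ⊆ Icc 0 T := Icc_subset_Icc_right hτ.2
  -- For a fixed end time `τ` the nonlocal source `j` is replaced by the constant `B * D`, whose
  -- integral over `[0, τ]` is again a multiple of the integral of `δv`.
  set D := ∫ s in (0 : ℝ)..τ, δv s with hD
  have hint : ∀ {F : ℝ → ℝ} {t : ℝ}, t ∈ Icc 0 T → ContinuousOn F (Icc 0 T) →
      IntervalIntegrable F volume 0 t := fun {F t} ht hF =>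
    ContinuousOn.intervalIntegrable (by
      rw [uIcc_of_le ht.1]; exact hF.mono (Icc_subset_Icc_right ht.2))
  have hD0 : 0 ≤ D := intervalIntegral.integral_nonneg hτ.1 fun s hs => hδv0 s (hsub hs)
  have hDle : ∀ t ∈ Icc 0 τ, ∫ s in (0 : ℝ)..t, δv s ≤ D := fun t ht => by
    refine intervalIntegral.integral_mono_interval le_rfl ht.1 ht.2 ?_ (hint hτ hδvc)
    filter_upwards [ae_restrict_mem measurableSet_Ioc] with s hs
    exact hδv0 s (hsub (Ioc_subset_Icc_self hs))
  have hgr := gronwall_dissipation (C := Q) (m := fun t => C⁻¹ * g t)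
    (δ := fun t => B * D + (δv t + δu t)) hτ.1 hQ0
    (fun t ht => (hEd t (hsub ht)).mono hsub) (continuousOn_const.mul (hgc.mono hsub))
    (continuousOn_const.add ((hδvc.mono hsub).add (hδuc.mono hsub)))
    (fun t ht => mul_nonneg (inv_nonneg.2 hC.le) (hg0 t (hsub ht)))
    (fun t ht => add_nonneg (mul_nonneg hB hD0)
      (add_nonneg (hδv0 t (hsub ht)) (hδu0 t (hsub ht))))
    hE0 fun t ht => by
      refine (hineq t (hsub ht)).trans ?_
      have h1 := (hpos t (hsub ht)).trans (mul_le_mul_of_nonneg_left (hDle t ht) hB)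
      have h2 : j t + δv t + δu t ≤ B * D + (δv t + δu t) := by linarith
      gcongr
  set I := ∫ s in (0 : ℝ)..τ, (δu s + δv s) with hI
  have hDI : D ≤ I := intervalIntegral.integral_mono_on hτ.1 (hint hτ hδvc)
    (hint hτ (hδuc.add hδvc)) fun s hs => by linarith [hδu0 s (hsub hs)]
  have hI0 : 0 ≤ I := hD0.trans hDI
  have hΔ : ∫ s in (0 : ℝ)..τ, (B * D + (δv s + δu s)) ≤ (B * T + 1) * I := by
    rw [intervalIntegral.integral_add (f := fun _ => B * D) (g := fun s => δv s + δu s)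
      intervalIntegrable_const (hint hτ (hδvc.add hδuc)),
      intervalIntegral.integral_const, smul_eq_mul, sub_zero]
    have h1 : ∫ s in (0 : ℝ)..τ, (δv s + δu s) = I := by
      rw [hI]; congr 1; funext s; ring
    have h2 : τ * (B * D) ≤ T * (B * I) := by
      have := hτ.2
      gcongr
    rw [h1]; linarith
  have hQe : Q * Real.exp (Q * τ) ≤ Q * Real.exp (Q * T) := by
    have := hτ.2
    gcongr
  have hgr2 : E τ + ∫ s in (0 : ℝ)..τ, C⁻¹ * g s ≤
      (Q * Real.exp (Q * T)) * ((B * T + 1) * I) := by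
    refine hgr.trans (mul_le_mul hQe hΔ ?_ (by positivity))
    exact intervalIntegral.integral_nonneg hτ.1 fun t ht => add_nonneg (mul_nonneg hB hD0)
      (add_nonneg (hδv0 t (hsub ht)) (hδu0 t (hsub ht)))
  -- One factor `C` comes from the bound for `s`, the other compensates for the `C⁻¹` in the
  -- dissipation.
  have hL2 : ∫ r in (0 : ℝ)..τ, s r ≤ C ^ 2 * ∫ s in (0 : ℝ)..τ, C⁻¹ * g s := by
    rw [← intervalIntegral.integral_const_mul]
    refine intervalIntegral.integral_mono_on hτ.1 (hint hτ hsc)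
      (hint hτ (continuousOn_const.mul (continuousOn_const.mul hgc))) fun r hr => ?_
    refine (hs r (hsub hr)).trans (le_of_eq ?_)
    field_simp
  calc _ ≤ C ^ 2 * E τ + C ^ 2 * ∫ s in (0 : ℝ)..τ, C⁻¹ * g s := add_le_add (hm τ hτ) hL2
    _ = C ^ 2 * (E τ + ∫ s in (0 : ℝ)..τ, C⁻¹ * g s) := by ring
    _ ≤ C ^ 2 * ((Q * Real.exp (Q * T)) * ((B * T + 1) * I)) := by gcongr
    _ = _ := by ring

/-- The energy lives on the moving discrete domain, so its derivative is computed from the mass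
matrix appearing in the scheme. Norms at the exact positions are restored only at the end, by
equivalence with the norms on the reference space; this is the factor `C ^ 2`. -/
theorem IsStable.diffusion_stability [SecondCountableTopology Y] [DecidableEq N]
    (hS : 𝔽.IsStable ν int CP J) {T K C B : ℝ} (hT : 0 < T)
    (hC : 1 ≤ C) (hCP : 0 ≤ CP) (hK0 : 0 ≤ K) (hB : 0 ≤ B) {xs vs x w : ℝ → N → E3}
    {u us us' : ℝ → N → ℝ} {f : ℝ → E3 → ℝ}
    (hxs : ∀ t ∈ Icc 0 T, HasDerivWithinAt xs (vs t) (Icc 0 T) t)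
    (hvs : ContinuousOn vs (Icc 0 T))
    (hx : ∀ t ∈ Icc 0 T, HasDerivWithinAt x (w t) (Icc 0 T) t)
    (hus : ∀ t ∈ Icc 0 T, HasDerivWithinAt us (us' t) (Icc 0 T) t)
    (hus' : ContinuousOn us' (Icc 0 T))
    (hf : ContinuousOn (fun z : ℝ × E3 => f z.1 z.2) (Icc 0 T ×ˢ univ))
    (h0 : u 0 = us 0)
    (hFBs : ∀ t ∈ Icc 0 T, ∀ y, FormBounds C (𝔽.jac (xs t) y) (𝔽.jac (xs t) y))
    (hFB : ∀ t ∈ Icc 0 T, ∀ y, FormBounds C (𝔽.jac (xs t) y) (𝔽.jac (x t) y))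
    (hKvs : ∀ t ∈ Icc 0 T, ∀ y, ‖𝔽.jac (vs t) y‖ ≤ K)
    (hKw : ∀ t ∈ Icc 0 T, ∀ y, ‖𝔽.jac (w t) y‖ ≤ K + 1)
    (hKus : ∀ t ∈ Icc 0 T, ∀ y, |𝔽.val (us t) y| ≤ K)
    (hKus' : ∀ t ∈ Icc 0 T, ∀ y, |𝔽.val (us' t) y| ≤ K)
    (hKgus : ∀ t ∈ Icc 0 T, ∀ y, ‖𝔽.grad (us t) y‖ ≤ K)
    (hKf : ∀ t ∈ Icc 0 T, ∀ y, |f t (𝔽.pos (xs t) y)| ≤ K)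
    (hLf : ∀ t ∈ Icc 0 T, ∀ y, |f t (𝔽.pos (x t) y) - f t (𝔽.pos (xs t) y)| ≤
      K * ‖𝔽.pos (x t) y - 𝔽.pos (xs t) y‖)
    (hbd : ∀ t ∈ Icc 0 T, ∀ j, ¬ int j → x t j = xs t j)
    (hpos : ∀ t ∈ Icc 0 T, 𝔽.jacSq ν (x t - xs t) ≤
      B * ∫ s in (0 : ℝ)..t, 𝔽.velDefectSq ν int (xs s) (vs s))
    (hvel : ∀ t ∈ Icc 0 T, 𝔽.jacSq ν (w t - vs t) ≤
      velConst C K * (𝔽.jacSq ν (x t - xs t) + 𝔽.velDefectSq ν int (xs t) (vs t)))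
    (hdiff : ∀ t ∈ Icc 0 T, HasDerivWithinAt (fun s => 𝔽.mass ν (x s) *ᵥ u s)
      (𝔽.load ν (f t) (x t) - 𝔽.stiff ν (x t) *ᵥ u t) (Icc 0 T) t) :
    ∀ t ∈ Icc 0 T, (u t - us t) ⬝ᵥ (𝔽.mass ν (xs t) *ᵥ (u t - us t)) +
      ∫ s in (0 : ℝ)..t, (u s - us s) ⬝ᵥ (𝔽.stiff ν (xs s) *ᵥ (u s - us s)) ≤
      C ^ 2 * (diffConst CP C K * Real.exp (diffConst CP C K * T)) * (B * T + 1) *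
      ∫ s in (0 : ℝ)..t, (𝔽.diffDefectSq ν (f s) (xs s) (vs s) (us s) (us' s) +
        𝔽.velDefectSq ν int (xs s) (vs s)) := by
  have hC0 : 0 < C := by linarith
  have ha := velConst_pos (K := K) hC0
  set a := velConst C K with hadef
  set Q := diffConst CP C K with hQ
  have hQ0 : 0 ≤ Q := by rw [hQ, diffConst]; positivity
  set δv : ℝ → ℝ := fun t => 𝔽.velDefectSq ν int (xs t) (vs t) with hδv
  set δu : ℝ → ℝ := fun t => 𝔽.diffDefectSq ν (f t) (xs t) (vs t) (us t) (us' t) with hδu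
  have hxsc : ContinuousOn xs (Icc 0 T) := fun t ht => (hxs t ht).continuousWithinAt
  have husc : ContinuousOn us (Icc 0 T) := fun t ht => (hus t ht).continuousWithinAt
  have hMAs : ∀ t ∈ Icc 0 T, (𝔽.mass ν (xs t) + 𝔽.stiff ν (xs t)).PosDef := fun t ht =>
    (hS.mass_posDef 𝔽 ν hC0 (hFBs t ht)).add_posSemidef (𝔽.stiff_posSemidef ν hC0 (hFBs t ht))
  have hδvc : ContinuousOn δv (Icc 0 T) := hS.continuousOn_velDefectSq 𝔽 ν hC0 hxsc hvs hFBs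
  have hδv0 : ∀ t ∈ Icc 0 T, 0 ≤ δv t := fun t ht =>
    hS.velDefectSq_nonneg 𝔽 ν hC0 (hFBs t ht) _
  have hδuc : ContinuousOn δu (Icc 0 T) := by
    have hA := 𝔽.continuousOn_stiff ν hxsc fun t ht y => (hFBs t ht y).inv
    have hM := 𝔽.continuousOn_mass ν hxsc
    have hr : ContinuousOn (fun t => 𝔽.diffResidual ν (f t) (xs t) (vs t) (us t) (us' t))
        (Icc 0 T) :=
      ((continuousOn_mulVec (𝔽.continuousOn_dmass ν hxsc hvs fun t ht y => (hFBs t ht y).inv)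
        husc).add (continuousOn_mulVec hM hus')).sub
        ((𝔽.continuousOn_load ν hxsc hf).sub (continuousOn_mulVec hA husc))
    exact continuousOn_dotProduct hr (continuousOn_mulVec
      (continuousOn_inv (hM.add hA) fun t ht => (hMAs t ht).det_pos.ne') hr)
  have hδu0 : ∀ t ∈ Icc 0 T, 0 ≤ δu t := fun t ht => by
    have := (hMAs t ht).posSemidef.inv.dotProduct_mulVec_nonneg
      (𝔽.diffResidual ν (f t) (xs t) (vs t) (us t) (us' t))
    rwa [star_trivial] at this
  have hM' : ∀ t ∈ Icc 0 T, ∀ j l, HasDerivWithinAt (fun t => 𝔽.mass ν (x t) j l)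
      (𝔽.dmass ν (x t) (w t) j l) (Icc 0 T) t := fun t ht =>
    𝔽.hasDerivWithinAt_mass ν (hx t ht) fun y => (hFB t ht y).inv
  have hdet : ∀ t ∈ Icc 0 T, (𝔽.mass ν (x t)).det ≠ 0 := fun t ht =>
    (hS.mass_posDef 𝔽 ν hC0 (hFB t ht)).det_pos.ne'
  -- The scheme differentiates only the product of mass matrix and solution; invertibility of the
  -- mass matrix makes the solution itself differentiable.
  obtain ⟨u', hu', hMu'⟩ := exists_hasDerivWithinAt_of_mulVec hM' hdet hdiff
  set e : ℝ → N → ℝ := fun t => u t - us t with he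
  set e' : ℝ → N → ℝ := fun t => u' t - us' t with he'
  have hed : ∀ t ∈ Icc 0 T, HasDerivWithinAt e (e' t) (Icc 0 T) t := fun t ht =>
    (hu' t ht).sub (hus t ht)
  have hec : ContinuousOn e (Icc 0 T) := fun t ht => (hed t ht).continuousWithinAt
  set n : ℝ → ℝ := fun t => 𝔽.normSq ν (e t) with hn
  set g : ℝ → ℝ := fun t => 𝔽.gradSq ν (e t) with hg
  have hgc : ContinuousOn g (Icc 0 T) := by
    refine continuousOn_integral (F := fun t y => ‖𝔽.grad (e t) y‖ ^ 2) ν ?_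
    have h1 : ∀ j, ContinuousOn (fun z : ℝ × Y => e z.1 j) (Icc 0 T ×ˢ univ) := fun j => by
      have := (continuous_apply j).comp_continuousOn hec
      exact this.comp continuousOn_fst fun z hz => hz.1
    refine ContinuousOn.pow (ContinuousOn.norm ?_) 2
    exact continuousOn_finsetSum _ fun j _ => (h1 j).smul
      ((𝔽.continuous_g j).comp continuous_snd).continuousOn
  have hg0 : ∀ t, 0 ≤ g t := fun t => 𝔽.gradSq_nonneg ν _
  have hn0 : ∀ t, 0 ≤ n t := fun t => 𝔽.normSq_nonneg ν _
  set E : ℝ → ℝ := fun t => e t ⬝ᵥ (𝔽.mass ν (x t) *ᵥ e t) with hE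
  have hnE : ∀ t ∈ Icc 0 T, n t ≤ C * E t := fun t ht => by
    have := 𝔽.le_mass ν (hFB t ht) (e t)
    rwa [inv_mul_le_iff₀ hC0] at this
  have hEd : ∀ t ∈ Icc 0 T, HasDerivWithinAt E
      (2 * (e t ⬝ᵥ (𝔽.mass ν (x t) *ᵥ e' t)) + e t ⬝ᵥ (𝔽.dmass ν (x t) (w t) *ᵥ e t))
      (Icc 0 T) t := fun t ht => by
    have h1 := hasDerivWithinAt_dotProduct (hed t ht) (hasDerivWithinAt_mulVec (hM' t ht) (hed t ht))
    have h2 : e' t ⬝ᵥ (𝔽.mass ν (x t) *ᵥ e t) = e t ⬝ᵥ (𝔽.mass ν (x t) *ᵥ e' t) := by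
      rw [Matrix.dotProduct_mulVec, ← Matrix.mulVec_transpose, mass_transpose, dotProduct_comm]
    convert h1 using 1
    rw [h2, dotProduct_add]; ring
  have hineq : ∀ t ∈ Icc 0 T,
      2 * (e t ⬝ᵥ (𝔽.mass ν (x t) *ᵥ e' t)) + e t ⬝ᵥ (𝔽.dmass ν (x t) (w t) *ᵥ e t) ≤
      Q * (E t + (𝔽.jacSq ν (x t - xs t) + δv t + δu t)) - C⁻¹ * g t := fun t ht => by
    have hft : Continuous (f t) := by
      rw [← continuousOn_univ]
      exact hf.comp (f := fun x : E3 => (t, x)) (by fun_prop) fun x _ => ⟨ht, mem_univ _⟩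
    refine hS.energy_inequality hC hCP hK0 hft (hFBs t ht) (hFB t ht) (hKvs t ht) (hKw t ht)
      (hKus t ht) (hKus' t ht) (hKgus t ht) (hKf t ht) (hLf t ht) (hbd t ht) (hvel t ht) ?_
    have hu : e t + us t = u t := by simp [he]
    rw [hu, ← hMu' t ht, ← mulVec_sub]
  exact gronwall_sources hC0 hQ0 hB hT.le hEd (by simp [hE, he, h0]) hgc hδvc hδuc
    (continuousOn_dotProduct hec (continuousOn_mulVec
        (𝔽.continuousOn_stiff ν hxsc fun t ht y => (hFBs t ht y).inv) hec))
    (fun t _ => hg0 t) hδv0 hδu0 hineq hpos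
    (fun t ht => by
      have h1 := 𝔽.mass_le ν (hFBs t ht) (e t)
      have h2 := mul_le_mul_of_nonneg_left (hnE t ht) hC0.le
      rw [pow_two, mul_assoc]
      exact h1.trans h2)
    (fun t ht => 𝔽.stiff_le ν (hFBs t ht) (e t))

end FESpace
/-! ### Shape functions -/

lemma sum_bary (y : E3) : ∑ i, bary y i = 1 := by
  simp [bary, Fin.sum_univ_succ]

lemma bary_succ (y : E3) (i : Fin 3) : bary y i.succ = y i := rfl

lemma bary_zero (y : E3) : bary y 0 = 1 - ∑ i, y i := rfl

/-- Each factor of a shape function is a generalized binomial coefficient, so identities for shape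
functions become identities for binomial series. -/
lemma prod_range_div_eq_choose (r : ℝ) (n : ℕ) :
    ∏ m ∈ Finset.range n, (r - m) / ((n : ℝ) - m) = Ring.choose r n := by
  rw [Ring.choose_eq_smul, ← Polynomial.aeval_eq_smeval, Polynomial.aeval_def,
    Polynomial.eval₂_eq_eval_map, descPochhammer_map, Finset.prod_div_distrib,
    descPochhammer_eval_eq_prod_range, smul_eq_mul, div_eq_inv_mul]
  congr 2
  rw [← Nat.descFactorial_self, Nat.descFactorial_eq_prod_range, Nat.cast_prod]
  refine Finset.prod_congr rfl fun m hm => ?_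
  rw [Nat.cast_sub (Finset.mem_range.1 hm).le]

variable {k : ℕ}

lemma shape_eq_choose (α : LocalNode k) (y : E3) :
    shape α y = ∏ i, Ring.choose ((k : ℝ) * bary y i) (α.1 i : ℕ) := by
  simp only [shape, prod_range_div_eq_choose]

/-- The coefficient form of `X d/dX (1 + X)^r = r X (1 + X)^(r-1)`. -/
lemma coeff_smul_X_mul_binomialSeries (r : ℝ) (n : ℕ) :
    PowerSeries.coeff n (r • (PowerSeries.X * PowerSeries.binomialSeries ℝ (r - 1))) =
      n * Ring.choose r n := by
  cases n with
  | zero => simp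
  | succ n =>
    have h := Ring.choose_add_smul_choose (r - 1) n 1
    simp only [Nat.cast_one, sub_add_cancel, Nat.choose_one_right, nsmul_eq_mul,
      Ring.choose_one_right] at h
    rw [PowerSeries.coeff_smul, PowerSeries.coeff_succ_X_mul, PowerSeries.binomialSeries_coeff, h]
    simp

/-- Sums over the local nodes as coefficients of a product of power series. -/
lemma sum_localNode_prod_coeff (p : Fin 4 → PowerSeries ℝ) :
    ∑ α : LocalNode k, ∏ i, PowerSeries.coeff (α.1 i : ℕ) (p i) =
      PowerSeries.coeff k (∏ i, p i) := by
  rw [PowerSeries.coeff_prod]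
  refine Finset.sum_bij (fun α _ => Finsupp.equivFunOnFinite.symm fun i => (α.1 i : ℕ))
    (fun α _ => ?_) (fun α _ β _ h => ?_) (fun a ha => ?_) (fun α _ => ?_)
  · rw [Finset.mem_finsuppAntidiag]
    exact ⟨by simpa using α.2, Finset.subset_univ _⟩
  · refine Subtype.ext (funext fun i => Fin.ext ?_)
    exact DFunLike.congr_fun h i
  · rw [Finset.mem_finsuppAntidiag] at ha
    have hle : ∀ i, a i < k + 1 := fun i => by
      rw [← ha.1]
      exact Nat.lt_succ_of_le (Finset.single_le_sum (fun _ _ => Nat.zero_le _) (Finset.mem_univ i))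
    refine ⟨⟨fun i => ⟨a i, hle i⟩, ha.1⟩, Finset.mem_univ _, ?_⟩
    ext i; rfl
  · rfl

lemma prod_binomialSeries (r : Fin 4 → ℝ) :
    ∏ i, PowerSeries.binomialSeries ℝ (r i) = PowerSeries.binomialSeries ℝ (∑ i, r i) := by
  simp [Fin.prod_univ_succ, Fin.sum_univ_succ, PowerSeries.binomialSeries_add]

/-- Vandermonde's identity: the sum is the coefficient of `X ^ k` in the product of the series `(1 +
X)^(k λ_i)`. The barycentric coordinates add up to one, so this product is `(1 + X)^k`. -/
lemma sum_shape (y : E3) : ∑ α : LocalNode k, shape α y = 1 := by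
  have h := sum_localNode_prod_coeff (k := k)
    fun i => PowerSeries.binomialSeries ℝ ((k : ℝ) * bary y i)
  rw [prod_binomialSeries, ← Finset.mul_sum, sum_bary, mul_one] at h
  simp only [PowerSeries.binomialSeries_coeff, smul_eq_mul, mul_one, Ring.choose_natCast,
    Nat.choose_self, Nat.cast_one] at h
  simpa only [shape_eq_choose] using h

/-- The operator `X d/dX` applied to the `i`-th binomial series produces the weight `α i`. The
product becomes `k λ_i X (1 + X)^(k-1)`, whose coefficient of `X ^ k` is `k λ_i`. -/
lemma sum_mul_shape (y : E3) (i : Fin 4) :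
    ∑ α : LocalNode k, ((α.1 i : ℕ) : ℝ) * shape α y = k * bary y i := by
  set r : Fin 4 → ℝ := fun i => (k : ℝ) * bary y i with hr
  set p : Fin 4 → PowerSeries ℝ := fun l => PowerSeries.binomialSeries ℝ (r l) with hp
  have h := sum_localNode_prod_coeff (k := k) (Function.update p i
    (r i • (PowerSeries.X * PowerSeries.binomialSeries ℝ (r i - 1))))
  have h1 : ∀ α : LocalNode k, ∏ l, PowerSeries.coeff (α.1 l : ℕ) (Function.update p i
      (r i • (PowerSeries.X * PowerSeries.binomialSeries ℝ (r i - 1))) l) =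
      ((α.1 i : ℕ) : ℝ) * shape α y := fun α => by
    rw [shape_eq_choose, ← Finset.mul_prod_erase _ _ (Finset.mem_univ i),
      ← Finset.mul_prod_erase _ (fun l => Ring.choose ((k : ℝ) * bary y l) (α.1 l : ℕ))
        (Finset.mem_univ i), ← mul_assoc]
    congr 1
    · rw [Function.update_self, coeff_smul_X_mul_binomialSeries]
    · refine Finset.prod_congr rfl fun l hl => ?_
      rw [Function.update_of_ne (Finset.ne_of_mem_erase hl), hp]
      simp [PowerSeries.binomialSeries_coeff, hr]
  rw [Finset.sum_congr rfl fun α _ => h1 α] at h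
  rw [h]
  have hsum : ∑ l, Function.update r i (r i - 1) l = k - 1 := by
    rw [Finset.sum_update_of_mem (Finset.mem_univ i)]
    have : ∑ l, r l = k := by rw [hr, ← Finset.mul_sum, sum_bary, mul_one]
    rw [← Finset.add_sum_erase _ _ (Finset.mem_univ i)] at this
    rw [Finset.sdiff_singleton_eq_erase]
    linarith
  have h2 : ∏ l, Function.update p i
      (r i • (PowerSeries.X * PowerSeries.binomialSeries ℝ (r i - 1))) l =
      r i • (PowerSeries.X * PowerSeries.binomialSeries ℝ ((k : ℝ) - 1)) := by
    rw [← hsum, ← prod_binomialSeries, Finset.prod_update_of_mem (Finset.mem_univ i),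
      ← Finset.mul_prod_erase _ _ (Finset.mem_univ i), Function.update_self, smul_mul_assoc,
      mul_assoc, Finset.sdiff_singleton_eq_erase]
    congr 3
    refine Finset.prod_congr rfl fun l hl => ?_
    rw [Function.update_of_ne (Finset.ne_of_mem_erase hl)]
  rw [h2]
  cases k with
  | zero => simp [hr]
  | succ n =>
    rw [PowerSeries.coeff_smul, PowerSeries.coeff_succ_X_mul, PowerSeries.binomialSeries_coeff]
    push_cast
    simp [hr, Ring.choose_natCast]

/-- Interpolation reproduces affine functions. -/
lemma sum_shape_smul_refNode (hk : k ≠ 0) (y : E3) :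
    ∑ α : LocalNode k, shape α y • refNode α = y := by
  ext i
  have h := sum_mul_shape (k := k) y i.succ
  have hk' : (k : ℝ) ≠ 0 := Nat.cast_ne_zero.2 hk
  rw [bary_succ] at h
  have : (∑ α : LocalNode k, shape α y • refNode α) i =
      (∑ α : LocalNode k, ((α.1 i.succ : ℕ) : ℝ) * shape α y) / k := by
    simp only [refNode, WithLp.ofLp_sum, WithLp.ofLp_smul, Finset.sum_apply, Pi.smul_apply,
      smul_eq_mul, Finset.sum_div]
    exact Finset.sum_congr rfl fun α _ => by ring
  rw [this, h]
  field_simp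

lemma bary_refNode (hk : k ≠ 0) (α : LocalNode k) (i : Fin 4) :
    bary (refNode α) i = ((α.1 i : ℕ) : ℝ) / k := by
  have hk' : (k : ℝ) ≠ 0 := Nat.cast_ne_zero.2 hk
  refine Fin.cases ?_ (fun i => rfl) i
  have h : (∑ i, ((α.1 i : ℕ) : ℝ)) = k := by exact_mod_cast α.2
  rw [Fin.sum_univ_succ] at h
  rw [bary_zero, eq_div_iff hk']
  simp only [refNode]
  rw [← Finset.sum_div, sub_mul, div_mul_cancel₀ _ hk']
  linarith

lemma refNode_mem (hk : k ≠ 0) (α : LocalNode k) : refNode α ∈ refSimplex := fun i => by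
  rw [bary_refNode hk]; positivity

/-- The value is a product of binomial coefficients of `β i` over `α i`. It is nonzero only if `α ≤
β` componentwise, and equal sums then force equality. -/
lemma shape_refNode (hk : k ≠ 0) (α β : LocalNode k) :
    shape α (refNode β) = if α = β then 1 else 0 := by
  have hk' : (k : ℝ) ≠ 0 := Nat.cast_ne_zero.2 hk
  have h : ∀ i, (k : ℝ) * bary (refNode β) i = ((β.1 i : ℕ) : ℝ) := fun i => by
    rw [bary_refNode hk]; field_simp
  simp only [shape_eq_choose, h, Ring.choose_natCast]
  split_ifs with hαβ
  · subst hαβ; simp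
  · by_contra hne
    have hle : ∀ i, (α.1 i : ℕ) ≤ β.1 i := fun i => by
      by_contra hlt
      push Not at hlt
      refine hne (Finset.prod_eq_zero (Finset.mem_univ i) ?_)
      rw [Nat.choose_eq_zero_of_lt hlt, Nat.cast_zero]
    have heq := (Finset.sum_eq_sum_iff_of_le fun i _ => hle i).1 (α.2.trans β.2.symm)
    exact hαβ (Subtype.ext (funext fun i => Fin.ext (heq i (Finset.mem_univ i))))

/-- A shape function vanishes on the faces that do not contain its node. -/
lemma shape_eq_zero {α : LocalNode k} {y : E3} {i : Fin 4} (hy : bary y i = 0)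
    (hα : (α.1 i : ℕ) ≠ 0) : shape α y = 0 := by
  refine Finset.prod_eq_zero (Finset.mem_univ i)
    (Finset.prod_eq_zero (Finset.mem_range.2 (Nat.pos_of_ne_zero hα)) ?_)
  simp [hy]

@[fun_prop]
lemma contDiff_bary (i : Fin 4) {n : WithTop ℕ∞} : ContDiff ℝ n fun y => bary y i := by
  refine Fin.cases ?_ (fun i => ?_) i
  · change ContDiff ℝ n fun y : E3 => 1 - ∑ i, y i
    fun_prop
  · change ContDiff ℝ n fun y : E3 => y i
    fun_prop

@[fun_prop]
lemma contDiff_shape (α : LocalNode k) {n : WithTop ℕ∞} : ContDiff ℝ n (shape α) := by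
  unfold shape
  refine contDiff_prod fun i _ => contDiff_prod fun m _ => ?_
  exact ((contDiff_const.mul (contDiff_bary i)).sub contDiff_const).div_const _

/-! ### The reference simplex -/

lemma convex_refSimplex : Convex ℝ refSimplex := by
  have h : refSimplex = ⋂ i, {y | 0 ≤ bary y i} := by ext; simp [refSimplex]
  rw [h]
  refine convex_iInter fun i => ?_
  intro x hx y hy a b ha hb hab
  have : bary (a • x + b • y) i = a * bary x i + b * bary y i := by
    refine Fin.cases ?_ (fun i => by simp [bary_succ]) i
    simp only [bary_zero, PiLp.add_apply, PiLp.smul_apply, smul_eq_mul, Finset.sum_add_distrib,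
      ← Finset.mul_sum]
    linear_combination (-1 : ℝ) * hab
  rw [mem_ofPred_eq, this]
  exact add_nonneg (mul_nonneg ha hx) (mul_nonneg hb hy)

lemma isClosed_refSimplex : IsClosed refSimplex := by
  have h : refSimplex = ⋂ i, {y | 0 ≤ bary y i} := by ext; simp [refSimplex]
  rw [h]
  exact isClosed_iInter fun i => isClosed_le continuous_const (contDiff_bary i (n := 0)).continuous

lemma bary_le_one {y : E3} (hy : y ∈ refSimplex) (i : Fin 4) : bary y i ≤ 1 := by
  rw [← sum_bary y]
  exact Finset.single_le_sum (fun j _ => hy j) (Finset.mem_univ i)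

lemma norm_le_of_mem_refSimplex {y : E3} (hy : y ∈ refSimplex) : ‖y‖ ≤ 1 := by
  rw [EuclideanSpace.norm_eq, Real.sqrt_le_iff]
  refine ⟨zero_le_one, ?_⟩
  rw [one_pow]
  have h0 : ∀ i : Fin 3, 0 ≤ y i := fun i => hy i.succ
  have h1 : ∀ i : Fin 3, y i ≤ 1 := fun i => bary_le_one hy i.succ
  have h2 : ∑ i, y i ≤ 1 := by have := hy 0; rw [bary_zero] at this; linarith
  refine (Finset.sum_le_sum fun i _ => ?_).trans h2
  rw [Real.norm_eq_abs, sq_abs]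
  nlinarith [h0 i, h1 i]

lemma isCompact_refSimplex : IsCompact refSimplex :=
  Metric.isCompact_of_isClosed_isBounded isClosed_refSimplex
    (Metric.isBounded_closedBall.subset fun y hy => by
      rw [mem_closedBall_zero_iff]; exact norm_le_of_mem_refSimplex hy)

lemma nonempty_interior_refSimplex : (interior refSimplex).Nonempty := by
  have ho : IsOpen {y : E3 | ∀ i, 0 < bary y i} := by
    have h : {y : E3 | ∀ i, 0 < bary y i} = ⋂ i, {y | 0 < bary y i} := by ext; simp
    rw [h]
    exact isOpen_iInter_of_finite fun i =>
      isOpen_lt continuous_const (contDiff_bary i (n := 0)).continuous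
  refine ⟨WithLp.toLp 2 fun _ => 1 / 4, interior_maximal (fun y hy i => (hy i).le) ho ?_⟩
  intro i
  refine Fin.cases ?_ (fun i => ?_) i
  · rw [bary_zero]; norm_num
  · rw [bary_succ]; norm_num

lemma closure_interior_refSimplex : closure (interior refSimplex) = refSimplex := by
  rw [convex_refSimplex.closure_interior_eq_closure_of_nonempty_interior
    nonempty_interior_refSimplex, isClosed_refSimplex.closure_eq]

lemma uniqueDiffOn_refSimplex : UniqueDiffOn ℝ refSimplex :=
  uniqueDiffOn_convex convex_refSimplex nonempty_interior_refSimplex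

instance : CompactSpace refSimplex := isCompact_iff_compactSpace.1 isCompact_refSimplex

/-- A continuous function whose square has vanishing integral over the unit simplex vanishes
there. -/
lemma eqOn_zero_of_setIntegral_eq_zero {F : E3 → ℝ} (hF : Continuous F) (h0 : ∀ y, 0 ≤ F y)
    (h : ∫ y in refSimplex, F y = 0) : ∀ y ∈ refSimplex, F y = 0 := by
  have hi : IntegrableOn F refSimplex volume :=
    hF.continuousOn.integrableOn_compact isCompact_refSimplex
  have h1 := (setIntegral_eq_zero_iff_of_nonneg_ae (Filter.Eventually.of_forall h0) hi).1 h
  exact Measure.eqOn_of_ae_eq (f := F) (g := fun _ => (0 : ℝ)) h1 hF.continuousOn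
    continuousOn_const closure_interior_refSimplex.symm.subset

/-- The function on the unit simplex with the given nodal values. -/
def shapeSum (z : LocalNode k → ℝ) (y : E3) : ℝ := ∑ α, z α * shape α y

/-- Its differential. -/
def shapeGrad (z : LocalNode k → ℝ) (y : E3) : StrongDual ℝ E3 :=
  ∑ α, z α • fderiv ℝ (shape α) y

lemma differentiable_shape (α : LocalNode k) : Differentiable ℝ (shape α) :=
  (contDiff_shape α (n := 1)).differentiable one_ne_zero

lemma continuous_shape (α : LocalNode k) : Continuous (shape α) :=
  (differentiable_shape α).continuous

lemma continuous_fderiv_shape (α : LocalNode k) : Continuous (fderiv ℝ (shape α)) :=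
  (contDiff_shape α (n := 1)).continuous_fderiv one_ne_zero

lemma hasFDerivAt_shapeSum (z : LocalNode k → ℝ) (y : E3) :
    HasFDerivAt (shapeSum z) (shapeGrad z y) y := by
  unfold shapeSum shapeGrad
  exact HasFDerivAt.fun_sum fun α _ => ((differentiable_shape α y).hasFDerivAt).const_mul (z α)

lemma continuous_shapeSum (z : LocalNode k → ℝ) : Continuous (shapeSum z) :=
  continuous_finsetSum _ fun α _ => continuous_const.mul (continuous_shape α)

lemma continuous_shapeGrad (z : LocalNode k → ℝ) : Continuous (shapeGrad z) :=
  continuous_finsetSum _ fun α _ => (continuous_fderiv_shape α).const_smul (z α)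

lemma shapeSum_refNode (hk : k ≠ 0) (z : LocalNode k → ℝ) (β : LocalNode k) :
    shapeSum z (refNode β) = z β := by
  simp [shapeSum, shape_refNode hk]

/-- Derivative of the partition of unity; it permits subtracting constants from nodal values in
gradient estimates. -/
lemma sum_fderiv_shape (y : E3) : ∑ α : LocalNode k, fderiv ℝ (shape α) y = 0 := by
  have h : HasFDerivAt (fun y => ∑ α : LocalNode k, shape α y)
      (∑ α : LocalNode k, fderiv ℝ (shape α) y) y :=
    HasFDerivAt.fun_sum fun α _ => (differentiable_shape α y).hasFDerivAt
  simp only [sum_shape] at h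
  exact h.unique (hasFDerivAt_const (1 : ℝ) y)

lemma sum_fderiv_shape_smul_refNode (hk : k ≠ 0) (y e : E3) :
    ∑ α : LocalNode k, fderiv ℝ (shape α) y e • refNode α = e := by
  have h : HasFDerivAt (fun y => ∑ α : LocalNode k, shape α y • refNode α)
      (∑ α : LocalNode k, (fderiv ℝ (shape α) y).smulRight (refNode α)) y :=
    HasFDerivAt.fun_sum fun α _ => ((differentiable_shape α y).hasFDerivAt).smul_const _
  simp only [sum_shape_smul_refNode hk] at h
  have := congrArg (fun L : E3 →L[ℝ] E3 => L e) (h.unique (hasFDerivAt_id y))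
  simpa [_root_.sum_apply] using this

lemma exists_shape_bound (k : ℕ) : ∃ C, 1 ≤ C ∧ ∀ y ∈ refSimplex,
    ∑ α : LocalNode k, ‖fderiv ℝ (shape α) y‖ ≤ C ∧ ∑ α : LocalNode k, |shape α y| ≤ C := by
  obtain ⟨C₁, h₁⟩ := isCompact_refSimplex.exists_bound_of_continuousOn
    (f := fun y => ∑ α : LocalNode k, ‖fderiv ℝ (shape α) y‖)
    (continuous_finsetSum _ fun α _ => (continuous_fderiv_shape α).norm).continuousOn
  obtain ⟨C₂, h₂⟩ := isCompact_refSimplex.exists_bound_of_continuousOn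
    (f := fun y => ∑ α : LocalNode k, |shape α y|)
    (continuous_finsetSum _ fun α _ => (continuous_shape α).abs).continuousOn
  refine ⟨max 1 (max C₁ C₂), le_max_left _ _, fun y hy => ⟨?_, ?_⟩⟩
  · exact (le_abs_self _).trans ((h₁ y hy).trans ((le_max_left _ _).trans (le_max_right _ _)))
  · exact (le_abs_self _).trans ((h₂ y hy).trans ((le_max_right _ _).trans (le_max_right _ _)))

lemma shapeGrad_sub_const (z : LocalNode k → ℝ) (a : ℝ) (y : E3) :
    shapeGrad (fun α => z α - a) y = shapeGrad z y := by
  simp only [shapeGrad, sub_smul, Finset.sum_sub_distrib, ← Finset.smul_sum, sum_fderiv_shape,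
    smul_zero, sub_zero]

lemma shapeGrad_smul (z : LocalNode k → ℝ) (a : ℝ) (y : E3) :
    shapeGrad (a • z) y = a • shapeGrad z y := by
  simp only [shapeGrad, Finset.smul_sum, smul_smul, Pi.smul_apply, smul_eq_mul]

lemma integrableOn_sq_norm_shapeGrad (z : LocalNode k → ℝ) :
    IntegrableOn (fun y => ‖shapeGrad z y‖ ^ 2) refSimplex volume :=
  ((continuous_shapeGrad z).norm.pow 2).continuousOn.integrableOn_compact isCompact_refSimplex

/-- Inverse estimate on the unit simplex. -/
lemma exists_inverse_estimate (hk : k ≠ 0) : ∃ C, 0 ≤ C ∧ ∀ z : LocalNode k → ℝ,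
    ∀ y ∈ refSimplex, ‖shapeGrad z y‖ ^ 2 ≤ C * ∫ x in refSimplex, ‖shapeGrad z x‖ ^ 2 := by
  classical
  have α₀ : LocalNode k := ⟨fun i => if i = 0 then ⟨k, k.lt_succ_self⟩ else 0, by
    simp [Fin.sum_univ_succ]⟩
  -- Gradients do not see constants, so nodal vectors are normalized to vanish at one node, any node
  -- being suitable. On the unit sphere of this space the energy is continuous and positive, hence
  -- bounded below; homogeneity does the rest.
  set K : Set (LocalNode k → ℝ) := Metric.sphere 0 1 ∩ {z | z α₀ = 0} with hK
  have hKc : IsCompact K := (isCompact_sphere 0 1).inter_right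
    (isClosed_eq (continuous_apply α₀) continuous_const)
  set I : (LocalNode k → ℝ) → ℝ := fun z => ∫ x in refSimplex, ‖shapeGrad z x‖ ^ 2 with hI
  have hI0 : ∀ z, 0 ≤ I z := fun z => integral_nonneg fun _ => by positivity
  have hjc : Continuous fun p : (LocalNode k → ℝ) × E3 => ‖shapeGrad p.1 p.2‖ ^ 2 := by
    unfold shapeGrad
    refine Continuous.pow (Continuous.norm (continuous_finsetSum _ fun α _ => ?_)) 2
    exact ((continuous_apply α).comp continuous_fst).smul
      ((continuous_fderiv_shape α).comp continuous_snd)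
  have hIc : Continuous I := continuous_parametric_integral_of_continuous hjc isCompact_refSimplex
  have hIpos : ∀ z ∈ K, 0 < I z := fun z hz => by
    refine lt_of_le_of_ne (hI0 z) fun h => ?_
    have h1 := eqOn_zero_of_setIntegral_eq_zero ((continuous_shapeGrad z).norm.pow 2)
      (fun _ => sq_nonneg _) h.symm
    -- Zero energy makes the polynomial constant on the convex simplex, so all nodal values
    -- coincide.
    have h2 : ∀ β, z β = z α₀ := fun β => by
      rw [← shapeSum_refNode hk z β, ← shapeSum_refNode hk z α₀]
      refine convex_refSimplex.is_const_of_fderivWithin_eq_zero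
        (fun y _ => (hasFDerivAt_shapeSum z y).differentiableAt.differentiableWithinAt)
        (fun y hy => ?_) (refNode_mem hk β) (refNode_mem hk α₀)
      rw [(hasFDerivAt_shapeSum z y).hasFDerivWithinAt.fderivWithin (uniqueDiffOn_refSimplex y hy)]
      simpa using h1 y hy
    have h3 : z = 0 := funext fun β => (h2 β).trans hz.2
    have h4 := hz.1
    rw [h3, mem_sphere_zero_iff_norm, norm_zero] at h4
    exact zero_ne_one h4
  obtain ⟨m, hm, hmI⟩ : ∃ m, 0 < m ∧ ∀ z ∈ K, m ≤ I z := by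
    rcases K.eq_empty_or_nonempty with hK0 | hK0
    · exact ⟨1, one_pos, by simp [hK0]⟩
    · obtain ⟨z₀, hz₀, hmin⟩ := hKc.exists_isMinOn hK0 hIc.continuousOn
      exact ⟨I z₀, hIpos z₀ hz₀, fun z hz => hmin hz⟩
  obtain ⟨C, hC1, hC⟩ := exists_shape_bound k
  have hC0 : 0 ≤ C := zero_le_one.trans hC1
  refine ⟨C ^ 2 / m, by positivity, fun z y hy => ?_⟩
  set w : LocalNode k → ℝ := fun α => z α - z α₀ with hw
  have hgw : ∀ y, shapeGrad z y = shapeGrad w y := fun y => (shapeGrad_sub_const z _ y).symm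
  simp only [hgw]
  have h1 : ‖shapeGrad w y‖ ≤ C * ‖w‖ := by
    refine (norm_sum_le _ _).trans ?_
    have : ∀ α ∈ Finset.univ, ‖w α • fderiv ℝ (shape α) y‖ ≤ ‖fderiv ℝ (shape α) y‖ * ‖w‖ :=
      fun α _ => by
        rw [norm_smul, mul_comm]
        gcongr
        exact norm_le_pi_norm w α
    refine (Finset.sum_le_sum this).trans ?_
    rw [← Finset.sum_mul]
    exact mul_le_mul_of_nonneg_right (hC y hy).1 (norm_nonneg _)
  have h2 : m * ‖w‖ ^ 2 ≤ I w := by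
    rcases eq_or_ne w 0 with h0 | h0
    · rw [h0, norm_zero]; simpa using hI0 0
    have hn : 0 < ‖w‖ := norm_pos_iff.2 h0
    have hmem : ‖w‖⁻¹ • w ∈ K := by
      refine ⟨?_, ?_⟩
      · rw [mem_sphere_zero_iff_norm, norm_smul, norm_inv, norm_norm, inv_mul_cancel₀ hn.ne']
      · simp [hw]
    have h3 := hmI _ hmem
    have h4 : I (‖w‖⁻¹ • w) = (‖w‖⁻¹) ^ 2 * I w := by
      simp only [hI, shapeGrad_smul, norm_smul, mul_pow, norm_inv, norm_norm]
      rw [integral_const_mul]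
    rw [h4, inv_pow, inv_mul_eq_div, le_div_iff₀ (by positivity)] at h3
    exact h3
  calc ‖shapeGrad w y‖ ^ 2 ≤ (C * ‖w‖) ^ 2 := by gcongr
    _ = C ^ 2 / m * (m * ‖w‖ ^ 2) := by field_simp
    _ ≤ _ := by gcongr

/-! ### Poincaré inequality for continuous, piecewise smooth functions -/

/-- Cauchy–Schwarz, from the nonnegativity of the integral of `(f - m) ^ 2` with `m` the mean of
`f`. -/
lemma sq_integral_le {f : ℝ → ℝ} {a b : ℝ} (hab : a < b)
    (hf : IntervalIntegrable f volume a b) (hf2 : IntervalIntegrable (fun s => f s ^ 2) volume a b) :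
    (∫ s in a..b, f s) ^ 2 ≤ (b - a) * ∫ s in a..b, f s ^ 2 := by
  have hL : 0 < b - a := sub_pos.2 hab
  set I := ∫ s in a..b, f s with hI
  set m := I / (b - a) with hm
  have h0 : 0 ≤ ∫ s in a..b, (f s ^ 2 - 2 * m * f s + m ^ 2) :=
    intervalIntegral.integral_nonneg hab.le fun s _ => by nlinarith [sq_nonneg (f s - m)]
  rw [intervalIntegral.integral_add (f := fun s => f s ^ 2 - 2 * m * f s) (g := fun _ => m ^ 2)
      (hf2.sub (hf.const_mul _)) intervalIntegrable_const,
    intervalIntegral.integral_sub (f := fun s => f s ^ 2) (g := fun s => 2 * m * f s) hf2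
      (hf.const_mul _), intervalIntegral.integral_const_mul,
    intervalIntegral.integral_const, smul_eq_mul, ← hI] at h0
  have h1 : (b - a) * m = I := by rw [hm]; field_simp
  have h2 : 0 ≤ (b - a) * ((∫ s in a..b, f s ^ 2) - 2 * m * I + (b - a) * m ^ 2) :=
    mul_nonneg hL.le h0
  have h3 : (b - a) * ((∫ s in a..b, f s ^ 2) - 2 * m * I + (b - a) * m ^ 2) =
      (b - a) * (∫ s in a..b, f s ^ 2) - I ^ 2 := by rw [← h1]; ring
  linarith

section Piecewise

variable {ι : Type} [Fintype ι] {K : ι → Set E3} {V : ι → E3 → ℝ} {W : ι → E3 → StrongDual ℝ E3}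

/-- Continuous functions on finitely many compact pieces that agree on the overlaps and vanish on
the boundary of the union, extended by zero. -/
lemma exists_glue (hK : ∀ i, IsCompact (K i)) (hV : ∀ i, Continuous (V i))
    (hcons : ∀ i j, ∀ x ∈ K i, x ∈ K j → V i x = V j x)
    (hfr : ∀ i, ∀ x ∈ K i, x ∈ frontier (⋃ i, K i) → V i x = 0) :
    ∃ φ : E3 → ℝ, Continuous φ ∧ (∀ i, ∀ x ∈ K i, φ x = V i x) ∧ ∀ x ∉ ⋃ i, K i, φ x = 0 := by
  classical
  set φ : E3 → ℝ := fun x => if h : ∃ i, x ∈ K i then V h.choose x else 0 with hφ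
  have h1 : ∀ i, ∀ x ∈ K i, φ x = V i x := fun i x hx => by
    have h : ∃ i, x ∈ K i := ⟨i, hx⟩
    simp only [hφ, dif_pos h]
    exact hcons _ _ x h.choose_spec hx
  have h2 : ∀ x ∉ ⋃ i, K i, φ x = 0 := fun x hx => by
    rw [mem_iUnion] at hx
    simp only [hφ, dif_neg hx]
  have hclosed : IsClosed (⋃ i, K i) := isClosed_iUnion_of_finite fun i => (hK i).isClosed
  -- A point of the union that is a limit of outside points is a frontier point, where the pieces
  -- vanish. So `φ` is continuous on two closed sets that cover the space.
  have h3 : ∀ x ∈ closure (⋃ i, K i)ᶜ, φ x = 0 := fun x hx => by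
    by_cases hxP : x ∈ ⋃ i, K i
    · obtain ⟨i, hi⟩ := mem_iUnion.1 hxP
      rw [h1 i x hi]
      refine hfr i x hi ?_
      rw [frontier_eq_closure_inter_closure]
      exact ⟨subset_closure hxP, hx⟩
    · exact h2 x hxP
  refine ⟨φ, ?_, h1, h2⟩
  have hc : ContinuousOn φ (⋃ i, K i) :=
    (locallyFinite_of_finite K).continuousOn_iUnion (fun i => (hK i).isClosed) fun i =>
      (hV i).continuousOn.congr (h1 i)
  have hc2 : ContinuousOn φ (closure (⋃ i, K i)ᶜ) := continuousOn_const.congr h3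
  rw [← continuousOn_univ]
  have := hc.union_of_isClosed hc2 hclosed isClosed_closure
  refine this.mono fun x _ => ?_
  by_cases hx : x ∈ ⋃ i, K i
  · exact Or.inl hx
  · exact Or.inr (subset_closure hx)

/-- On a line, a piecewise smooth function is differentiable except in finitely many points. -/
lemma exists_hasDerivAt_line (hK : ∀ i, IsCompact (K i)) (hKv : ∀ i, Convex ℝ (K i))
    (hV : ∀ i x, HasFDerivAt (V i) (W i x) x) {φ : E3 → ℝ}
    (h1 : ∀ i, ∀ x ∈ K i, φ x = V i x) (h2 : ∀ x ∉ ⋃ i, K i, φ x = 0) (x e : E3) (he : ‖e‖ = 1) :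
    ∃ N : Set ℝ, N.Countable ∧ ∀ s ∉ N, ∃ d, HasDerivAt (fun s : ℝ => φ (x + s • e)) d s ∧
      (d = 0 ∨ ∃ i, x + s • e ∈ K i ∧ |d| ≤ ‖W i (x + s • e)‖) := by
  set l : ℝ → E3 := fun s => x + s • e with hl
  have hlc : Continuous l := by fun_prop
  have hld : ∀ s, HasDerivAt l e s := fun s => by
    have := ((hasDerivAt_id s).smul_const e).const_add x
    rwa [one_smul] at this
  set I : ι → Set ℝ := fun i => l ⁻¹' K i with hI
  have hIcl : ∀ i, IsClosed (I i) := fun i => (hK i).isClosed.preimage hlc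
  have hnorm : ∀ s t, ‖l s - l t‖ = |s - t| := fun s t => by
    simp only [hl, add_sub_add_left_eq_sub, ← sub_smul, norm_smul, he, mul_one, Real.norm_eq_abs]
  have hIc : ∀ i, IsCompact (I i) := fun i => by
    refine Metric.isCompact_of_isClosed_isBounded (hIcl i) ?_
    rw [Metric.isBounded_iff]
    obtain ⟨C, hC⟩ := Metric.isBounded_iff.1 (hK i).isBounded
    refine ⟨C, fun s hs t ht => ?_⟩
    rw [Real.dist_eq, ← hnorm, ← dist_eq_norm]
    exact hC hs ht
  have hIv : ∀ i, Convex ℝ (I i) := fun i s hs t ht a b ha hb hab => by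
    have : l (a • s + b • t) = a • l s + b • l t := by
      simp only [hl, smul_eq_mul]
      have hx : x = (a + b) • x := by rw [hab, one_smul]
      nth_rw 1 [hx]
      module
    rw [hI, mem_preimage, this]
    exact hKv i hs ht ha hb hab
  -- A line meets a compact convex piece in a compact interval, and off the endpoints of these
  -- intervals it is locally inside one piece or outside all of them.
  refine ⟨⋃ i, frontier (I i), countable_iUnion fun i => ?_, fun s hs => ?_⟩
  · rcases (I i).eq_empty_or_nonempty with h0 | h0
    · simp [h0]
    · rw [eq_Icc_of_connected_compact ((hIv i).isConnected h0) (hIc i),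
        frontier_Icc (Real.sInf_le_sSup _ (hIc i).bddBelow (hIc i).bddAbove)]
      exact (Set.toFinite _).countable
  · rw [mem_iUnion] at hs
    push Not at hs
    by_cases hex : ∃ i, s ∈ I i
    · obtain ⟨i, hi⟩ := hex
      have hint : s ∈ interior (I i) := by
        by_contra hn
        exact hs i ⟨subset_closure hi, hn⟩
      refine ⟨W i (l s) e, ?_, Or.inr ⟨i, hi, ?_⟩⟩
      · refine ((hV i (l s)).comp_hasDerivAt s (hld s)).congr_of_eventuallyEq ?_
        filter_upwards [mem_interior_iff_mem_nhds.1 hint] with r hr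
        exact h1 i _ hr
      · rw [← Real.norm_eq_abs]
        simpa [he] using (W i (l s)).le_opNorm e
    · push Not at hex
      refine ⟨0, ?_, Or.inl rfl⟩
      have hn : ∀ᶠ r in nhds s, ∀ i, r ∉ I i := by
        rw [Filter.eventually_all]
        exact fun i => (hIcl i).isOpen_compl.mem_nhds (hex i)
      refine (hasDerivAt_const s (0 : ℝ)).congr_of_eventuallyEq ?_
      filter_upwards [hn] with r hr
      refine h2 _ ?_
      rw [mem_iUnion]
      exact fun ⟨i, hi⟩ => hr i hi

variable {L : ℝ}

/-- Fundamental theorem of calculus along a line that leaves the union of the pieces. -/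
lemma exists_line_integral (hL : 0 < L) (hK : ∀ i, IsCompact (K i)) (hKv : ∀ i, Convex ℝ (K i))
    (hV : ∀ i x, HasFDerivAt (V i) (W i x) x) (hW : ∀ i, Continuous (W i)) {φ : E3 → ℝ}
    (hφ : Continuous φ)
    (h1 : ∀ i, ∀ x ∈ K i, φ x = V i x) (h2 : ∀ x ∉ ⋃ i, K i, φ x = 0)
    (hdiam : ∀ x ∈ ⋃ i, K i, ∀ y ∈ ⋃ i, K i, dist x y < L) (e : E3) (he : ‖e‖ = 1)
    (x : E3) (hx : x ∈ ⋃ i, K i) :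
    ∃ d : ℝ → ℝ, IntervalIntegrable d volume (-L) 0 ∧
      IntervalIntegrable (fun s => d s ^ 2) volume (-L) 0 ∧ φ x = ∫ s in (-L)..0, d s ∧
      ∀ᵐ s, d s = 0 ∨ ∃ i, x + s • e ∈ K i ∧ |d s| ≤ ‖W i (x + s • e)‖ := by
  obtain ⟨N, hN, hd⟩ := exists_hasDerivAt_line hK hKv hV h1 h2 x e he
  set γ : ℝ → ℝ := fun s => φ (x + s • e) with hγ
  have hγc : Continuous γ := by fun_prop
  have hae : ∀ᵐ s, deriv γ s = 0 ∨ ∃ i, x + s • e ∈ K i ∧ |deriv γ s| ≤ ‖W i (x + s • e)‖ := by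
    filter_upwards [hN.ae_notMem volume] with s hs
    obtain ⟨d, hd1, hd2⟩ := hd s hs
    rwa [hd1.deriv]
  have hM : ∃ M, 0 ≤ M ∧ ∀ i, ∀ x ∈ K i, ‖W i x‖ ≤ M := by
    choose C hC using fun i => (hK i).exists_bound_of_continuousOn (hW i).continuousOn
    refine ⟨∑ i, |C i|, Finset.sum_nonneg fun i _ => abs_nonneg _, fun i x hx => ?_⟩
    exact (hC i x hx).trans ((le_abs_self _).trans
      (Finset.single_le_sum (f := fun i => |C i|) (fun i _ => abs_nonneg _) (Finset.mem_univ i)))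
  obtain ⟨M, hM0, hM⟩ := hM
  have hbound : ∀ᵐ s, |deriv γ s| ≤ M := by
    filter_upwards [hae] with s hs
    rcases hs with h | ⟨i, hi, h⟩
    · rw [h, abs_zero]; exact hM0
    · exact h.trans (hM i _ hi)
  have hmeas : Measurable (deriv γ) := measurable_deriv γ
  have hint : IntervalIntegrable (deriv γ) volume (-L) 0 := by
    rw [intervalIntegrable_iff]
    exact Measure.integrableOn_of_bounded (M := M) (by simp) hmeas.aestronglyMeasurable
      (ae_restrict_of_ae hbound)
  refine ⟨deriv γ, hint, ?_, ?_, hae⟩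
  · rw [intervalIntegrable_iff]
    refine Measure.integrableOn_of_bounded (M := M ^ 2) (by simp)
      (hmeas.pow_const 2).aestronglyMeasurable (ae_restrict_of_ae ?_)
    filter_upwards [hbound] with s hs
    rw [norm_pow, Real.norm_eq_abs]
    gcongr
  · rw [integral_eq_of_hasDerivAt_off_countable γ (deriv γ) hN hγc.continuousOn
      (fun s hs => ?_) hint]
    -- The starting point has distance `L` from `x`, more than any two points of the union can have,
    -- so it lies outside and contributes nothing.
    · have : γ (-L) = 0 := by
        refine h2 _ fun hmem => ?_
        have := hdiam _ hmem x hx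
        rw [dist_eq_norm, add_sub_cancel_left, norm_smul, he, mul_one, norm_neg, Real.norm_eq_abs,
          abs_of_pos hL] at this
        exact lt_irrefl _ this
      rw [this]
      simp [hγ]
    · obtain ⟨d, hd1, _⟩ := hd s hs.2
      exact hd1.differentiableAt.hasDerivAt

/-- Maximum bound for piecewise smooth functions with zero boundary values. -/
lemma abs_le_of_piecewise (hL : 0 < L) (hK : ∀ i, IsCompact (K i)) (hKv : ∀ i, Convex ℝ (K i))
    (hV : ∀ i x, HasFDerivAt (V i) (W i x) x) (hW : ∀ i, Continuous (W i))
    (hcons : ∀ i j, ∀ x ∈ K i, x ∈ K j → V i x = V j x)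
    (hfr : ∀ i, ∀ x ∈ K i, x ∈ frontier (⋃ i, K i) → V i x = 0)
    (hdiam : ∀ x ∈ ⋃ i, K i, ∀ y ∈ ⋃ i, K i, dist x y < L) {ε : ℝ}
    (hε : ∀ i, ∀ x ∈ K i, ‖W i x‖ ≤ ε) (i : ι) (x : E3) (hx : x ∈ K i) : |V i x| ≤ L * ε := by
  obtain ⟨φ, hφ, h1, h2⟩ := exists_glue hK
    (fun i => continuous_iff_continuousAt.2 fun x => (hV i x).continuousAt) hcons hfr
  obtain ⟨d, hd1, -, hd3, hd4⟩ := exists_line_integral hL hK hKv hV hW hφ h1 h2 hdiam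
    (EuclideanSpace.single 0 1) (by simp) x (mem_iUnion.2 ⟨i, hx⟩)
  have hε0 : 0 ≤ ε := (norm_nonneg _).trans (hε i x hx)
  rw [← h1 i x hx, hd3, ← Real.norm_eq_abs]
  refine (intervalIntegral.norm_integral_le_of_norm_le_const_ae (C := ε) ?_).trans (le_of_eq ?_)
  · filter_upwards [hd4] with s hs _
    rcases hs with h | ⟨i, hi, h⟩
    · rw [h, norm_zero]; exact hε0
    · exact h.trans (hε i _ hi)
  · rw [sub_neg_eq_add, zero_add, abs_of_pos hL, mul_comm]

/-- Poincaré inequality for piecewise smooth functions with zero boundary values. -/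
lemma poincare_of_piecewise (hL : 0 < L) (hK : ∀ i, IsCompact (K i)) (hKv : ∀ i, Convex ℝ (K i))
    (hdisj : Pairwise fun i j => volume (K i ∩ K j) = 0)
    (hV : ∀ i x, HasFDerivAt (V i) (W i x) x) (hW : ∀ i, Continuous (W i))
    (hcons : ∀ i j, ∀ x ∈ K i, x ∈ K j → V i x = V j x)
    (hfr : ∀ i, ∀ x ∈ K i, x ∈ frontier (⋃ i, K i) → V i x = 0)
    (hdiam : ∀ x ∈ ⋃ i, K i, ∀ y ∈ ⋃ i, K i, dist x y < L) :
    ∑ i, ∫ x in K i, V i x ^ 2 ≤ L ^ 2 * ∑ i, ∫ x in K i, ‖W i x‖ ^ 2 := by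
  have hVc : ∀ i, Continuous (V i) :=
    fun i => continuous_iff_continuousAt.2 fun x => (hV i x).continuousAt
  obtain ⟨φ, hφ, h1, h2⟩ := exists_glue hK hVc hcons hfr
  set e : E3 := EuclideanSpace.single 0 1 with he
  -- Points in several pieces are counted several times, which is harmless for an upper bound.
  -- Negligible overlaps are used only when the left side is split into pieces.
  set ρ : E3 → ENNReal := fun x => ∑ i, (K i).indicator (fun x => ENNReal.ofReal (‖W i x‖ ^ 2)) x
    with hρ
  have hKm : ∀ i, MeasurableSet (K i) := fun i => (hK i).isClosed.measurableSet
  have hWm : ∀ i, Measurable fun x => ENNReal.ofReal (‖W i x‖ ^ 2) := fun i =>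
    (ENNReal.continuous_ofReal.comp ((hW i).norm.pow 2)).measurable
  have hρm : Measurable ρ :=
    Finset.measurable_sum _ fun i _ => Measurable.indicator (hWm i) (hKm i)
  have hpt : ∀ x ∈ ⋃ i, K i, ENNReal.ofReal (φ x ^ 2) ≤
      ENNReal.ofReal L * ∫⁻ s in Ioc (-L) 0, ρ (x + s • e) := fun x hx => by
    obtain ⟨d, hd1, hd2, hd3, hd4⟩ := exists_line_integral hL hK hKv hV hW hφ h1 h2 hdiam
      e (by simp [he]) x hx
    have h3 := sq_integral_le (neg_lt_zero.2 hL) hd1 hd2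
    rw [← hd3, zero_sub, neg_neg] at h3
    refine (ENNReal.ofReal_le_ofReal h3).trans ?_
    rw [ENNReal.ofReal_mul hL.le, intervalIntegral.integral_of_le (neg_nonpos.2 hL.le),
      ofReal_integral_eq_lintegral_ofReal
        ((intervalIntegrable_iff_integrableOn_Ioc_of_le (neg_nonpos.2 hL.le)).1 hd2)
        (Filter.Eventually.of_forall fun s => sq_nonneg _)]
    refine mul_le_mul_right (lintegral_mono_ae (ae_restrict_of_ae ?_)) _
    filter_upwards [hd4] with s hs
    rcases hs with h | ⟨i, hi, h⟩
    · simp [h]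
    · calc ENNReal.ofReal (d s ^ 2) ≤ ENNReal.ofReal (‖W i (x + s • e)‖ ^ 2) := by
            rw [← sq_abs]
            gcongr
        _ = (K i).indicator (fun x => ENNReal.ofReal (‖W i x‖ ^ 2)) (x + s • e) := by
            rw [indicator_of_mem hi]
        _ ≤ _ := Finset.single_le_sum
            (f := fun i => (K i).indicator (fun x => ENNReal.ofReal (‖W i x‖ ^ 2)) (x + s • e))
            (fun i _ => zero_le) (Finset.mem_univ i)
  have hPm : MeasurableSet (⋃ i, K i) := MeasurableSet.iUnion hKm
  -- After Tonelli the inner integral runs over all space and is translation invariant, so the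
  -- integration in `s` contributes the second factor `L`.
  have hmain : ∫⁻ x in ⋃ i, K i, ENNReal.ofReal (φ x ^ 2) ≤
      ENNReal.ofReal (L ^ 2) * ∫⁻ x, ρ x := by
    have hm2 : Measurable fun z : E3 × ℝ => ρ (z.1 + z.2 • e) :=
      hρm.comp (by fun_prop)
    calc _ ≤ ∫⁻ x in ⋃ i, K i, ENNReal.ofReal L * ∫⁻ s in Ioc (-L) 0, ρ (x + s • e) :=
          setLIntegral_mono' hPm hpt
      _ ≤ ∫⁻ x, ENNReal.ofReal L * ∫⁻ s in Ioc (-L) 0, ρ (x + s • e) :=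
          setLIntegral_le_lintegral _ _
      _ = ENNReal.ofReal L * ∫⁻ x, ∫⁻ s in Ioc (-L) 0, ρ (x + s • e) :=
          lintegral_const_mul' _ _ ENNReal.ofReal_ne_top
      _ = ENNReal.ofReal L * ∫⁻ s in Ioc (-L) 0, ∫⁻ x, ρ (x + s • e) := by
          rw [lintegral_lintegral_swap hm2.aemeasurable]
      _ = ENNReal.ofReal L * ∫⁻ s in Ioc (-L) 0, ∫⁻ x, ρ x := by
          simp only [lintegral_add_right_eq_self]
      _ = _ := by
          rw [setLIntegral_const, Real.volume_Ioc, zero_sub, neg_neg, pow_two,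
            ENNReal.ofReal_mul hL.le]
          ring
  have hl : ENNReal.ofReal (∑ i, ∫ x in K i, V i x ^ 2) =
      ∫⁻ x in ⋃ i, K i, ENNReal.ofReal (φ x ^ 2) := by
    rw [lintegral_iUnion₀ (fun i => (hKm i).nullMeasurableSet) hdisj, tsum_fintype,
      ENNReal.ofReal_sum_of_nonneg fun i _ => integral_nonneg fun x => sq_nonneg _]
    refine Finset.sum_congr rfl fun i _ => ?_
    rw [ofReal_integral_eq_lintegral_ofReal (f := fun x => V i x ^ 2)
      (((hVc i).pow 2).continuousOn.integrableOn_compact (hK i))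
      (Filter.Eventually.of_forall fun s => sq_nonneg _)]
    exact setLIntegral_congr_fun (hKm i) fun x hx => by simp only [h1 i x hx]
  have hr : ∫⁻ x, ρ x = ENNReal.ofReal (∑ i, ∫ x in K i, ‖W i x‖ ^ 2) := by
    rw [hρ, lintegral_finsetSum
      (f := fun i => (K i).indicator (fun x => ENNReal.ofReal (‖W i x‖ ^ 2))) _ fun i _ => (Measurable.indicator (hWm i) (hKm i)),
      ENNReal.ofReal_sum_of_nonneg fun i _ => integral_nonneg fun x => sq_nonneg _]
    refine Finset.sum_congr rfl fun i _ => ?_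
    rw [lintegral_indicator (hKm i), ofReal_integral_eq_lintegral_ofReal (f := fun x => ‖W i x‖ ^ 2)
      (((hW i).norm.pow 2).continuousOn.integrableOn_compact (hK i))
      (Filter.Eventually.of_forall fun s => sq_nonneg _)]
  rw [← hl, hr, ← ENNReal.ofReal_mul (sq_nonneg L)] at hmain
  refine (ENNReal.ofReal_le_ofReal_iff ?_).1 hmain
  exact mul_nonneg (sq_nonneg _) (Finset.sum_nonneg fun i _ => integral_nonneg fun x => sq_nonneg _)

end Piecewise

/-! ### Barycentric coordinates and simplices -/

/-- The point with given barycentric coordinates. -/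
def ofBary (b : Fin 4 → ℝ) : E3 := WithLp.toLp 2 fun i => b i.succ

lemma bary_ofBary {b : Fin 4 → ℝ} (hb : ∑ i, b i = 1) : bary (ofBary b) = b := by
  rw [Fin.sum_univ_succ] at hb
  funext i
  refine Fin.cases ?_ (fun i => rfl) i
  rw [bary_zero]
  simp only [ofBary]
  linarith

lemma ofBary_bary (y : E3) : ofBary (bary y) = y := rfl

lemma bary_combo (x y : E3) {a b : ℝ} (hab : a + b = 1) (i : Fin 4) :
    bary (a • x + b • y) i = a * bary x i + b * bary y i := by
  refine Fin.cases ?_ (fun i => by simp [bary_succ]) i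
  simp only [bary_zero, PiLp.add_apply, PiLp.smul_apply, smul_eq_mul, Finset.sum_add_distrib,
    ← Finset.mul_sum]
  linear_combination (-1 : ℝ) * hab

lemma bary_add_sub (x y w : E3) (i : Fin 4) :
    bary (x + w) i - bary x i = bary (y + w) i - bary y i := by
  refine Fin.cases ?_ (fun i => by simp [bary_succ]) i
  simp only [bary_zero, PiLp.add_apply, Finset.sum_add_distrib]
  ring

/-- The linear part of the affine map onto a simplex. -/
def linPart (S : Fin 4 → E3) : E3 →L[ℝ] E3 :=
  ∑ i : Fin 3, (EuclideanSpace.proj i : E3 →L[ℝ] ℝ).smulRight (S i.succ - S 0)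

lemma linPart_apply (S : Fin 4 → E3) (y : E3) :
    linPart S y = ∑ i : Fin 3, y i • (S i.succ - S 0) := by
  simp [linPart]

lemma affineMap_eq (S : Fin 4 → E3) (y : E3) : affineMap S y = S 0 + linPart S y := by
  rw [affineMap, linPart_apply, Fin.sum_univ_succ]
  simp only [bary_succ, bary_zero, smul_sub, Finset.sum_sub_distrib, sub_smul, Finset.sum_smul,
    one_smul]
  module

lemma hasFDerivAt_affineMap (S : Fin 4 → E3) (y : E3) :
    HasFDerivAt (affineMap S) (linPart S) y := by
  have : affineMap S = fun y => S 0 + linPart S y := funext (affineMap_eq S)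
  rw [this]
  exact (linPart S).hasFDerivAt.const_add _

lemma continuous_affineMap (S : Fin 4 → E3) : Continuous (affineMap S) :=
  continuous_iff_continuousAt.2 fun y => (hasFDerivAt_affineMap S y).continuousAt

lemma affineMap_combo (S : Fin 4 → E3) (x y : E3) {a b : ℝ} (hab : a + b = 1) :
    affineMap S (a • x + b • y) = a • affineMap S x + b • affineMap S y := by
  simp only [affineMap, bary_combo x y hab, add_smul, Finset.sum_add_distrib, Finset.smul_sum,
    mul_smul]

variable {S S' : Fin 4 → E3}

lemma linPart_isInvertible (hS : AffineIndependent ℝ S) : (linPart S).IsInvertible := by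
  have h1 : LinearIndependent ℝ fun i : Fin 3 => S i.succ - S 0 := by
    have h := (affineIndependent_iff_linearIndependent_vsub ℝ S 0).1 hS
    exact h.comp (fun i : Fin 3 => (⟨i.succ, Fin.succ_ne_zero i⟩ : {x : Fin 4 // x ≠ 0}))
      fun i j hij => Fin.succ_injective _ (congrArg Subtype.val hij)
  have hinj : Function.Injective (linPart S) := by
    rw [injective_iff_map_eq_zero]
    intro y hy
    rw [linPart_apply] at hy
    ext i
    exact Fintype.linearIndependent_iff.1 h1 _ hy i
  exact ⟨(LinearEquiv.ofInjectiveEndo (linPart S : E3 →ₗ[ℝ] E3) hinj).toContinuousLinearEquiv,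
    ContinuousLinearMap.ext fun x => rfl⟩

/-- The inverse of the affine map onto a simplex. -/
def affineInv (S : Fin 4 → E3) (x : E3) : E3 := (linPart S).inverse (x - S 0)

lemma affineInv_affineMap (hS : AffineIndependent ℝ S) (y : E3) :
    affineInv S (affineMap S y) = y := by
  rw [affineInv, affineMap_eq, add_sub_cancel_left,
    (linPart_isInvertible hS).inverse_apply_eq]

lemma affineMap_affineInv (hS : AffineIndependent ℝ S) (x : E3) :
    affineMap S (affineInv S x) = x := by
  have h := ((linPart_isInvertible hS).inverse_apply_eq
    (x := (linPart S).inverse (x - S 0)) (y := x - S 0)).1 rfl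
  rw [affineMap_eq, affineInv, ← h]
  abel

lemma affineMap_injective (hS : AffineIndependent ℝ S) : Function.Injective (affineMap S) :=
  Function.LeftInverse.injective (affineInv_affineMap hS)

lemma hasFDerivAt_affineInv (S : Fin 4 → E3) (x : E3) :
    HasFDerivAt (affineInv S) (linPart S).inverse x := by
  unfold affineInv
  have := (linPart S).inverse.hasFDerivAt.comp x ((hasFDerivAt_id x).sub_const (S 0))
  rwa [ContinuousLinearMap.comp_id] at this

lemma ofBary_single_mem (i : Fin 4) : ofBary (Pi.single i 1) ∈ refSimplex := fun j => by
  rw [bary_ofBary (by simp)]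
  by_cases h : j = i
  · subst h; simp
  · simp [h]

lemma affineMap_ofBary_single (S : Fin 4 → E3) (i : Fin 4) :
    affineMap S (ofBary (Pi.single i 1)) = S i := by
  rw [affineMap, bary_ofBary (by simp)]
  simp [Pi.single_apply, ite_smul]

lemma affineMap_mem_convexHull (S : Fin 4 → E3) {y : E3} (hy : y ∈ refSimplex) :
    affineMap S y ∈ convexHull ℝ (range S) :=
  (convex_convexHull ℝ _).sum_mem (fun i _ => hy i) (sum_bary y)
    fun i _ => subset_convexHull ℝ _ (mem_range_self i)

/-- Points of a face have vanishing barycentric coordinates off the face. -/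
lemma exists_of_mem_convexHull {I : Set (Fin 4)} {x : E3} (hx : x ∈ convexHull ℝ (S '' I)) :
    ∃ y ∈ refSimplex, (∀ i ∉ I, bary y i = 0) ∧ affineMap S y = x := by
  have hconv : Convex ℝ (affineMap S '' {y | y ∈ refSimplex ∧ ∀ i ∉ I, bary y i = 0}) := by
    rintro _ ⟨y, ⟨hy, hyI⟩, rfl⟩ _ ⟨y', ⟨hy', hyI'⟩, rfl⟩ a b ha hb hab
    refine ⟨a • y + b • y', ⟨convex_refSimplex hy hy' ha hb hab, fun i hi => ?_⟩,
      affineMap_combo S y y' hab⟩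
    rw [bary_combo y y' hab, hyI i hi, hyI' i hi]; simp
  have hsub : S '' I ⊆ affineMap S '' {y | y ∈ refSimplex ∧ ∀ i ∉ I, bary y i = 0} := by
    rintro _ ⟨i, hi, rfl⟩
    refine ⟨_, ⟨ofBary_single_mem i, fun j hj => ?_⟩, affineMap_ofBary_single S i⟩
    rw [bary_ofBary (by simp), Pi.single_eq_of_ne]
    rintro rfl
    exact hj hi
  obtain ⟨y, ⟨hy, hyI⟩, hyx⟩ := convexHull_min hsub hconv hx
  exact ⟨y, hy, hyI, hyx⟩

lemma image_affineMap (S : Fin 4 → E3) : affineMap S '' refSimplex = convexHull ℝ (range S) := by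
  refine Subset.antisymm ?_ fun x hx => ?_
  · rintro _ ⟨y, hy, rfl⟩
    exact affineMap_mem_convexHull S hy
  · rw [← image_univ] at hx
    obtain ⟨y, hy, -, hyx⟩ := exists_of_mem_convexHull hx
    exact ⟨y, hy, hyx⟩

lemma affineInv_mem (hS : AffineIndependent ℝ S) {x : E3} :
    affineInv S x ∈ refSimplex ↔ x ∈ convexHull ℝ (range S) := by
  rw [← image_affineMap]
  refine ⟨fun h => ⟨_, h, affineMap_affineInv hS x⟩, ?_⟩
  rintro ⟨y, hy, rfl⟩
  rwa [affineInv_affineMap hS]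

/-- Two simplices that meet in a common face: a matching of the vertices. -/
lemma exists_perm (hS : AffineIndependent ℝ S) (hS' : AffineIndependent ℝ S')
    (h : convexHull ℝ (range S) ∩ convexHull ℝ (range S') = convexHull ℝ (range S ∩ range S')) :
    ∃ π : Equiv.Perm (Fin 4), ∀ y ∈ refSimplex, affineMap S y ∈ convexHull ℝ (range S') →
      ∀ i, S' (π i) ≠ S i → bary y i = 0 := by
  classical
  have hf : ∀ i : {i // S i ∈ range S'}, ∃ j : {j // S' j ∈ range S}, S' j = S i := fun i => by
    obtain ⟨j, hj⟩ := i.2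
    exact ⟨⟨j, hj ▸ mem_range_self _⟩, hj⟩
  choose f hf using hf
  have hbij : Function.Bijective f := by
    refine ⟨fun i i' hii => Subtype.ext (hS.injective ?_), fun j => ?_⟩
    · rw [← hf i, ← hf i', hii]
    · obtain ⟨i, hi⟩ := j.2
      refine ⟨⟨i, hi ▸ mem_range_self _⟩, Subtype.ext (hS'.injective ?_)⟩
      rw [hf]; exact hi
  -- The bijection of the common vertices is extended arbitrarily. The remaining vertices do not
  -- matter, because points of the common face have zero coordinates there.
  refine ⟨(Equiv.ofBijective f hbij).extendSubtype, fun y hy hyS' i hi => ?_⟩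
  have hmem : affineMap S y ∈ convexHull ℝ (S '' {i | S i ∈ range S'}) := by
    have he : S '' {i | S i ∈ range S'} = range S ∩ range S' := by
      ext p
      constructor
      · rintro ⟨i, hi, rfl⟩; exact ⟨mem_range_self i, hi⟩
      · rintro ⟨⟨i, rfl⟩, hp⟩; exact ⟨i, hp, rfl⟩
    rw [he, ← h]
    exact ⟨affineMap_mem_convexHull S hy, hyS'⟩
  obtain ⟨y', -, hy', he⟩ := exists_of_mem_convexHull hmem
  rw [← affineMap_injective hS he]
  refine hy' i fun hiI => hi ?_
  rw [Equiv.extendSubtype_apply_of_mem _ _ hiI]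
  exact hf ⟨i, hiI⟩

/-- Transport of a point of a common face from one simplex to the other. -/
lemma affineMap_ofBary_perm {π : Equiv.Perm (Fin 4)} {b : Fin 4 → ℝ} (hb : ∑ i, b i = 1)
    (h : ∀ i, S' (π i) ≠ S i → b i = 0) :
    affineMap S' (ofBary (b ∘ π.symm)) = affineMap S (ofBary b) := by
  have hb' : ∑ i, (b ∘ π.symm) i = 1 := by rw [← hb]; exact Equiv.sum_comp π.symm b
  rw [affineMap, affineMap, bary_ofBary hb, bary_ofBary hb', ← Equiv.sum_comp π]
  refine Finset.sum_congr rfl fun i _ => ?_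
  by_cases hi : S' (π i) = S i
  · simp [hi]
  · simp [h i hi]

/-- Some vertex of `S` is not a vertex of `S'`, so the common face lies in the affine span of the
other vertices of `S`, a proper subspace. -/
lemma volume_inter_eq_zero (hS : AffineIndependent ℝ S) (hS' : AffineIndependent ℝ S')
    (h : convexHull ℝ (range S) ∩ convexHull ℝ (range S') = convexHull ℝ (range S ∩ range S'))
    (hne : range S ≠ range S') :
    volume (convexHull ℝ (range S) ∩ convexHull ℝ (range S')) = 0 := by
  have hex : ∃ i, S i ∉ range S' := by
    by_contra hall
    push Not at hall
    refine hne (Set.eq_of_subset_of_ncard_le (range_subset_iff.2 hall) ?_ (Set.toFinite _))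
    rw [← image_univ, ← image_univ, Set.ncard_image_of_injective _ hS.injective,
      Set.ncard_image_of_injective _ hS'.injective]
  obtain ⟨i, hi⟩ := hex
  have hsub : range S ∩ range S' ⊆ S '' (univ \ {i}) := by
    rintro _ ⟨⟨j, rfl⟩, hj⟩
    refine ⟨j, ⟨mem_univ _, ?_⟩, rfl⟩
    rintro rfl
    exact hi hj
  rw [h]
  refine measure_mono_null ((convexHull_mono hsub).trans (convexHull_subset_affineSpan _))
    (Measure.addHaar_affineSubspace _ _ fun htop => ?_)
  have := hS.notMem_affineSpan_sdiff i univ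
  rw [htop] at this
  exact this (AffineSubspace.mem_top ℝ _ _)

end HarmonicFEM

namespace HarmonicFEM
namespace ExactTriangulation

variable {Ω₀ : Set E3} (𝒯 : ExactTriangulation Ω₀) {k : ℕ}

/-! ### Finite element functions on the flat triangulation -/

/-- A simplex, as a set. -/
def hull (S : 𝒯.simplices) : Set E3 := convexHull ℝ (range S.1)

/-- The union of the simplices. -/
def carrier : Set E3 := ⋃ S : 𝒯.simplices, 𝒯.hull S

lemma biUnion_eq_carrier : (⋃ S ∈ 𝒯.simplices, convexHull ℝ (range S)) = 𝒯.carrier := by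
  ext x
  simp [carrier, hull]

lemma indep (S : 𝒯.simplices) : AffineIndependent ℝ S.1 := 𝒯.affineIndependent S.1 S.2

lemma isCompact_hull (S : 𝒯.simplices) : IsCompact (𝒯.hull S) := by
  rw [hull, ← image_affineMap]
  exact isCompact_refSimplex.image (continuous_affineMap S.1)

lemma convex_hull (S : 𝒯.simplices) : Convex ℝ (𝒯.hull S) := convex_convexHull ℝ _

lemma affineMap_mem_hull (S : 𝒯.simplices) {y : E3} (hy : y ∈ refSimplex) :
    affineMap S.1 y ∈ 𝒯.hull S := affineMap_mem_convexHull S.1 hy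

lemma affineMap_mem_carrier (S : 𝒯.simplices) {y : E3} (hy : y ∈ refSimplex) :
    affineMap S.1 y ∈ 𝒯.carrier := mem_iUnion.2 ⟨S, 𝒯.affineMap_mem_hull S hy⟩

lemma exists_perm (S S' : 𝒯.simplices) : ∃ π : Equiv.Perm (Fin 4), ∀ y ∈ refSimplex,
    affineMap S.1 y ∈ 𝒯.hull S' → ∀ i, S'.1 (π i) ≠ S.1 i → bary y i = 0 :=
  HarmonicFEM.exists_perm (𝒯.indep S) (𝒯.indep S') (𝒯.conforming S.1 S.2 S'.1 S'.2)

lemma mem_frontier_of_carrier {x : E3} (hx : x ∈ frontier 𝒯.carrier) :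
    𝒯.G x ∈ frontier Ω₀ := by
  rw [← 𝒯.image_frontier_G, biUnion_eq_carrier]
  exact mem_image_of_mem _ hx

/-- Points in the relative interior of the same face are simultaneously interior points. -/
lemma interior_of_support_eq (S : 𝒯.simplices) {y q : E3} (hy : y ∈ refSimplex)
    (hq : q ∈ refSimplex) (h : ∀ i, bary y i = 0 ↔ bary q i = 0)
    (hqi : affineMap S.1 q ∈ interior 𝒯.carrier) : affineMap S.1 y ∈ interior 𝒯.carrier := by
  set x := affineMap S.1 y with hx
  set p := affineMap S.1 q with hp
  rw [mem_interior_iff_mem_nhds, ← map_add_left_nhds_zero, Filter.mem_map]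
  -- A small neighbourhood of `p` is transplanted to `x` by translation. For small `w` the point `p
  -- + w` lies in a simplex `S'` that contains `p`, hence also `x`. The coordinates in `S'` that are
  -- positive at `x` stay positive; the others vanish at both points and change by the same amount,
  -- so nonnegativity at `p + w` carries over to `x + w`.
  have h1 : ∀ᶠ w in nhds (0 : E3), p + w ∈ 𝒯.carrier := by
    have := mem_interior_iff_mem_nhds.1 hqi
    rwa [← map_add_left_nhds_zero, Filter.mem_map] at this
  have hcont : Continuous fun w : E3 => p + w := by fun_prop
  have h2 : ∀ᶠ w in nhds (0 : E3), ∀ S' : 𝒯.simplices, p ∉ 𝒯.hull S' → p + w ∉ 𝒯.hull S' := by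
    rw [Filter.eventually_all]
    intro S'
    by_cases hpS : p ∈ 𝒯.hull S'
    · exact Filter.Eventually.of_forall fun w h => absurd hpS h
    · have : ∀ᶠ w in nhds (0 : E3), p + w ∈ (𝒯.hull S')ᶜ :=
        hcont.continuousAt.eventually
          ((𝒯.isCompact_hull S').isClosed.isOpen_compl.mem_nhds (by simpa using hpS))
      filter_upwards [this] with w hw _ using hw
  have h3 : ∀ᶠ w in nhds (0 : E3), ∀ S' : 𝒯.simplices, ∀ j, 0 < bary (affineInv S'.1 x) j →
      0 < bary (affineInv S'.1 (x + w)) j := by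
    rw [Filter.eventually_all]
    intro S'
    rw [Filter.eventually_all]
    intro j
    by_cases hj : 0 < bary (affineInv S'.1 x) j
    · have hc : Continuous fun w : E3 => bary (affineInv S'.1 (x + w)) j := by
        have : Continuous (affineInv S'.1) :=
          continuous_iff_continuousAt.2 fun x => (hasFDerivAt_affineInv S'.1 x).continuousAt
        exact (contDiff_bary j (n := 0)).continuous.comp (this.comp (by fun_prop))
      have hc0 := hc.tendsto' 0 (bary (affineInv S'.1 x) j) (by rw [add_zero])
      filter_upwards [hc0.eventually_const_lt hj] with w hw _ using hw
    · exact Filter.Eventually.of_forall fun w h => absurd h hj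
  filter_upwards [h1, h2, h3] with w hw1 hw2 hw3
  obtain ⟨S', hS'⟩ := mem_iUnion.1 hw1
  have hpS' : p ∈ 𝒯.hull S' := by
    by_contra hn
    exact hw2 S' hn hS'
  obtain ⟨π, hπ⟩ := 𝒯.exists_perm S S'
  have hq0 := hπ q hq hpS'
  have hy0 : ∀ i, S'.1 (π i) ≠ S.1 i → bary y i = 0 := fun i hi => (h i).2 (hq0 i hi)
  have hI := 𝒯.indep S'
  have hxq := affineMap_ofBary_perm (sum_bary q) hq0
  have hxy := affineMap_ofBary_perm (sum_bary y) hy0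
  rw [ofBary_bary] at hxq hxy
  have hyb : affineInv S'.1 x = ofBary (bary y ∘ π.symm) := by
    rw [hx, ← hxy, affineInv_affineMap hI]
  have hqb : affineInv S'.1 p = ofBary (bary q ∘ π.symm) := by
    rw [hp, ← hxq, affineInv_affineMap hI]
  have hby : bary (affineInv S'.1 x) = bary y ∘ π.symm := by
    have h1 : ∑ i, (bary y ∘ π.symm) i = 1 := (Equiv.sum_comp π.symm (bary y)).trans (sum_bary y)
    rw [hyb, bary_ofBary h1]
  have hbq : bary (affineInv S'.1 p) = bary q ∘ π.symm := by
    have h1 : ∑ i, (bary q ∘ π.symm) i = 1 := (Equiv.sum_comp π.symm (bary q)).trans (sum_bary q)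
    rw [hqb, bary_ofBary h1]
  refine mem_iUnion.2 ⟨S', (affineInv_mem hI).1 fun j => ?_⟩
  have hlin : ∀ z : E3, affineInv S'.1 (z + w) = affineInv S'.1 z + (linPart S'.1).inverse w :=
    fun z => by rw [affineInv, affineInv, ← map_add]; congr 1; abel
  rcases (hy (π.symm j)).lt_or_eq with hlt | heq
  · refine (hw3 S' j ?_).le
    rw [hby]; exact hlt
  · have e1 := bary_add_sub (affineInv S'.1 x) (affineInv S'.1 p) ((linPart S'.1).inverse w) j
    rw [← hlin, ← hlin, hby, hbq, Function.comp_apply, Function.comp_apply, ← heq,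
      (h _).1 heq.symm, sub_zero, sub_zero] at e1
    rw [e1]
    exact (affineInv_mem hI).2 hS' j

/-- The face of a boundary point belongs to the boundary. -/
lemma mem_frontier_of_support (S : 𝒯.simplices) {y n : E3} (hy : y ∈ refSimplex)
    (hn : n ∈ refSimplex) (h : ∀ i, bary y i = 0 → bary n i = 0)
    (hyf : affineMap S.1 y ∈ frontier 𝒯.carrier) : affineMap S.1 n ∈ frontier 𝒯.carrier := by
  by_contra hnf
  have hint : affineMap S.1 n ∈ interior 𝒯.carrier := by
    by_contra hni
    exact hnf ⟨subset_closure (𝒯.affineMap_mem_carrier S hn), hni⟩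
  -- If `n` were interior, a point slightly displaced from `n` towards `y` would be interior too,
  -- and it has exactly the same vanishing coordinates as `y`.
  have hc : Continuous fun ε : ℝ => affineMap S.1 ((1 - ε) • n + ε • y) :=
    (continuous_affineMap S.1).comp (by fun_prop)
  have h1 : ∀ᶠ ε in nhds (0 : ℝ), affineMap S.1 ((1 - ε) • n + ε • y) ∈ interior 𝒯.carrier :=
    hc.continuousAt.eventually (isOpen_interior.mem_nhds (by simpa using hint))
  obtain ⟨ε, hε1, hε2⟩ : ∃ ε : ℝ, affineMap S.1 ((1 - ε) • n + ε • y) ∈ interior 𝒯.carrier ∧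
      ε ∈ Ioo (0 : ℝ) 1 := by
    have h2 : ∀ᶠ ε in nhdsWithin (0 : ℝ) (Ioi 0), ε ∈ Ioo (0 : ℝ) 1 :=
      Ioo_mem_nhdsGT one_pos
    exact ((h1.filter_mono nhdsWithin_le_nhds).and h2).exists
  have hq : (1 - ε) • n + ε • y ∈ refSimplex :=
    convex_refSimplex hn hy (by linarith [hε2.2]) hε2.1.le (by ring)
  refine hyf.2 (𝒯.interior_of_support_eq S hy hq (fun i => ?_) hε1)
  rw [bary_combo n y (by ring)]
  constructor
  · intro h0; rw [h i h0, h0]; simp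
  · intro h0
    have h2 := mul_nonneg (sub_nonneg.2 hε2.2.le) (hn i)
    have h3 := mul_nonneg hε2.1.le (hy i)
    have h4 : ε * bary y i = 0 := by linarith
    exact (mul_eq_zero.1 h4).resolve_left hε2.1.ne'

/-- The finite element function with given nodal values on the polynomial extension of a
simplex. -/
def flatVal (z : 𝒯.Node k → ℝ) (S : 𝒯.simplices) (x : E3) : ℝ :=
  shapeSum (fun α => z (𝒯.dof S α)) (affineInv S.1 x)

/-- Its gradient. -/
def flatGrad (z : 𝒯.Node k → ℝ) (S : 𝒯.simplices) (x : E3) : StrongDual ℝ E3 :=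
  shapeGrad (fun α => z (𝒯.dof S α)) (affineInv S.1 x) ∘L (linPart S.1).inverse

lemma hasFDerivAt_flatVal (z : 𝒯.Node k → ℝ) (S : 𝒯.simplices) (x : E3) :
    HasFDerivAt (𝒯.flatVal z S) (𝒯.flatGrad z S x) x :=
  (hasFDerivAt_shapeSum _ _).comp x (hasFDerivAt_affineInv S.1 x)

lemma continuous_affineInv (S : Fin 4 → E3) : Continuous (affineInv S) :=
  continuous_iff_continuousAt.2 fun x => (hasFDerivAt_affineInv S x).continuousAt

lemma continuous_flatGrad (z : 𝒯.Node k → ℝ) (S : 𝒯.simplices) :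
    Continuous (𝒯.flatGrad z S) :=
  ((continuous_shapeGrad _).comp (continuous_affineInv S.1)).clm_comp continuous_const

/-- Finite element functions are continuous across common faces. -/
lemma flatVal_congr (hk : k ≠ 0) (z : 𝒯.Node k → ℝ) (S S' : 𝒯.simplices) {x : E3}
    (hx : x ∈ 𝒯.hull S) (hx' : x ∈ 𝒯.hull S') : 𝒯.flatVal z S x = 𝒯.flatVal z S' x := by
  obtain ⟨π, hπ⟩ := 𝒯.exists_perm S S'
  set y := affineInv S.1 x with hy
  have hxy : affineMap S.1 y = x := affineMap_affineInv (𝒯.indep S) x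
  have hyr : y ∈ refSimplex := (affineInv_mem (𝒯.indep S)).2 hx
  have h0 := hπ y hyr (hxy ▸ hx')
  have hy' : affineInv S'.1 x = ofBary (bary y ∘ π.symm) := by
    have := affineMap_ofBary_perm (sum_bary y) h0
    rw [ofBary_bary, hxy] at this
    rw [← this, affineInv_affineMap (𝒯.indep S')]
  have hb : bary (affineInv S'.1 x) = bary y ∘ π.symm := by
    have h1 : ∑ i, (bary y ∘ π.symm) i = 1 := (Equiv.sum_comp π.symm (bary y)).trans (sum_bary y)
    rw [hy', bary_ofBary h1]
  -- Local nodes are relabelled by `π`. A node with weight at an unmatched vertex has a shape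
  -- function vanishing at `x`; any other node is the same point seen from both simplices, hence
  -- carries the same global index.
  let e : LocalNode k ≃ LocalNode k :=
    { toFun := fun α => ⟨α.1 ∘ π.symm, by
        have := Equiv.sum_comp π.symm fun i => (α.1 i : ℕ)
        exact this.trans α.2⟩
      invFun := fun α => ⟨α.1 ∘ π, by
        have := Equiv.sum_comp π fun i => (α.1 i : ℕ)
        exact this.trans α.2⟩
      left_inv := fun α => by ext; simp
      right_inv := fun α => by ext; simp }
  rw [flatVal, flatVal, shapeSum, shapeSum,
    ← Equiv.sum_comp e fun α => z (𝒯.dof S' α) * shape α (affineInv S'.1 x)]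
  refine Finset.sum_congr rfl fun α _ => ?_
  have hshape : shape (e α) (affineInv S'.1 x) = shape α y := by
    simp only [shape]
    rw [← Equiv.prod_comp π]
    refine Finset.prod_congr rfl fun i _ => ?_
    simp [e, hb]
  rw [hshape]
  by_cases hα : ∃ i, S'.1 (π i) ≠ S.1 i ∧ (α.1 i : ℕ) ≠ 0
  · obtain ⟨i, hi, hαi⟩ := hα
    rw [shape_eq_zero (h0 i hi) hαi, mul_zero, mul_zero]
  · push Not at hα
    have hdof : 𝒯.dof S' (e α) = 𝒯.dof S α := by
      refine Subtype.ext (congrArg 𝒯.G ?_)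
      have h1 := affineMap_ofBary_perm (S := S.1) (S' := S'.1) (π := π)
        (sum_bary (refNode α)) fun i hi => by rw [bary_refNode hk, hα i hi]; simp
      rw [ofBary_bary] at h1
      have h2 : bary (refNode α) ∘ π.symm = bary (refNode (e α)) := by
        funext i
        rw [Function.comp_apply, bary_refNode hk, bary_refNode hk]
        rfl
      rw [← h1, h2, ofBary_bary]
    rw [hdof]

/-- Functions with vanishing boundary nodal values vanish on the boundary. -/
lemma flatVal_eq_zero (hk : k ≠ 0) {z : 𝒯.Node k → ℝ}
    (hz : ∀ j : 𝒯.Node k, (j : E3) ∈ frontier Ω₀ → z j = 0) (S : 𝒯.simplices) {x : E3}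
    (hx : x ∈ 𝒯.hull S) (hxf : x ∈ frontier 𝒯.carrier) : 𝒯.flatVal z S x = 0 := by
  set y := affineInv S.1 x with hy
  have hxy : affineMap S.1 y = x := affineMap_affineInv (𝒯.indep S) x
  have hyr : y ∈ refSimplex := (affineInv_mem (𝒯.indep S)).2 hx
  refine Finset.sum_eq_zero fun α _ => ?_
  -- The shape functions that survive at `x` belong to nodes on the face of `x`, and these lie on
  -- the boundary together with `x`.
  by_cases hα : ∃ i, bary y i = 0 ∧ (α.1 i : ℕ) ≠ 0
  · obtain ⟨i, hi, hαi⟩ := hα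
    rw [shape_eq_zero hi hαi, mul_zero]
  · push Not at hα
    refine mul_eq_zero_of_left (hz _ ?_) _
    refine 𝒯.mem_frontier_of_carrier (𝒯.mem_frontier_of_support S hyr (refNode_mem hk α)
      (fun i hi => ?_) (hxy.symm ▸ hxf))
    rw [bary_refNode hk, hα i hi]; simp

/-- Fixed vertices tie the flat mesh to the domain; this makes the diameter in Poincaré's inequality
independent of the mesh. -/
lemma vertex_mem_closure (S : 𝒯.simplices) (i : Fin 4) : S.1 i ∈ closure Ω₀ := by
  rw [← 𝒯.image_G, ← 𝒯.G_vertex S.1 S.2 i, biUnion_eq_carrier]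
  exact mem_image_of_mem _
    (mem_iUnion.2 ⟨S, subset_convexHull ℝ _ (mem_range_self i)⟩)

/-- The triangulation lies in a ball that contains the domain. -/
lemma carrier_subset {R : ℝ} (hR : closure Ω₀ ⊆ Metric.closedBall 0 R) :
    𝒯.carrier ⊆ Metric.closedBall 0 R := by
  refine iUnion_subset fun S => convexHull_min ?_ (convex_closedBall 0 R)
  rintro _ ⟨i, rfl⟩
  exact hR (𝒯.vertex_mem_closure S i)

section Poincare

variable {R : ℝ} (hR0 : 0 ≤ R) (hR : closure Ω₀ ⊆ Metric.closedBall 0 R) (hk : k ≠ 0)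
  {z : 𝒯.Node k → ℝ} (hz : ∀ j : 𝒯.Node k, (j : E3) ∈ frontier Ω₀ → z j = 0)

include hR in
lemma dist_lt_of_carrier : ∀ x ∈ 𝒯.carrier, ∀ y ∈ 𝒯.carrier, dist x y < 2 * R + 1 := by
  intro x hx y hy
  have h1 := 𝒯.carrier_subset hR hx
  have h2 := 𝒯.carrier_subset hR hy
  rw [mem_closedBall_zero_iff] at h1 h2
  rw [dist_eq_norm]
  linarith [norm_sub_le x y]

include hR0 hR hk hz in
lemma flatVal_poincare :
    ∑ S, ∫ x in 𝒯.hull S, 𝒯.flatVal z S x ^ 2 ≤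
      (2 * R + 1) ^ 2 * ∑ S, ∫ x in 𝒯.hull S, ‖𝒯.flatGrad z S x‖ ^ 2 :=
  poincare_of_piecewise (by linarith) 𝒯.isCompact_hull 𝒯.convex_hull
    (fun S S' hne => volume_inter_eq_zero (𝒯.indep S) (𝒯.indep S')
      (𝒯.conforming S.1 S.2 S'.1 S'.2)
      fun h => hne (Subtype.ext (𝒯.range_injOn S.1 S.2 S'.1 S'.2 h)))
    (fun S x => 𝒯.hasFDerivAt_flatVal z S x) (fun S => 𝒯.continuous_flatGrad z S)
    (fun S S' x hx hx' => 𝒯.flatVal_congr hk z S S' hx hx')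
    (fun S x hx hxf => 𝒯.flatVal_eq_zero hk hz S hx hxf) (𝒯.dist_lt_of_carrier hR)

include hR0 hR hk hz in
lemma abs_flatVal_le {ε : ℝ} (hε : ∀ S, ∀ x ∈ 𝒯.hull S, ‖𝒯.flatGrad z S x‖ ≤ ε)
    (S : 𝒯.simplices) {x : E3} (hx : x ∈ 𝒯.hull S) : |𝒯.flatVal z S x| ≤ (2 * R + 1) * ε :=
  abs_le_of_piecewise (by linarith) 𝒯.isCompact_hull 𝒯.convex_hull
    (fun S x => 𝒯.hasFDerivAt_flatVal z S x) (fun S => 𝒯.continuous_flatGrad z S)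
    (fun S S' x hx hx' => 𝒯.flatVal_congr hk z S S' hx hx')
    (fun S x hx hxf => 𝒯.flatVal_eq_zero hk hz S hx hxf) (𝒯.dist_lt_of_carrier hR) hε S x hx

end Poincare

end ExactTriangulation
end HarmonicFEM

namespace HarmonicFEM
namespace ExactTriangulation

variable {Ω₀ : Set E3} (𝒯 : ExactTriangulation Ω₀) {k : ℕ}

/-! ### The finite element space of a triangulation -/

/-- The disjoint union of copies of the unit simplex. -/
abbrev RefSpace : Type := 𝒯.simplices × refSimplex

variable (k) in
/-- The finite element space, with gradients with respect to the flat triangulation. -/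
def feSpace : FESpace 𝒯.RefSpace (𝒯.Node k) where
  φ j y := ∑ α : LocalNode k, if 𝒯.dof y.1 α = j then shape α y.2 else 0
  g j y := ∑ α : LocalNode k, if 𝒯.dof y.1 α = j then
    fderiv ℝ (shape α) y.2 ∘L (linPart y.1.1).inverse else 0
  continuous_φ j := by
    rw [continuous_prod_of_discrete_left]
    intro S
    refine continuous_finsetSum _ fun α _ => ?_
    by_cases h : 𝒯.dof S α = j <;> simp only [h, if_true, if_false]
    · exact (continuous_shape α).comp continuous_subtype_val
    · exact continuous_const
  continuous_g j := by
    rw [continuous_prod_of_discrete_left]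
    intro S
    refine continuous_finsetSum _ fun α _ => ?_
    by_cases h : 𝒯.dof S α = j <;> simp only [h, if_true, if_false]
    · exact ((continuous_fderiv_shape α).comp continuous_subtype_val).clm_comp continuous_const
    · exact continuous_const

lemma feSpace_val (z : 𝒯.Node k → ℝ) (S : 𝒯.simplices) (y : refSimplex) :
    (𝒯.feSpace k).val z (S, y) = shapeSum (fun α => z (𝒯.dof S α)) y := by
  simp only [FESpace.val, feSpace, Finset.mul_sum, shapeSum]
  rw [Finset.sum_comm]
  simp

lemma feSpace_grad (z : 𝒯.Node k → ℝ) (S : 𝒯.simplices) (y : refSimplex) :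
    (𝒯.feSpace k).grad z (S, y) =
      shapeGrad (fun α => z (𝒯.dof S α)) y ∘L (linPart S.1).inverse := by
  ext e
  simp only [FESpace.grad, feSpace, shapeGrad, Finset.smul_sum, ContinuousLinearMap.comp_apply]
  rw [Finset.sum_comm]
  simp

lemma feSpace_pos (x : 𝒯.Node k → E3) (S : 𝒯.simplices) (y : refSimplex) :
    (𝒯.feSpace k).pos x (S, y) = 𝒯.elementMap x S y := by
  simp only [FESpace.pos, feSpace, elementMap, Finset.sum_smul]
  rw [Finset.sum_comm]
  simp [ite_smul]

/-- The volume of the flat triangulation, transported to the reference space. -/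
def refMeasure : Measure 𝒯.RefSpace :=
  ∑ S : 𝒯.simplices, ENNReal.ofReal |(linPart S.1).det| •
    Measure.map (fun y : refSimplex => (S, y)) (Measure.comap Subtype.val volume)

instance : IsFiniteMeasure (Measure.comap (Subtype.val : refSimplex → E3) volume) := by
  refine ⟨?_⟩
  rw [comap_subtype_coe_apply isClosed_refSimplex.measurableSet]
  exact (measure_mono (by simp)).trans_lt isCompact_refSimplex.measure_lt_top

instance : IsFiniteMeasure 𝒯.refMeasure := by
  refine ⟨?_⟩
  rw [refMeasure, Measure.finsetSum_apply, ENNReal.sum_lt_top]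
  intro S _
  rw [Measure.smul_apply, smul_eq_mul]
  exact ENNReal.mul_lt_top ENNReal.ofReal_lt_top (measure_lt_top _ _)

lemma integral_refMeasure {F : 𝒯.RefSpace → ℝ} (hF : Continuous F) {F' : 𝒯.simplices → E3 → ℝ}
    (h : ∀ S, ∀ y : refSimplex, F (S, y) = F' S y) :
    ∫ y, F y ∂𝒯.refMeasure = ∑ S, |(linPart S.1).det| * ∫ y in refSimplex, F' S y := by
  have hm : ∀ S : 𝒯.simplices, Measurable fun y : refSimplex => (S, y) :=
    fun S => measurable_prodMk_left
  have hc : ∀ S : 𝒯.simplices, Continuous fun y : refSimplex => (S, y) := fun S => by fun_prop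
  rw [refMeasure, integral_finsetSum_measure]
  · refine Finset.sum_congr rfl fun S _ => ?_
    rw [integral_smul_measure, ENNReal.toReal_ofReal (abs_nonneg _), smul_eq_mul,
      integral_map (hm S).aemeasurable hF.aestronglyMeasurable]
    simp only [h]
    rw [integral_subtype_comap isClosed_refSimplex.measurableSet]
  · intro S _
    refine Integrable.smul_measure ?_ ENNReal.ofReal_ne_top
    exact integrable_of_continuous _ hF

lemma integral_hull (S : 𝒯.simplices) (F : E3 → ℝ) :
    ∫ x in 𝒯.hull S, F (affineInv S.1 x) =
      |(linPart S.1).det| * ∫ y in refSimplex, F y := by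
  rw [hull, ← image_affineMap, integral_image_eq_integral_abs_det_fderiv_smul volume
    isClosed_refSimplex.measurableSet
    (fun y _ => (hasFDerivAt_affineMap S.1 y).hasFDerivWithinAt)
    (affineMap_injective (𝒯.indep S)).injOn]
  simp only [affineInv_affineMap (𝒯.indep S), smul_eq_mul]
  rw [integral_const_mul]

lemma normSq_eq (z : 𝒯.Node k → ℝ) : (𝒯.feSpace k).normSq 𝒯.refMeasure z =
    ∑ S, |(linPart S.1).det| * ∫ y in refSimplex, shapeSum (fun α => z (𝒯.dof S α)) y ^ 2 := by
  refine 𝒯.integral_refMeasure (((𝒯.feSpace k).continuous_val z).pow 2) fun S y => ?_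
  rw [Pi.pow_apply, feSpace_val]

lemma gradSq_eq (z : 𝒯.Node k → ℝ) : (𝒯.feSpace k).gradSq 𝒯.refMeasure z =
    ∑ S, |(linPart S.1).det| * ∫ y in refSimplex,
      ‖shapeGrad (fun α => z (𝒯.dof S α)) y ∘L (linPart S.1).inverse‖ ^ 2 := by
  refine 𝒯.integral_refMeasure (((𝒯.feSpace k).continuous_grad z).norm.pow 2) fun S y => ?_
  rw [Pi.pow_apply, feSpace_grad]

/-! ### Size of the simplices -/

lemma simplices_nonempty (hΩ : Ω₀.Nonempty) : Nonempty 𝒯.simplices := by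
  by_contra hn
  rw [not_nonempty_iff] at hn
  have h1 : 𝒯.carrier = ∅ := iUnion_of_empty _
  have h2 := 𝒯.image_G
  rw [biUnion_eq_carrier, h1, image_empty] at h2
  exact (hΩ.mono subset_closure).ne_empty h2.symm

lemma dist_le_width (S : 𝒯.simplices) {x y : E3} (hx : x ∈ 𝒯.hull S) (hy : y ∈ 𝒯.hull S) :
    dist x y ≤ 𝒯.width :=
  (Metric.dist_le_diam_of_mem (𝒯.isCompact_hull S).isBounded hx hy).trans
    (le_ciSup (f := fun S : 𝒯.simplices => Metric.diam (convexHull ℝ (range S.1)))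
      (Set.finite_range _).bddAbove S)

lemma vertex_mem_hull (S : 𝒯.simplices) (i : Fin 4) : S.1 i ∈ 𝒯.hull S :=
  subset_convexHull ℝ _ (mem_range_self i)

lemma width_pos (S : 𝒯.simplices) : 0 < 𝒯.width := by
  have h1 : S.1 0 ≠ S.1 1 := fun h => by simpa using (𝒯.indep S).injective h
  exact (dist_pos.2 h1).trans_le
    (𝒯.dist_le_width S (𝒯.vertex_mem_hull S 0) (𝒯.vertex_mem_hull S 1))

lemma norm_linPart_le (S : 𝒯.simplices) : ‖linPart S.1‖ ≤ 3 * 𝒯.width := by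
  refine ContinuousLinearMap.opNorm_le_bound _ (by have := 𝒯.width_pos S; positivity) fun y => ?_
  rw [linPart_apply]
  refine (norm_sum_le _ _).trans ?_
  have h : ∀ i ∈ (Finset.univ : Finset (Fin 3)),
      ‖y i • (S.1 i.succ - S.1 0)‖ ≤ 𝒯.width * ‖y‖ := fun i _ => by
    rw [norm_smul, mul_comm, ← dist_eq_norm]
    exact mul_le_mul (𝒯.dist_le_width S (𝒯.vertex_mem_hull S _) (𝒯.vertex_mem_hull S _))
      (PiLp.norm_apply_le y i) (norm_nonneg _) (𝒯.width_pos S).le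
  refine (Finset.sum_le_sum h).trans (le_of_eq ?_)
  simp [mul_assoc]

variable {σ q : ℝ} {𝒯}

/-- A diameter of the inscribed ball is pulled back into the unit simplex, whose points have norm at
most one; so `2 r B⁻¹ u` has norm at most two. -/
lemma IsQuasiUniform.norm_inverse_le (h : 𝒯.IsQuasiUniform σ q) (hσ : 0 < σ)
    (S : 𝒯.simplices) : ‖(linPart S.1).inverse‖ ≤ σ / 𝒯.width := by
  have hw := 𝒯.width_pos S
  obtain ⟨⟨z, hz⟩, -⟩ := h S.1 S.2
  refine ContinuousLinearMap.opNorm_le_of_unit_norm (by positivity) fun u hu => ?_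
  set r := 𝒯.width / σ with hr
  have hr0 : 0 < r := by positivity
  have hp : z + r • u ∈ 𝒯.hull S := hz (by
    rw [mem_closedBall_iff_norm, add_sub_cancel_left, norm_smul, hu, mul_one, Real.norm_eq_abs,
      abs_of_pos hr0])
  have hm : z - r • u ∈ 𝒯.hull S := hz (by
    rw [mem_closedBall_iff_norm, sub_sub_cancel_left, norm_neg, norm_smul, hu, mul_one,
      Real.norm_eq_abs, abs_of_pos hr0])
  have h1 := norm_le_of_mem_refSimplex ((affineInv_mem (𝒯.indep S)).2 hp)
  have h2 := norm_le_of_mem_refSimplex ((affineInv_mem (𝒯.indep S)).2 hm)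
  have h3 : affineInv S.1 (z + r • u) - affineInv S.1 (z - r • u) =
      (2 * r) • (linPart S.1).inverse u := by
    rw [affineInv, affineInv, ← map_sub, ← map_smul]
    congr 1
    module
  have h4 : ‖(2 * r) • (linPart S.1).inverse u‖ ≤ 2 := by
    rw [← h3]; exact (norm_sub_le _ _).trans (by linarith)
  rw [norm_smul, Real.norm_eq_abs, abs_of_pos (by positivity)] at h4
  have h5 : σ / 𝒯.width = 1 / r := by rw [hr]; field_simp
  rw [h5, le_div_iff₀ hr0]
  linarith

/-- A bound for determinants by operator norms. -/
lemma exists_det_bound : ∃ D : ℝ, 0 < D ∧ ∀ A : E3 →L[ℝ] E3, |A.det| ≤ D * ‖A‖ ^ 3 := by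
  obtain ⟨D, hD⟩ := (isCompact_closedBall (0 : E3 →L[ℝ] E3) 1).exists_bound_of_continuousOn
    (f := fun A : E3 →L[ℝ] E3 => A.det) ContinuousLinearMap.continuous_det.continuousOn
  refine ⟨max D 1, by positivity, fun A => ?_⟩
  rcases eq_or_ne A 0 with h0 | h0
  · subst h0
    have : (0 : E3 →L[ℝ] E3).det = 0 := by
      rw [ContinuousLinearMap.det]
      simp
    simp [this]
  have hn : 0 < ‖A‖ := norm_pos_iff.2 h0
  -- The determinant is homogeneous of degree three, so a bound on the unit ball suffices.
  have h1 := hD (‖A‖⁻¹ • A) (by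
    rw [mem_closedBall_zero_iff, norm_smul, norm_inv, norm_norm, inv_mul_cancel₀ hn.ne'])
  have h2 : (‖A‖⁻¹ • A).det = (‖A‖⁻¹) ^ 3 * A.det := by
    rw [ContinuousLinearMap.det, ContinuousLinearMap.toLinearMap_smul, LinearMap.det_smul]
    simp
  rw [h2, Real.norm_eq_abs, abs_mul, abs_of_pos (by positivity), inv_pow, inv_mul_le_iff₀
    (by positivity)] at h1
  rw [mul_comm]
  exact h1.trans (mul_le_mul_of_nonneg_left (le_max_left _ _) (by positivity))

/-! ### Stability of the finite element space -/

variable (Ω₀) in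
/-- The inequalities of `IsStable`, with the dependence of the constants on the mesh width. -/
lemma exists_isStable (hk : k ≠ 0) (hσ : 0 < σ) {R : ℝ} (hR0 : 0 ≤ R)
    (hR : closure Ω₀ ⊆ Metric.closedBall 0 R) : ∃ CP CJ : ℝ, 0 ≤ CP ∧ 0 ≤ CJ ∧
      ∀ 𝒯 : ExactTriangulation Ω₀, 𝒯.IsQuasiUniform σ q →
        (𝒯.feSpace k).IsStable 𝒯.refMeasure (fun j => (j : E3) ∉ frontier Ω₀) CP
          (CJ / 𝒯.width ^ 3) := by
  obtain ⟨C₀, hC₀, hinv⟩ := exists_inverse_estimate hk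
  obtain ⟨D, hD0, hD⟩ := exists_det_bound
  -- `2 * R + 1` exceeds the diameter of the mesh. In the second constant, 9 comes from `‖B‖ ≤ 3 h`,
  -- while `σ ^ 5` combines `σ ^ 2` from the gradient with `σ ^ 3` from the volume of a simplex.
  refine ⟨(2 * R + 1) ^ 2, 9 * σ ^ 5 * C₀ * D, sq_nonneg _, by positivity, fun 𝒯 h𝒯 => ?_⟩
  have hdet : ∀ S : 𝒯.simplices, 0 < |(linPart S.1).det| := fun S =>
    abs_pos.2 (det_ne_zero_of_isInvertible (linPart_isInvertible (𝒯.indep S)))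
  have hsq : 2 * R + 1 ≤ (2 * R + 1) ^ 2 := by nlinarith
  refine ⟨fun z hz => ?_, fun z hz => ?_, fun z hz ε hε y => ?_, fun z y => ?_⟩
  · rw [normSq_eq, Finset.sum_eq_zero_iff_of_nonneg fun S _ =>
      mul_nonneg (abs_nonneg _) (integral_nonneg fun y => sq_nonneg _)] at hz
    funext j
    obtain ⟨⟨S, α⟩, hj⟩ := j.2
    have h1 := (mul_eq_zero.1 (hz S (Finset.mem_univ S))).resolve_left (hdet S).ne'
    have h2 := eqOn_zero_of_setIntegral_eq_zero
      ((continuous_shapeSum fun α => z (𝒯.dof S α)).pow 2) (fun y => sq_nonneg _) h1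
      _ (refNode_mem hk α)
    rw [Pi.pow_apply, shapeSum_refNode hk, sq_eq_zero_iff] at h2
    have h3 : j = 𝒯.dof S α := Subtype.ext hj.symm
    rw [h3, h2]; rfl
  · have hz' : ∀ j : 𝒯.Node k, (j : E3) ∈ frontier Ω₀ → z j = 0 := fun j hj => hz j (not_not.2 hj)
    have h := 𝒯.flatVal_poincare hR0 hR hk hz'
    rw [normSq_eq, gradSq_eq]
    simp only [← integral_hull]
    exact h
  · have hz' : ∀ j : 𝒯.Node k, (j : E3) ∈ frontier Ω₀ → z j = 0 := fun j hj => hz j (not_not.2 hj)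
    have h := 𝒯.abs_flatVal_le hR0 hR hk hz' (ε := ε) (fun S x hx => ?_) y.1
      (𝒯.affineMap_mem_hull y.1 y.2.2)
    · have hε0 : 0 ≤ ε := (norm_nonneg _).trans (hε y)
      rw [flatVal, affineInv_affineMap (𝒯.indep y.1)] at h
      rw [show y = (y.1, y.2) from rfl, feSpace_val]
      exact h.trans (mul_le_mul_of_nonneg_right hsq hε0)
    · have := hε (S, ⟨affineInv S.1 x, (affineInv_mem (𝒯.indep S)).2 hx⟩)
      rwa [feSpace_grad] at this
  · obtain ⟨S, y⟩ := y
    have hw := 𝒯.width_pos S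
    rw [feSpace_grad, gradSq_eq]
    set p := fun α => z (𝒯.dof S α) with hp
    set B := linPart S.1 with hB
    have hBi : B.IsInvertible := linPart_isInvertible (𝒯.indep S)
    have hn := h𝒯.norm_inverse_le hσ S
    have hnB := 𝒯.norm_linPart_le S
    set I := ∫ y in refSimplex, ‖shapeGrad p y ∘L B.inverse‖ ^ 2 with hI
    have hI0 : 0 ≤ I := integral_nonneg fun _ => sq_nonneg _
    have h1 : ‖shapeGrad p y ∘L B.inverse‖ ^ 2 ≤ (σ / 𝒯.width) ^ 2 * ‖shapeGrad p y‖ ^ 2 := by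
      rw [← mul_pow]
      refine pow_le_pow_left₀ (norm_nonneg _) ?_ 2
      refine (ContinuousLinearMap.opNorm_comp_le _ _).trans ?_
      rw [mul_comm]
      exact mul_le_mul_of_nonneg_right hn (norm_nonneg _)
    have h2 : ∫ y in refSimplex, ‖shapeGrad p y‖ ^ 2 ≤ (3 * 𝒯.width) ^ 2 * I := by
      rw [hI, ← integral_const_mul]
      refine integral_mono (integrableOn_sq_norm_shapeGrad p) ?_ fun y => ?_
      · refine Integrable.const_mul ?_ _
        exact ((((continuous_shapeGrad p).clm_comp continuous_const).norm.pow
          2).continuousOn.integrableOn_compact isCompact_refSimplex)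
      · have e : shapeGrad p y = (shapeGrad p y ∘L B.inverse) ∘L B := by
          ext v
          simp only [ContinuousLinearMap.comp_apply]
          rw [(hBi.inverse_apply_eq (y := B v) (x := v)).2 rfl]
        change ‖shapeGrad p y‖ ^ 2 ≤ (3 * 𝒯.width) ^ 2 * ‖shapeGrad p y ∘L B.inverse‖ ^ 2
        rw [← mul_pow]
        refine pow_le_pow_left₀ (norm_nonneg _) ?_ 2
        nth_rw 1 [e]
        refine (ContinuousLinearMap.opNorm_comp_le _ _).trans ?_
        rw [mul_comm]
        exact mul_le_mul_of_nonneg_right hnB (norm_nonneg _)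
    -- A simplex has volume at least of order `h³`; this is the origin of the factor `h⁻³`.
    have h3 : 1 ≤ D * (σ / 𝒯.width) ^ 3 * |B.det| := by
      have e1 : |B.det| * |B.inverse.det| = 1 := by
        rw [← abs_mul, det_mul_det_inverse hBi, abs_one]
      have e2 : |B.inverse.det| ≤ D * (σ / 𝒯.width) ^ 3 :=
        (hD _).trans (mul_le_mul_of_nonneg_left (pow_le_pow_left₀ (norm_nonneg _) hn 3) hD0.le)
      rw [← e1, mul_comm]
      exact mul_le_mul_of_nonneg_right e2 (abs_nonneg _)
    have h4 : |B.det| * I ≤ ∑ S : 𝒯.simplices, |(linPart S.1).det| * ∫ y in refSimplex,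
        ‖shapeGrad (fun α => z (𝒯.dof S α)) y ∘L (linPart S.1).inverse‖ ^ 2 :=
      Finset.single_le_sum (f := fun S : 𝒯.simplices => |(linPart S.1).det| *
        ∫ y in refSimplex, ‖shapeGrad (fun α => z (𝒯.dof S α)) y ∘L (linPart S.1).inverse‖ ^ 2)
        (fun S _ => mul_nonneg (abs_nonneg _) (integral_nonneg fun _ => sq_nonneg _))
        (Finset.mem_univ S)
    calc _ ≤ (σ / 𝒯.width) ^ 2 * ‖shapeGrad p y‖ ^ 2 := h1
      _ ≤ (σ / 𝒯.width) ^ 2 * (C₀ * ((3 * 𝒯.width) ^ 2 * I)) := by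
          have := hinv p y y.2
          gcongr
          exact this.trans (mul_le_mul_of_nonneg_left h2 hC₀)
      _ = 9 * σ ^ 2 * C₀ * I * 1 := by field_simp; ring
      _ ≤ 9 * σ ^ 2 * C₀ * I * (D * (σ / 𝒯.width) ^ 3 * |B.det|) :=
          mul_le_mul_of_nonneg_left h3 (by positivity)
      _ = 9 * σ ^ 5 * C₀ * D / 𝒯.width ^ 3 * (|B.det| * I) := by field_simp
      _ ≤ _ := mul_le_mul_of_nonneg_left h4 (by positivity)

end ExactTriangulation
/-! ### Functions of class `C¹` on a compact space-time cylinder -/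

section Cylinder

variable {V : Type*} [NormedAddCommGroup V] [NormedSpace ℝ V] {T : ℝ} {Ω : Set E3}
  {F : ℝ → E3 → V}

lemma uniqueDiffOn_cylinder (hT : 0 < T) (hΩ : UniqueDiffOn ℝ Ω) :
    UniqueDiffOn ℝ (Icc 0 T ×ˢ Ω) := (uniqueDiffOn_Icc hT).prod hΩ

lemma hasFDerivWithinAt_space (hF : ContDiffOn ℝ 1 (fun z : ℝ × E3 => F z.1 z.2) (Icc 0 T ×ˢ Ω))
    {t : ℝ} (ht : t ∈ Icc 0 T) {p : E3} (hp : p ∈ Ω) :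
    HasFDerivWithinAt (F t) (fderivWithin ℝ (fun z : ℝ × E3 => F z.1 z.2) (Icc 0 T ×ˢ Ω) (t, p) ∘L
      ContinuousLinearMap.inr ℝ ℝ E3) Ω p := by
  have h1 := (hF.differentiableOn one_ne_zero (t, p) ⟨ht, hp⟩).hasFDerivWithinAt
  have h2 : HasFDerivWithinAt (fun p : E3 => (t, p)) (ContinuousLinearMap.inr ℝ ℝ E3) Ω p :=
    (hasFDerivAt_prodMk_right t p).hasFDerivWithinAt
  exact h1.comp p h2 fun y hy => ⟨ht, hy⟩

lemma hasDerivWithinAt_time (hF : ContDiffOn ℝ 1 (fun z : ℝ × E3 => F z.1 z.2) (Icc 0 T ×ˢ Ω))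
    {t : ℝ} (ht : t ∈ Icc 0 T) {p : E3} (hp : p ∈ Ω) :
    HasDerivWithinAt (fun s => F s p)
      (fderivWithin ℝ (fun z : ℝ × E3 => F z.1 z.2) (Icc 0 T ×ˢ Ω) (t, p) (1, 0))
      (Icc 0 T) t := by
  have h1 := (hF.differentiableOn one_ne_zero (t, p) ⟨ht, hp⟩).hasFDerivWithinAt
  have h2 : HasDerivWithinAt (fun s : ℝ => (s, p)) ((1 : ℝ), (0 : E3)) (Icc 0 T) t :=
    ((hasDerivAt_id t).prodMk (hasDerivAt_const t p)).hasDerivWithinAt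
  have h3 : MapsTo (fun s : ℝ => (s, p)) (Icc 0 T) (Icc 0 T ×ˢ Ω) := fun s hs => ⟨hs, hp⟩
  exact HasFDerivWithinAt.comp_hasDerivWithinAt t h1 h2 h3

lemma fderivWithin_space (hΩ : UniqueDiffOn ℝ Ω)
    (hF : ContDiffOn ℝ 1 (fun z : ℝ × E3 => F z.1 z.2) (Icc 0 T ×ˢ Ω))
    {t : ℝ} (ht : t ∈ Icc 0 T) {p : E3} (hp : p ∈ Ω) :
    fderivWithin ℝ (F t) Ω p = fderivWithin ℝ (fun z : ℝ × E3 => F z.1 z.2)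
      (Icc 0 T ×ˢ Ω) (t, p) ∘L ContinuousLinearMap.inr ℝ ℝ E3 :=
  (hasFDerivWithinAt_space hF ht hp).fderivWithin (hΩ p hp)

lemma continuousOn_fderivWithin_space (hT : 0 < T) (hΩ : UniqueDiffOn ℝ Ω)
    (hF : ContDiffOn ℝ 1 (fun z : ℝ × E3 => F z.1 z.2) (Icc 0 T ×ˢ Ω)) :
    ContinuousOn (fun z : ℝ × E3 => fderivWithin ℝ (F z.1) Ω z.2) (Icc 0 T ×ˢ Ω) := by
  have h := hF.continuousOn_fderivWithin (uniqueDiffOn_cylinder hT hΩ) le_rfl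
  refine ContinuousOn.congr (h.clm_comp continuousOn_const)
    fun z hz => fderivWithin_space hΩ hF hz.1 hz.2

lemma exists_bound_cylinder (hT : 0 < T) (hΩ : UniqueDiffOn ℝ Ω) (hΩc : IsCompact Ω)
    (hF : ContDiffOn ℝ 1 (fun z : ℝ × E3 => F z.1 z.2) (Icc 0 T ×ˢ Ω)) :
    ∃ K, 0 ≤ K ∧ ∀ t ∈ Icc 0 T, ∀ p ∈ Ω, ‖F t p‖ ≤ K ∧ ‖fderivWithin ℝ (F t) Ω p‖ ≤ K ∧
      ‖fderivWithin ℝ (fun z : ℝ × E3 => F z.1 z.2) (Icc 0 T ×ˢ Ω) (t, p) (1, 0)‖ ≤ K := by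
  have hc : IsCompact (Icc 0 T ×ˢ Ω) := isCompact_Icc.prod hΩc
  obtain ⟨K₁, h₁⟩ := hc.exists_bound_of_continuousOn hF.continuousOn
  obtain ⟨K₂, h₂⟩ := hc.exists_bound_of_continuousOn (continuousOn_fderivWithin_space hT hΩ hF)
  obtain ⟨K₃, h₃⟩ := hc.exists_bound_of_continuousOn
    ((hF.continuousOn_fderivWithin (uniqueDiffOn_cylinder hT hΩ) le_rfl).clm_apply
      (continuousOn_const (c := ((1 : ℝ), (0 : E3)))))
  refine ⟨max 0 (max K₁ (max K₂ K₃)), le_max_left _ _, fun t ht p hp => ⟨?_, ?_, ?_⟩⟩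
  · exact (h₁ (t, p) ⟨ht, hp⟩).trans ((le_max_left _ _).trans (le_max_right _ _))
  · exact (h₂ (t, p) ⟨ht, hp⟩).trans
      ((le_max_left _ _).trans ((le_max_right _ _).trans (le_max_right _ _)))
  · exact (h₃ (t, p) ⟨ht, hp⟩).trans
      ((le_max_right _ _).trans ((le_max_right _ _).trans (le_max_right _ _)))

end Cylinder

/-! ### Interpolation of C¹ functions on fine meshes. -/

lemma isInvertible_of_norm_sub_id_le {q : ℝ} (hq : q < 1) {D : E3 →L[ℝ] E3}
    (hD : ‖D - ContinuousLinearMap.id ℝ E3‖ ≤ q) :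
    D.IsInvertible ∧ ‖D.inverse‖ ≤ 1 / (1 - q) ∧ ‖D‖ ≤ 2 := by
  have h := isInvertible_of_antilipschitz (H := D) (sub_pos.2 hq) fun x => by
    have h1 : ‖(D - ContinuousLinearMap.id ℝ E3) x‖ ≤ q * ‖x‖ :=
      ((D - ContinuousLinearMap.id ℝ E3).le_opNorm x).trans
        (mul_le_mul_of_nonneg_right hD (norm_nonneg _))
    have h2 : x = D x - (D - ContinuousLinearMap.id ℝ E3) x := by simp
    have h3 : ‖x‖ ≤ ‖D x‖ + ‖(D - ContinuousLinearMap.id ℝ E3) x‖ := by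
      nth_rw 1 [h2]; exact norm_sub_le _ _
    linarith
  refine ⟨h.1, h.2, ?_⟩
  have h1 : D = (D - ContinuousLinearMap.id ℝ E3) + ContinuousLinearMap.id ℝ E3 := by abel
  rw [h1]
  refine (norm_add_le _ _).trans ?_
  have := ContinuousLinearMap.norm_id_le (𝕜 := ℝ) (E := E3)
  linarith

namespace ExactTriangulation

variable {Ω₀ : Set E3} {k : ℕ} {σ q T : ℝ}

lemma mapsTo_G (𝒯 : ExactTriangulation Ω₀) (S : 𝒯.simplices) :
    MapsTo 𝒯.G (𝒯.hull S) (closure Ω₀) := fun x hx => by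
  rw [← 𝒯.image_G, biUnion_eq_carrier]
  exact mem_image_of_mem _ (mem_iUnion.2 ⟨S, hx⟩)

lemma node_mem_closure (hk : k ≠ 0) (𝒯 : ExactTriangulation Ω₀) (j : 𝒯.Node k) :
    (j : E3) ∈ closure Ω₀ := by
  obtain ⟨⟨S, α⟩, hj⟩ := j.2
  rw [← hj]
  exact 𝒯.mapsTo_G S (𝒯.affineMap_mem_hull S (refNode_mem hk α))

lemma nonempty_interior_hull (𝒯 : ExactTriangulation Ω₀) (S : 𝒯.simplices) :
    (interior (𝒯.hull S)).Nonempty :=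
  interior_convexHull_nonempty_iff_affineSpan_eq_top.2
    ((𝒯.indep S).affineSpan_eq_top_iff_card_eq_finrank_add_one.2 (by simp))

/-- The curved simplices have tangent cones that span. -/
lemma IsQuasiUniform.uniqueDiffOn {𝒯 : ExactTriangulation Ω₀} (h : 𝒯.IsQuasiUniform σ q)
    (hq : q < 1) : UniqueDiffOn ℝ (closure Ω₀) := by
  intro x hx
  rw [← 𝒯.image_G, biUnion_eq_carrier] at hx
  obtain ⟨y, hy, rfl⟩ := hx
  obtain ⟨S, hS⟩ := mem_iUnion.1 hy
  obtain ⟨-, D, hD, -⟩ := h S.1 S.2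
  -- A simplex is convex with interior; the invertible differential of `G` transports its tangent
  -- directions, and the larger set inherits them.
  have hu : UniqueDiffWithinAt ℝ (𝒯.hull S) y :=
    uniqueDiffOn_convex (𝒯.convex_hull S) (𝒯.nonempty_interior_hull S) y hS
  obtain ⟨A, hA⟩ := (isInvertible_of_norm_sub_id_le hq (hD y hS).2).1
  have hd : DenseRange (D y) := by
    rw [← hA]; exact A.surjective.denseRange
  exact ((hD y hS).1.uniqueDiffWithinAt hu hd).mono (𝒯.mapsTo_G S).image_subset

/-- Approximation of the differential of the interpolant of a function of class `C¹`. -/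
lemma exists_interpolation_error {V : Type*} [NormedAddCommGroup V] [NormedSpace ℝ V]
    {F : ℝ → E3 → V} (hk : k ≠ 0) (hT : 0 < T) (hσ : 0 < σ) (hq : q < 1)
    (hΩ : UniqueDiffOn ℝ (closure Ω₀)) (hΩc : IsCompact (closure Ω₀))
    (hF : ContDiffOn ℝ 1 (fun z : ℝ × E3 => F z.1 z.2) (Icc 0 T ×ˢ closure Ω₀))
    {ε : ℝ} (hε : 0 < ε) :
    ∃ h₁ : ℝ, 0 < h₁ ∧ ∀ 𝒯 : ExactTriangulation Ω₀, 𝒯.IsQuasiUniform σ q → 𝒯.width ≤ h₁ →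
      ∀ S : 𝒯.simplices, ∃ D : E3 →L[ℝ] E3, ‖D - ContinuousLinearMap.id ℝ E3‖ ≤ q ∧
        ∀ t ∈ Icc 0 T, ∀ y ∈ refSimplex, ∀ e : E3,
          ‖∑ α : LocalNode k, (fderiv ℝ (shape α) y ((linPart S.1).inverse e)) •
              F t (𝒯.dof S α) - fderivWithin ℝ (F t) (closure Ω₀) (S.1 0) (D e)‖ ≤ ε * ‖e‖ := by
  obtain ⟨Cs, hCs1, hCs⟩ := exists_shape_bound k
  have hCs0 : 0 < Cs := by linarith
  obtain ⟨K, hK0, hK⟩ := exists_bound_cylinder hT hΩ hΩc hF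
  -- Shape gradients on a simplex cost `Cs * σ / h`, and the remainders they multiply are of size
  -- `ε' * h`; the powers of `h` cancel.
  set ε' := ε / (Cs * σ) with hε'
  have hε'0 : 0 < ε' := by positivity
  have huc := (isCompact_Icc.prod hΩc).uniformContinuousOn_of_continuous
    (continuousOn_fderivWithin_space hT hΩ hF)
  obtain ⟨δ, hδ0, hδ⟩ := Metric.uniformContinuousOn_iff.1 huc (ε' / 4) (by positivity)
  refine ⟨min (δ / 4) (ε' / (2 * (K * σ + 1))), by positivity, fun 𝒯 h𝒯 hw S => ?_⟩
  have hw0 := 𝒯.width_pos S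
  have hwδ : 𝒯.width ≤ δ / 4 := hw.trans (min_le_left _ _)
  have hwε : 𝒯.width ≤ ε' / (2 * (K * σ + 1)) := hw.trans (min_le_right _ _)
  obtain ⟨-, D, hD, hDL⟩ := h𝒯 S.1 S.2
  have h0 := 𝒯.vertex_mem_hull S 0
  have hG0 : 𝒯.G (S.1 0) = S.1 0 := 𝒯.G_vertex S.1 S.2 0
  refine ⟨D (S.1 0), (hD _ h0).2, fun t ht y hy e => ?_⟩
  set DF : E3 → E3 →L[ℝ] V := fun p => fderivWithin ℝ (F t) (closure Ω₀) p with hDF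
  set L := DF (S.1 0) ∘L D (S.1 0) with hL
  have hder : ∀ x ∈ 𝒯.hull S, HasFDerivWithinAt (fun x => F t (𝒯.G x)) (DF (𝒯.G x) ∘L D x)
      (𝒯.hull S) x := fun x hx => by
    have h1 : HasFDerivWithinAt (F t) (DF (𝒯.G x)) (closure Ω₀) (𝒯.G x) := by
      rw [hDF]
      simp only
      rw [fderivWithin_space hΩ hF ht (𝒯.mapsTo_G S hx)]
      exact hasFDerivWithinAt_space hF ht (𝒯.mapsTo_G S hx)
    exact h1.comp x (hD x hx).1 (𝒯.mapsTo_G S)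
  have hGd : ∀ x ∈ 𝒯.hull S, dist (𝒯.G x) (S.1 0) < δ := fun x hx => by
    have h1 := (𝒯.convex_hull S).norm_image_sub_le_of_norm_hasFDerivWithin_le
      (fun z hz => (hD z hz).1) (fun z hz => (isInvertible_of_norm_sub_id_le hq (hD z hz).2).2.2)
      h0 hx
    rw [hG0, ← dist_eq_norm, ← dist_eq_norm] at h1
    have := 𝒯.dist_le_width S hx h0
    linarith
  -- On one simplex the differential of `F t ∘ G` is nearly constant: uniform continuity of the
  -- differential of `F` contributes half of `ε'`, the Lipschitz bound for that of `G` the other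
  -- half.
  have hbound : ∀ x ∈ 𝒯.hull S, ‖DF (𝒯.G x) ∘L D x - L‖ ≤ ε' := fun x hx => by
    have e1 : DF (𝒯.G x) ∘L D x - L = (DF (𝒯.G x) - DF (S.1 0)) ∘L D x +
        DF (S.1 0) ∘L (D x - D (S.1 0)) := by
      ext v; simp [hL]
    have h1 : ‖DF (𝒯.G x) - DF (S.1 0)‖ ≤ ε' / 4 := by
      rw [← dist_eq_norm]
      refine (hδ (t, 𝒯.G x) ⟨ht, 𝒯.mapsTo_G S hx⟩ (t, S.1 0)
        ⟨ht, 𝒯.vertex_mem_closure S 0⟩ ?_).le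
      rw [Prod.dist_eq, dist_self]
      exact max_lt hδ0 (hGd x hx)
    have h2 : ‖D x‖ ≤ 2 := (isInvertible_of_norm_sub_id_le hq (hD x hx).2).2.2
    have h3 : ‖D x - D (S.1 0)‖ ≤ σ * 𝒯.width := by
      refine (hDL x hx _ h0).trans (mul_le_mul_of_nonneg_left ?_ hσ.le)
      rw [← dist_eq_norm]
      exact 𝒯.dist_le_width S hx h0
    have h4 : ‖DF (S.1 0)‖ ≤ K := (hK t ht _ (𝒯.vertex_mem_closure S 0)).2.1
    have h5 : K * (σ * 𝒯.width) ≤ ε' / 2 := by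
      rw [le_div_iff₀ (by positivity)] at hwε
      nlinarith
    calc _ ≤ ‖DF (𝒯.G x) - DF (S.1 0)‖ * ‖D x‖ + ‖DF (S.1 0)‖ * ‖D x - D (S.1 0)‖ := by
          rw [e1]
          exact (norm_add_le _ _).trans (add_le_add (ContinuousLinearMap.opNorm_comp_le _ _)
            (ContinuousLinearMap.opNorm_comp_le _ _))
      _ ≤ ε' / 4 * 2 + K * (σ * 𝒯.width) := by gcongr
      _ ≤ ε' := by linarith
  have hrem : ∀ α : LocalNode k, ‖F t (𝒯.dof S α) - F t (S.1 0) -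
      L (linPart S.1 (refNode α))‖ ≤ ε' * 𝒯.width := fun α => by
    have hα := 𝒯.affineMap_mem_hull S (refNode_mem hk α)
    have h1 := (𝒯.convex_hull S).norm_image_sub_le_of_norm_hasFDerivWithin_le' hder hbound h0 hα
    rw [hG0] at h1
    have e1 : affineMap S.1 (refNode α) - S.1 0 = linPart S.1 (refNode α) := by
      rw [affineMap_eq, add_sub_cancel_left]
    have h2 : ‖affineMap S.1 (refNode α) - S.1 0‖ ≤ 𝒯.width := by
      rw [← dist_eq_norm]; exact 𝒯.dist_le_width S hα h0
    refine le_trans ?_ (h1.trans (mul_le_mul_of_nonneg_left h2 hε'0.le))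
    rw [e1]
    rfl
  set c : LocalNode k → ℝ := fun α => fderiv ℝ (shape α) y ((linPart S.1).inverse e) with hc
  have hc0 : ∑ α, c α = 0 := by
    have := congrArg (fun A : StrongDual ℝ E3 => A ((linPart S.1).inverse e))
      (sum_fderiv_shape (k := k) y)
    simpa [_root_.sum_apply] using this
  have hc1 : ∑ α, c α • refNode α = (linPart S.1).inverse e :=
    sum_fderiv_shape_smul_refNode hk y _
  have hBB : linPart S.1 ((linPart S.1).inverse e) = e :=
    (((linPart_isInvertible (𝒯.indep S)).inverse_apply_eq (y := e)
      (x := (linPart S.1).inverse e)).1 rfl).symm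
  -- Shape gradients annihilate constants and reproduce linear maps, so only the deviations of the
  -- nodal values from an affine map remain.
  have hid : ∑ α, c α • F t (𝒯.dof S α) - L e = ∑ α, c α • (F t (𝒯.dof S α) - F t (S.1 0) -
      L (linPart S.1 (refNode α))) := by
    simp only [smul_sub, Finset.sum_sub_distrib]
    rw [← Finset.sum_smul, hc0, zero_smul, sub_zero]
    congr 1
    nth_rw 1 [← hBB, ← hc1]
    simp only [map_sum, map_smul]
  change ‖∑ α, c α • F t (𝒯.dof S α) - L e‖ ≤ _
  rw [hid]
  have hcb : ∑ α, |c α| ≤ Cs * (σ / 𝒯.width * ‖e‖) := by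
    have h1 : ∀ α ∈ Finset.univ, |c α| ≤ ‖fderiv ℝ (shape α) y‖ * (σ / 𝒯.width * ‖e‖) :=
      fun α _ => by
        refine ((fderiv ℝ (shape α) y).le_opNorm _).trans ?_
        refine mul_le_mul_of_nonneg_left ?_ (norm_nonneg _)
        exact ((linPart S.1).inverse.le_opNorm e).trans
          (mul_le_mul_of_nonneg_right (h𝒯.norm_inverse_le hσ S) (norm_nonneg _))
    refine (Finset.sum_le_sum h1).trans ?_
    rw [← Finset.sum_mul]
    exact mul_le_mul_of_nonneg_right (hCs y hy).1 (by positivity)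
  calc _ ≤ ∑ α, |c α| * (ε' * 𝒯.width) := by
        refine (norm_sum_le _ _).trans (Finset.sum_le_sum fun α _ => ?_)
        rw [norm_smul, Real.norm_eq_abs]
        exact mul_le_mul_of_nonneg_left (hrem α) (abs_nonneg _)
    _ = (∑ α, |c α|) * (ε' * 𝒯.width) := by rw [Finset.sum_mul]
    _ ≤ Cs * (σ / 𝒯.width * ‖e‖) * (ε' * 𝒯.width) :=
        mul_le_mul_of_nonneg_right hcb (by positivity)
    _ = ε * ‖e‖ := by rw [hε']; field_simp

end ExactTriangulation
namespace ExactTriangulation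

variable {Ω₀ : Set E3} (𝒯 : ExactTriangulation Ω₀) {k : ℕ} {σ q T : ℝ}

/-! ### Bounds for the interpolated exact solution -/

lemma feSpace_jac_apply (x : 𝒯.Node k → E3) (S : 𝒯.simplices) (y : refSimplex) (e : E3) :
    (𝒯.feSpace k).jac x (S, y) e =
      ∑ α : LocalNode k, (fderiv ℝ (shape α) y ((linPart S.1).inverse e)) • x (𝒯.dof S α) := by
  rw [FESpace.jac_apply]
  simp only [feSpace]
  have h : ∀ j : 𝒯.Node k, (∑ α : LocalNode k, if 𝒯.dof S α = j then
      fderiv ℝ (shape α) y ∘L (linPart S.1).inverse else 0) e • x j =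
      ∑ α : LocalNode k, if 𝒯.dof S α = j then
        (fderiv ℝ (shape α) y ((linPart S.1).inverse e)) • x j else 0 := fun j => by
    rw [_root_.sum_apply, Finset.sum_smul]
    refine Finset.sum_congr rfl fun α _ => ?_
    split_ifs <;> simp
  simp only [h]
  rw [Finset.sum_comm]
  simp

lemma feSpace_grad_apply (z : 𝒯.Node k → ℝ) (S : 𝒯.simplices) (y : refSimplex) (e : E3) :
    (𝒯.feSpace k).grad z (S, y) e =
      ∑ α : LocalNode k, (fderiv ℝ (shape α) y ((linPart S.1).inverse e)) • z (𝒯.dof S α) := by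
  rw [feSpace_grad]
  simp [shapeGrad, mul_comm]

lemma norm_sum_shape_smul_le {V : Type*} [NormedAddCommGroup V] [NormedSpace ℝ V]
    {z : LocalNode k → V} {K Cs : ℝ} (hz : ∀ α, ‖z α‖ ≤ K) (hK : 0 ≤ K) {y : E3}
    (hy : ∑ α : LocalNode k, |shape α y| ≤ Cs) : ‖∑ α, shape α y • z α‖ ≤ Cs * K := by
  refine (norm_sum_le _ _).trans (le_trans ?_ (mul_le_mul_of_nonneg_right hy hK))
  rw [Finset.sum_mul]
  refine Finset.sum_le_sum fun α _ => ?_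
  rw [norm_smul, Real.norm_eq_abs]
  exact mul_le_mul_of_nonneg_left (hz α) (abs_nonneg _)

variable (Ω₀) in
-- The interpolation error with tolerance one already bounds the gradients independently of the
-- mesh; values are bounded by the sum of the moduli of the shape functions.
lemma exists_interpolation_bound {V : Type*} [NormedAddCommGroup V] [NormedSpace ℝ V]
    {F : ℝ → E3 → V} (hk : k ≠ 0) (hT : 0 < T) (hσ : 0 < σ) (hq : q < 1)
    (hΩ : UniqueDiffOn ℝ (closure Ω₀)) (hΩc : IsCompact (closure Ω₀))
    (hF : ContDiffOn ℝ 1 (fun z : ℝ × E3 => F z.1 z.2) (Icc 0 T ×ˢ closure Ω₀)) :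
    ∃ K : ℝ, 0 ≤ K ∧ ∃ h₁ : ℝ, 0 < h₁ ∧
      ∀ 𝒯 : ExactTriangulation Ω₀, 𝒯.IsQuasiUniform σ q → 𝒯.width ≤ h₁ →
      ∀ S : 𝒯.simplices, ∀ t ∈ Icc 0 T, ∀ y ∈ refSimplex,
        (∀ e : E3, ‖∑ α : LocalNode k, (fderiv ℝ (shape α) y ((linPart S.1).inverse e)) •
          F t (𝒯.dof S α)‖ ≤ K * ‖e‖) ∧
        ‖∑ α : LocalNode k, shape α y • F t (𝒯.dof S α)‖ ≤ K ∧
        ‖∑ α : LocalNode k, shape α y •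
          fderivWithin ℝ (fun z : ℝ × E3 => F z.1 z.2) (Icc 0 T ×ˢ closure Ω₀)
            (t, 𝒯.dof S α) (1, 0)‖ ≤ K := by
  obtain ⟨K, hK0, hK⟩ := exists_bound_cylinder hT hΩ hΩc hF
  obtain ⟨Cs, hCs1, hCs⟩ := exists_shape_bound k
  obtain ⟨h₁, hh₁, h⟩ := exists_interpolation_error hk hT hσ hq hΩ hΩc hF one_pos
  have hCs0 : 0 ≤ Cs := by linarith
  refine ⟨max (2 * K + 1) (Cs * K), le_max_of_le_left (by positivity), h₁, hh₁,
    fun 𝒯 h𝒯 hw S t ht y hy => ⟨fun e => ?_, ?_, ?_⟩⟩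
  · obtain ⟨D, hD, hDe⟩ := h 𝒯 h𝒯 hw S
    have h1 := hDe t ht y hy e
    have h2 : ‖fderivWithin ℝ (F t) (closure Ω₀) (S.1 0) (D e)‖ ≤ 2 * K * ‖e‖ := by
      refine (ContinuousLinearMap.le_opNorm _ _).trans ?_
      have e1 := (hK t ht _ (𝒯.vertex_mem_closure S 0)).2.1
      have e2 : ‖D e‖ ≤ 2 * ‖e‖ := (D.le_opNorm e).trans
        (mul_le_mul_of_nonneg_right (isInvertible_of_norm_sub_id_le hq hD).2.2 (norm_nonneg _))
      calc _ ≤ K * (2 * ‖e‖) := mul_le_mul e1 e2 (norm_nonneg _) hK0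
        _ = _ := by ring
    have h3 := norm_le_norm_add_norm_sub' (∑ α : LocalNode k,
      (fderiv ℝ (shape α) y ((linPart S.1).inverse e)) • F t (𝒯.dof S α))
      (fderivWithin ℝ (F t) (closure Ω₀) (S.1 0) (D e))
    calc _ ≤ (2 * K + 1) * ‖e‖ := by linarith
      _ ≤ _ := mul_le_mul_of_nonneg_right (le_max_left _ _) (norm_nonneg _)
  · exact (norm_sum_shape_smul_le (fun α => (hK t ht _ (𝒯.node_mem_closure hk _)).1) hK0
      (hCs y hy).2).trans (le_max_right _ _)
  · exact (norm_sum_shape_smul_le (fun α => (hK t ht _ (𝒯.node_mem_closure hk _)).2.2) hK0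
      (hCs y hy).2).trans (le_max_right _ _)

/-- Inversion is continuous at invertible maps, so compactness of the space-time cylinder bounds the
differential and its inverse. -/
lemma exists_flow_bound {X : ℝ → E3 → E3} (hT : 0 < T)
    (hΩ : UniqueDiffOn ℝ (closure Ω₀)) (hΩc : IsCompact (closure Ω₀))
    (hX : ContDiffOn ℝ 1 (fun z : ℝ × E3 => X z.1 z.2) (Icc 0 T ×ˢ closure Ω₀))
    (hnd : ∀ t ∈ Icc 0 T, ∀ p ∈ closure Ω₀,
      ∃ D : E3 ≃L[ℝ] E3, HasFDerivWithinAt (X t) (D : E3 →L[ℝ] E3) (closure Ω₀) p) :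
    ∃ Λ : ℝ, 1 ≤ Λ ∧ ∀ t ∈ Icc 0 T, ∀ p ∈ closure Ω₀,
      GoodMap Λ (fderivWithin ℝ (X t) (closure Ω₀) p) := by
  have hcont := continuousOn_fderivWithin_space hT hΩ hX
  have hinv : ∀ t ∈ Icc 0 T, ∀ p ∈ closure Ω₀,
      (fderivWithin ℝ (X t) (closure Ω₀) p).IsInvertible := fun t ht p hp => by
    obtain ⟨D, hD⟩ := hnd t ht p hp
    exact ⟨D, (hD.fderivWithin (hΩ p hp)).symm⟩
  have hc : IsCompact (Icc 0 T ×ˢ closure Ω₀) := isCompact_Icc.prod hΩc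
  obtain ⟨K₁, h₁⟩ := hc.exists_bound_of_continuousOn hcont
  obtain ⟨K₂, h₂⟩ := hc.exists_bound_of_continuousOn
    (f := fun z : ℝ × E3 => (fderivWithin ℝ (X z.1) (closure Ω₀) z.2).inverse)
    fun z hz => ContinuousAt.comp_continuousWithinAt (g := ContinuousLinearMap.inverse)
      (f := fun z : ℝ × E3 => fderivWithin ℝ (X z.1) (closure Ω₀) z.2)
      (continuousAt_inverse (hinv z.1 hz.1 z.2 hz.2)) (hcont z hz)
  refine ⟨max 1 (max K₁ K₂), le_max_left _ _, fun t ht p hp => ⟨hinv t ht p hp, ?_, ?_⟩⟩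
  · exact (h₁ (t, p) ⟨ht, hp⟩).trans ((le_max_left _ _).trans (le_max_right _ _))
  · exact (h₂ (t, p) ⟨ht, hp⟩).trans ((le_max_right _ _).trans (le_max_right _ _))

variable (Ω₀) in
/-- The interpolated flow map is locally close to an invertible linear map. -/
lemma exists_exactPos_good {X : ℝ → E3 → E3} (hk : k ≠ 0) (hT : 0 < T) (hσ : 0 < σ) (hq : q < 1)
    (hΩ : UniqueDiffOn ℝ (closure Ω₀)) (hΩc : IsCompact (closure Ω₀))
    (hX : ContDiffOn ℝ 1 (fun z : ℝ × E3 => X z.1 z.2) (Icc 0 T ×ˢ closure Ω₀))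
    (hnd : ∀ t ∈ Icc 0 T, ∀ p ∈ closure Ω₀,
      ∃ D : E3 ≃L[ℝ] E3, HasFDerivWithinAt (X t) (D : E3 →L[ℝ] E3) (closure Ω₀) p) :
    ∃ Λ : ℝ, 1 ≤ Λ ∧ ∀ ε : ℝ, 0 < ε → ∃ h₁ : ℝ, 0 < h₁ ∧
      ∀ 𝒯 : ExactTriangulation Ω₀, 𝒯.IsQuasiUniform σ q → 𝒯.width ≤ h₁ →
        ∀ t ∈ Icc 0 T, ∀ S : 𝒯.simplices, ∃ L, GoodMap Λ L ∧ ∀ y : refSimplex,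
          ‖(𝒯.feSpace k).jac (𝒯.exactPos k X t) (S, y) - L‖ ≤ ε := by
  obtain ⟨Λ, hΛ1, hΛ⟩ := exists_flow_bound hT hΩ hΩc hX hnd
  have hΛ0 : 0 < Λ := by linarith
  have hq' : 0 < 1 - q := sub_pos.2 hq
  -- The limiting linear map is the differential of the flow composed with that of `G` at a vertex.
  -- The latter need not be the identity: it is bounded by 2, and its inverse by `1 / (1 - q)`.
  refine ⟨max (Λ * 2) (Λ / (1 - q)), le_max_of_le_left (by linarith), fun ε hε => ?_⟩
  obtain ⟨h₁, hh₁, h⟩ := exists_interpolation_error hk hT hσ hq hΩ hΩc hX hε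
  refine ⟨h₁, hh₁, fun 𝒯 h𝒯 hw t ht S => ?_⟩
  obtain ⟨D, hD, hDe⟩ := h 𝒯 h𝒯 hw S
  have hgood := hΛ t ht _ (𝒯.vertex_mem_closure S 0)
  set A := fderivWithin ℝ (X t) (closure Ω₀) (S.1 0) with hA
  obtain ⟨hD1, hD2, hD3⟩ := isInvertible_of_norm_sub_id_le hq hD
  have hlow : ∀ x, ((1 - q) / Λ) * ‖x‖ ≤ ‖(A ∘L D) x‖ := fun x => by
    have e1 : ‖x‖ ≤ 1 / (1 - q) * ‖D x‖ := by
      have e2 : D.inverse (D x) = x := (hD1.inverse_apply_eq (y := D x) (x := x)).2 rfl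
      calc ‖x‖ = ‖D.inverse (D x)‖ := by rw [e2]
        _ ≤ _ := (D.inverse.le_opNorm _).trans (mul_le_mul_of_nonneg_right hD2 (norm_nonneg _))
    have e2 : ‖D x‖ ≤ Λ * ‖A (D x)‖ := by
      have e3 : A.inverse (A (D x)) = D x := (hgood.inv.inverse_apply_eq (y := A (D x))).2 rfl
      calc ‖D x‖ = ‖A.inverse (A (D x))‖ := by rw [e3]
        _ ≤ _ := (A.inverse.le_opNorm _).trans
          (mul_le_mul_of_nonneg_right hgood.norm_inverse_le (norm_nonneg _))
    rw [div_mul_eq_mul_div, div_le_iff₀ hΛ0, ContinuousLinearMap.comp_apply]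
    rw [one_div_mul_eq_div, le_div_iff₀ hq'] at e1
    linarith
  obtain ⟨hi, hin⟩ := isInvertible_of_antilipschitz (by positivity) hlow
  refine ⟨A ∘L D, ⟨hi, ?_, ?_⟩, fun y => ?_⟩
  · refine le_max_of_le_left ((ContinuousLinearMap.opNorm_comp_le _ _).trans ?_)
    exact mul_le_mul hgood.norm_le hD3 (norm_nonneg _) hΛ0.le
  · refine le_max_of_le_right (hin.trans (le_of_eq ?_))
    rw [one_div_div]
  · refine ContinuousLinearMap.opNorm_le_bound _ hε.le fun e => ?_
    have := hDe t ht y y.2 e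
    rw [_root_.sub_apply, feSpace_jac_apply]
    exact this

/-! ### The right-hand side and the boundary velocity -/

lemma exists_lipschitz_of_contDiffOn {V : Type*} [NormedAddCommGroup V] [NormedSpace ℝ V]
    {F : ℝ → E3 → V} (hT : 0 < T)
    (hF : ContDiffOn ℝ 1 (fun z : ℝ × E3 => F z.1 z.2) (Icc 0 T ×ˢ univ)) (R : ℝ) :
    ∃ K : ℝ, 0 ≤ K ∧ ∀ t ∈ Icc 0 T, ∀ p ∈ Metric.closedBall (0 : E3) R, ‖F t p‖ ≤ K ∧
      ∀ p' ∈ Metric.closedBall (0 : E3) R, ‖F t p' - F t p‖ ≤ K * ‖p' - p‖ := by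
  have hc : IsCompact (Icc 0 T ×ˢ Metric.closedBall (0 : E3) R) :=
    isCompact_Icc.prod (isCompact_closedBall 0 R)
  have hsub : Icc 0 T ×ˢ Metric.closedBall (0 : E3) R ⊆ Icc 0 T ×ˢ univ :=
    prod_mono_right (subset_univ _)
  obtain ⟨K₁, h₁⟩ := hc.exists_bound_of_continuousOn (hF.continuousOn.mono hsub)
  obtain ⟨K₂, h₂⟩ := hc.exists_bound_of_continuousOn
    ((continuousOn_fderivWithin_space hT uniqueDiffOn_univ hF).mono hsub)
  refine ⟨max 0 (max K₁ K₂), le_max_left _ _, fun t ht p hp => ⟨?_, fun p' hp' => ?_⟩⟩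
  · exact (h₁ (t, p) ⟨ht, hp⟩).trans ((le_max_left _ _).trans (le_max_right _ _))
  · refine (convex_closedBall (0 : E3) R).norm_image_sub_le_of_norm_hasFDerivWithin_le
      (f' := fun p => fderivWithin ℝ (F t) univ p) (fun z hz => ?_) (fun z hz => ?_) hp hp'
    · have := hasFDerivWithinAt_space hF ht (mem_univ z)
      rw [← fderivWithin_space uniqueDiffOn_univ hF ht (mem_univ z)] at this
      exact this.mono (subset_univ _)
    · exact (h₂ (t, z) ⟨ht, hz⟩).trans ((le_max_right _ _).trans (le_max_right _ _))

/-- Solutions of `x' = V(t, x)` that start on a given solution curve stay on it if `V` is of class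
`C¹` near the curve. -/
lemma eqOn_of_ode {V : ℝ → E3 → E3} (hT : 0 < T) {U : Set (ℝ × E3)} (hU : IsOpen U)
    (hV : ContDiffOn ℝ 1 (fun z : ℝ × E3 => V z.1 z.2) (U ∩ Icc 0 T ×ˢ univ))
    {x y : ℝ → E3} (hyU : ∀ t ∈ Icc 0 T, (t, y t) ∈ U)
    (hx : ∀ t ∈ Icc 0 T, HasDerivWithinAt x (V t (x t)) (Icc 0 T) t)
    (hy : ∀ t ∈ Icc 0 T, HasDerivWithinAt y (V t (y t)) (Icc 0 T) t) (h0 : x 0 = y 0) :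
    ∀ t ∈ Icc 0 T, x t = y t := by
  have hxc : ContinuousOn x (Icc 0 T) := fun t ht => (hx t ht).continuousWithinAt
  have hyc : ContinuousOn y (Icc 0 T) := fun t ht => (hy t ht).continuousWithinAt
  set Γ : Set (ℝ × E3) := (fun t => (t, y t)) '' Icc 0 T with hΓ
  have hΓc : IsCompact Γ := isCompact_Icc.image_of_continuousOn (continuousOn_id.prodMk hyc)
  obtain ⟨r, hr0, hrU⟩ := hΓc.exists_cthickening_subset_open hU
    (by rintro _ ⟨t, ht, rfl⟩; exact hyU t ht)
  have htube : ∀ t ∈ Icc 0 T, ∀ p ∈ Metric.closedBall (y t) r, (t, p) ∈ U := fun t ht p hp => by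
    refine hrU (Metric.mem_cthickening_of_dist_le (t, p) (t, y t) r Γ ⟨t, ht, rfl⟩ ?_)
    rw [Prod.dist_eq, dist_self]
    exact max_le hr0.le hp
  have huniq : UniqueDiffOn ℝ (U ∩ Icc 0 T ×ˢ univ) := by
    rw [inter_comm]
    exact (uniqueDiffOn_cylinder hT uniqueDiffOn_univ).inter hU
  -- `V` is Lipschitz only near the curve, so its differential is bounded on a compact tube whose
  -- time sections contain convex balls around `y t`.
  set N : Set (ℝ × E3) := Metric.cthickening r Γ ∩ Icc 0 T ×ˢ univ with hN
  have hNc : IsCompact N := by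
    refine hΓc.cthickening.inter_right ?_
    exact isClosed_Icc.prod isClosed_univ
  obtain ⟨M, hM⟩ := hNc.exists_bound_of_continuousOn
    ((hV.continuousOn_fderivWithin huniq le_rfl).mono (inter_subset_inter_left _ hrU))
  have hlip : ∀ t ∈ Icc 0 T, LipschitzOnWith (Real.toNNReal M) (V t)
      (Metric.closedBall (y t) r) := fun t ht => by
    refine (convex_closedBall (y t) r).lipschitzOnWith_of_nnnorm_hasFDerivWithin_le
      (f' := fun p => fderivWithin ℝ (fun z : ℝ × E3 => V z.1 z.2) (U ∩ Icc 0 T ×ˢ univ) (t, p) ∘L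
        ContinuousLinearMap.inr ℝ ℝ E3) (fun p hp => ?_) fun p hp => ?_
    · have h1 := (hV.differentiableOn one_ne_zero (t, p)
        ⟨htube t ht p hp, ht, mem_univ _⟩).hasFDerivWithinAt
      have h2 : HasFDerivWithinAt (fun p : E3 => (t, p)) (ContinuousLinearMap.inr ℝ ℝ E3)
        (Metric.closedBall (y t) r) p := (hasFDerivAt_prodMk_right t p).hasFDerivWithinAt
      exact h1.comp p h2 fun z hz => ⟨htube t ht z hz, ht, mem_univ _⟩
    · rw [← NNReal.coe_le_coe, coe_nnnorm]
      have hmem : (t, p) ∈ N := by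
        refine ⟨Metric.mem_cthickening_of_dist_le (t, p) (t, y t) r Γ ⟨t, ht, rfl⟩ ?_,
          ht, mem_univ _⟩
        rw [Prod.dist_eq, dist_self]
        exact max_le hr0.le hp
      refine (ContinuousLinearMap.opNorm_comp_le _ _).trans ?_
      refine (mul_le_of_le_one_right (norm_nonneg _) ?_).trans
        ((hM _ hmem).trans (Real.le_coe_toNNReal M))
      refine ContinuousLinearMap.opNorm_le_bound _ zero_le_one fun e => ?_
      simp [Prod.norm_def]
  have hright : ∀ {z : ℝ → E3} {τ : ℝ}, τ ∈ Icc 0 T →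
      (∀ t ∈ Icc 0 T, HasDerivWithinAt z (V t (z t)) (Icc 0 T) t) →
      ∀ t ∈ Ico 0 τ, HasDerivWithinAt z (V t (z t)) (Ici t) t := fun {z τ} hτ hz t ht => by
    refine (hz t ⟨ht.1, ht.2.le.trans hτ.2⟩).mono_of_mem_nhdsWithin ?_
    refine Filter.mem_of_superset (Icc_mem_nhdsGE (ht.2.trans_le hτ.2)) ?_
    exact Icc_subset_Icc_left ht.1
  have key : ∀ τ ∈ Icc 0 T, (∀ s ∈ Icc 0 τ, ‖x s - y s‖ ≤ r) → EqOn x y (Icc 0 τ) :=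
    fun τ hτ h => by
      have hsub : Icc 0 τ ⊆ Icc 0 T := Icc_subset_Icc_right hτ.2
      refine ODE_solution_unique_of_mem_Icc_right (v := V) (K := Real.toNNReal M)
        (s := fun t => Metric.closedBall (y t) r)
        (fun t ht => hlip t (hsub (Ico_subset_Icc_self ht))) (hxc.mono hsub) (hright hτ hx)
        (fun t ht => ?_) (hyc.mono hsub) (hright hτ hy)
        (fun t _ => Metric.mem_closedBall_self hr0.le) h0
      rw [mem_closedBall_iff_norm]
      exact h t (Ico_subset_Icc_self ht)
  -- As long as `x` stays in the tube, uniqueness gives `x = y`; the distance is then zero, so the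
  -- tube is never left.
  have hb := bootstrap (T := T) (b := r) (g := fun t => ‖x t - y t‖) (hxc.sub hyc).norm
    (by simpa [h0] using hr0) fun t ht h => by
      have := key t ht h (right_mem_Icc.2 ht.1)
      simpa [this] using hr0
  intro t ht
  exact key t ht (fun s hs => (hb s ⟨hs.1, hs.2.trans ht.2⟩).le) (right_mem_Icc.2 ht.1)

end ExactTriangulation
namespace ExactTriangulation

variable {Ω₀ : Set E3} (𝒯 : ExactTriangulation Ω₀) {k : ℕ}

/-! ### Matrices as integrals over the reference space -/

/-- The differential of the element map, with respect to the flat simplex. -/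
def localJac (x : 𝒯.Node k → E3) (S : 𝒯.simplices) (y : E3) : E3 →L[ℝ] E3 :=
  ∑ α : LocalNode k, (fderiv ℝ (shape α) y ∘L (linPart S.1).inverse).smulRight (x (𝒯.dof S α))

/-- The basis function of the node `j` on the unit simplex. -/
def localVal (S : 𝒯.simplices) (j : 𝒯.Node k) (y : E3) : ℝ :=
  ∑ α : LocalNode k, if 𝒯.dof S α = j then shape α y else 0

/-- The gradient of the basis function of the node `j`, with respect to the flat simplex. -/
def localGrad (S : 𝒯.simplices) (j : 𝒯.Node k) (y : E3) : StrongDual ℝ E3 :=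
  ∑ α : LocalNode k, if 𝒯.dof S α = j then fderiv ℝ (shape α) y ∘L (linPart S.1).inverse else 0

lemma feSpace_jac (x : 𝒯.Node k → E3) (S : 𝒯.simplices) (y : refSimplex) :
    (𝒯.feSpace k).jac x (S, y) = 𝒯.localJac x S y := by
  ext1 e
  rw [feSpace_jac_apply, localJac, _root_.sum_apply]
  rfl

lemma hasFDerivAt_localVal (S : 𝒯.simplices) (j : 𝒯.Node k) (y : E3) :
    HasFDerivAt (𝒯.localVal S j) (𝒯.localGrad S j y ∘L linPart S.1) y := by
  have h : HasFDerivAt (𝒯.localVal S j)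
      (∑ α : LocalNode k, if 𝒯.dof S α = j then fderiv ℝ (shape α) y else 0) y := by
    unfold localVal
    refine HasFDerivAt.fun_sum fun α _ => ?_
    by_cases hα : 𝒯.dof S α = j
    · simpa [hα] using (differentiable_shape α y).hasFDerivAt
    · simpa [hα] using hasFDerivAt_const (0 : ℝ) y
  refine h.congr_fderiv ?_
  have hB := linPart_isInvertible (𝒯.indep S)
  ext1 v
  have hv : (linPart S.1).inverse (linPart S.1 v) = v :=
    (hB.inverse_apply_eq (y := linPart S.1 v) (x := v)).2 rfl
  rw [ContinuousLinearMap.comp_apply, localGrad, _root_.sum_apply, _root_.sum_apply]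
  refine Finset.sum_congr rfl fun α _ => ?_
  split_ifs
  · rw [ContinuousLinearMap.comp_apply, hv]
  · simp

lemma hasFDerivAt_elementMap (x : 𝒯.Node k → E3) (S : 𝒯.simplices) (y : E3) :
    HasFDerivAt (𝒯.elementMap x S) (𝒯.localJac x S y ∘L linPart S.1) y := by
  have h : HasFDerivAt (𝒯.elementMap x S)
      (∑ α : LocalNode k, (fderiv ℝ (shape α) y).smulRight (x (𝒯.dof S α))) y := by
    unfold elementMap
    exact HasFDerivAt.fun_sum fun α _ => ((differentiable_shape α y).hasFDerivAt).smul_const _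
  refine h.congr_fderiv ?_
  have hB := linPart_isInvertible (𝒯.indep S)
  ext1 v
  have hv : (linPart S.1).inverse (linPart S.1 v) = v :=
    (hB.inverse_apply_eq (y := linPart S.1 v) (x := v)).2 rfl
  rw [ContinuousLinearMap.comp_apply, localJac, _root_.sum_apply, _root_.sum_apply]
  refine Finset.sum_congr rfl fun α _ => ?_
  rw [ContinuousLinearMap.smulRight_apply, ContinuousLinearMap.smulRight_apply,
    ContinuousLinearMap.comp_apply, hv]

lemma contDiff_elementMap (x : 𝒯.Node k → E3) (S : 𝒯.simplices) :
    ContDiff ℝ 1 (𝒯.elementMap x S) := by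
  unfold elementMap
  exact ContDiff.sum fun α _ => (contDiff_shape α).smul contDiff_const

/-- The differential of every element map is close to a constant invertible linear map. -/
def IsRegular (Λ : ℝ) (x : 𝒯.Node k → E3) : Prop :=
  ∀ S : 𝒯.simplices, ∃ L, GoodMap Λ L ∧ ∀ y : refSimplex,
    ‖(𝒯.feSpace k).jac x (S, y) - L‖ ≤ (2 * Λ)⁻¹

variable {𝒯} {Λ : ℝ} {x : 𝒯.Node k → E3} (hΛ : 1 ≤ Λ) (hx : 𝒯.IsRegular Λ x)

include hΛ hx

lemma IsRegular.isInvertible (S : 𝒯.simplices) {y : E3} (hy : y ∈ refSimplex) :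
    (𝒯.localJac x S y).IsInvertible := by
  obtain ⟨L, hL, hd⟩ := hx S
  have := (hL.perturb hΛ (hd ⟨y, hy⟩)).inv
  rwa [feSpace_jac] at this

/-- Over the flat convex simplex the map differs from `L` by a map with Lipschitz constant `(2
Λ)⁻¹`, half of the lower bound of `L`; hence it cannot identify two points. -/
lemma IsRegular.injOn (S : 𝒯.simplices) : InjOn (𝒯.elementMap x S) refSimplex := by
  obtain ⟨L, hL, hd⟩ := hx S
  have hΛ0 : 0 < Λ := by linarith
  intro y hy y' hy' heq
  have hder : ∀ z ∈ 𝒯.hull S, HasFDerivWithinAt (fun z => 𝒯.elementMap x S (affineInv S.1 z))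
      (𝒯.localJac x S (affineInv S.1 z)) (𝒯.hull S) z := fun z hz => by
    have h1 := (𝒯.hasFDerivAt_elementMap x S (affineInv S.1 z)).comp z (hasFDerivAt_affineInv S.1 z)
    have h2 : (𝒯.localJac x S (affineInv S.1 z) ∘L linPart S.1) ∘L (linPart S.1).inverse =
        𝒯.localJac x S (affineInv S.1 z) := by
      rw [ContinuousLinearMap.comp_assoc, (linPart_isInvertible (𝒯.indep S)).self_comp_inverse,
        ContinuousLinearMap.comp_id]
    rw [h2] at h1
    exact h1.hasFDerivWithinAt
  have hb : ∀ z ∈ 𝒯.hull S, ‖𝒯.localJac x S (affineInv S.1 z) - L‖ ≤ (2 * Λ)⁻¹ := fun z hz => by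
    have := hd ⟨affineInv S.1 z, (affineInv_mem (𝒯.indep S)).2 hz⟩
    rwa [feSpace_jac] at this
  have h1 := (𝒯.convex_hull S).norm_image_sub_le_of_norm_hasFDerivWithin_le' hder hb
    (𝒯.affineMap_mem_hull S hy) (𝒯.affineMap_mem_hull S hy')
  rw [affineInv_affineMap (𝒯.indep S), affineInv_affineMap (𝒯.indep S), heq, sub_self, zero_sub,
    norm_neg] at h1
  set v := affineMap S.1 y' - affineMap S.1 y with hv
  have h2 : Λ⁻¹ * ‖v‖ ≤ ‖L v‖ := hL.le_norm_apply hΛ0 v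
  have h3 : (2 * Λ)⁻¹ = Λ⁻¹ / 2 := by field_simp
  rw [h3] at h1
  have h4 : Λ⁻¹ * ‖v‖ ≤ 0 := by linarith
  have h5 : ‖v‖ ≤ 0 := nonpos_of_mul_nonpos_right h4 (inv_pos.2 hΛ0)
  exact (affineMap_injective (𝒯.indep S) (sub_eq_zero.1 (norm_le_zero_iff.1 h5))).symm

lemma IsRegular.basisFun_elementMap (S : 𝒯.simplices) (j : 𝒯.Node k) {y : E3}
    (hy : y ∈ refSimplex) : 𝒯.basisFun x S j (𝒯.elementMap x S y) = 𝒯.localVal S j y := by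
  rw [basisFun, localVal, (hx.injOn hΛ S).leftInvOn_invFunOn hy]

lemma IsRegular.integral_element (S : 𝒯.simplices) (F : E3 → ℝ) :
    ∫ z in 𝒯.element x S, F z = |(linPart S.1).det| *
      ∫ y in refSimplex, F (𝒯.elementMap x S y) * |(𝒯.localJac x S y).det| := by
  rw [element, integral_image_eq_integral_abs_det_fderiv_smul volume
    isClosed_refSimplex.measurableSet
    (fun y _ => (𝒯.hasFDerivAt_elementMap x S y).hasFDerivWithinAt) (hx.injOn hΛ S),
    ← integral_const_mul]
  congr 1
  funext y
  have : (𝒯.localJac x S y ∘L linPart S.1).det = (𝒯.localJac x S y).det * (linPart S.1).det := by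
    rw [ContinuousLinearMap.det, ContinuousLinearMap.det, ContinuousLinearMap.det,
      ContinuousLinearMap.toLinearMap_comp, LinearMap.det_comp]
  rw [this, abs_mul, smul_eq_mul]
  ring

/-- The inverse used in `basisFun` is tied to the reference simplex. Only at interior points is it a
left inverse on a whole neighbourhood, which the inverse function theorem then differentiates. -/
lemma IsRegular.gradient_basisFun (S : 𝒯.simplices) (j : 𝒯.Node k) {y : E3}
    (hy : y ∈ interior refSimplex) : gradient (𝒯.basisFun x S j) (𝒯.elementMap x S y) =
      (InnerProductSpace.toDual ℝ E3).symm (𝒯.localGrad S j y ∘L (𝒯.localJac x S y).inverse) := by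
  have hyr := interior_subset hy
  obtain ⟨A, hA⟩ := hx.isInvertible hΛ S hyr
  obtain ⟨B, hB⟩ := linPart_isInvertible (𝒯.indep S)
  set g := Function.invFunOn (𝒯.elementMap x S) refSimplex with hg
  have hstrict : HasStrictFDerivAt (𝒯.elementMap x S) ((B.trans A : E3 ≃L[ℝ] E3) : E3 →L[ℝ] E3)
      y := by
    refine (𝒯.contDiff_elementMap x S).contDiffAt.hasStrictFDerivAt' ?_ one_ne_zero
    have := 𝒯.hasFDerivAt_elementMap x S y
    rw [← hA, ← hB] at this
    exact this
  have hleft : ∀ᶠ z in nhds y, g (𝒯.elementMap x S z) = z := by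
    filter_upwards [mem_interior_iff_mem_nhds.1 hy] with z hz
    exact (hx.injOn hΛ S).leftInvOn_invFunOn hz
  have hgd := (hstrict.to_local_left_inverse hleft).hasFDerivAt
  have hgy : g (𝒯.elementMap x S y) = y := hleft.self_of_nhds
  have hv : HasFDerivAt (𝒯.localVal S j) (𝒯.localGrad S j y ∘L linPart S.1)
      (g (𝒯.elementMap x S y)) := by
    rw [hgy]; exact 𝒯.hasFDerivAt_localVal S j y
  have hcomp := hv.comp _ hgd
  have hfd : fderiv ℝ (𝒯.basisFun x S j) (𝒯.elementMap x S y) =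
      𝒯.localGrad S j y ∘L (𝒯.localJac x S y).inverse := by
    refine HasFDerivAt.fderiv (hcomp.congr_fderiv ?_)
    rw [← hA, ← hB, ContinuousLinearMap.inverse_equiv]
    ext v
    simp
  rw [gradient, hfd]

/-- The mass matrix as an integral over the reference space. -/
lemma IsRegular.massMatrix_eq : 𝒯.massMatrix x = (𝒯.feSpace k).mass 𝒯.refMeasure x := by
  ext j l
  change _ = ∫ y, _ ∂𝒯.refMeasure
  rw [𝒯.integral_refMeasure (F' := fun S y => 𝒯.localVal S j y * 𝒯.localVal S l y *
    |(𝒯.localJac x S y).det|) ?_ fun S y => ?_]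
  · refine Finset.sum_congr rfl fun S _ => ?_
    rw [hx.integral_element hΛ]
    congr 1
    refine setIntegral_congr_fun isClosed_refSimplex.measurableSet fun y hy => ?_
    simp only [hx.basisFun_elementMap hΛ S _ hy]
  · exact (((𝒯.feSpace k).continuous_φ j).mul ((𝒯.feSpace k).continuous_φ l)).mul
      ((contDiff_det (n := 0)).continuous.comp ((𝒯.feSpace k).continuous_jac x)).abs
  · rw [feSpace_jac]; rfl

/-- The load vector as an integral over the reference space. -/
lemma IsRegular.loadVector_eq {f : E3 → ℝ} (hf : Continuous f) :
    𝒯.loadVector f x = (𝒯.feSpace k).load 𝒯.refMeasure f x := by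
  funext j
  change _ = ∫ y, _ ∂𝒯.refMeasure
  rw [𝒯.integral_refMeasure (F' := fun S y => f (𝒯.elementMap x S y) * 𝒯.localVal S j y *
    |(𝒯.localJac x S y).det|) ?_ fun S y => ?_]
  · refine Finset.sum_congr rfl fun S _ => ?_
    rw [hx.integral_element hΛ]
    congr 1
    refine setIntegral_congr_fun isClosed_refSimplex.measurableSet fun y hy => ?_
    simp only [hx.basisFun_elementMap hΛ S _ hy]
  · exact ((hf.comp ((𝒯.feSpace k).continuous_pos x)).mul ((𝒯.feSpace k).continuous_φ j)).mul
      ((contDiff_det (n := 0)).continuous.comp ((𝒯.feSpace k).continuous_jac x)).abs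
  · rw [feSpace_jac, feSpace_pos]; rfl

/-- The stiffness matrix as an integral over the reference space. -/
lemma IsRegular.stiffMatrix_eq : 𝒯.stiffMatrix x = (𝒯.feSpace k).stiff 𝒯.refMeasure x := by
  ext j l
  change _ = ∫ y, _ ∂𝒯.refMeasure
  rw [𝒯.integral_refMeasure (F' := fun S y => stiffInt (𝒯.localJac x S y) (𝒯.localGrad S j y)
    (𝒯.localGrad S l y)) ?_ fun S y => ?_]
  · refine Finset.sum_congr rfl fun S _ => ?_
    rw [hx.integral_element hΛ]
    congr 1
    -- Gradients are known only at interior points; the frontier of a convex set has measure zero.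
    refine setIntegral_congr_ae isClosed_refSimplex.measurableSet ?_
    have hnull : volume (frontier refSimplex) = 0 := convex_refSimplex.addHaar_frontier volume
    filter_upwards [measure_eq_zero_iff_ae_notMem.1 hnull] with y hy hyr
    have hint : y ∈ interior refSimplex := by
      by_contra hn
      exact hy ⟨subset_closure hyr, hn⟩
    rw [hx.gradient_basisFun hΛ S j hint, hx.gradient_basisFun hΛ S l hint]
    rfl
  · rw [continuous_iff_continuousAt]
    intro y
    have hinv : ((𝒯.feSpace k).jac x y).IsInvertible := by
      have := hx.isInvertible hΛ y.1 y.2.2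
      rwa [← feSpace_jac] at this
    exact ContinuousAt.comp
      (g := fun z : (E3 →L[ℝ] E3) × StrongDual ℝ E3 × StrongDual ℝ E3 =>
        stiffInt z.1 z.2.1 z.2.2)
      (f := fun y => ((𝒯.feSpace k).jac x y, (𝒯.feSpace k).g j y, (𝒯.feSpace k).g l y))
      (continuousAt_stiffInt hinv _ _)
      (((𝒯.feSpace k).continuous_jac x).prodMk
        (((𝒯.feSpace k).continuous_g j).prodMk ((𝒯.feSpace k).continuous_g l))).continuousAt
  · rw [feSpace_jac]; rfl

end ExactTriangulation
namespace ExactTriangulation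

variable {Ω₀ : Set E3} {𝒯 : ExactTriangulation Ω₀} {k : ℕ} {Λ : ℝ}

/-! ### Residuals and defects -/

variable (𝒯 k) in
/-- The interior nodes, as a predicate. -/
def IsInt (j : 𝒯.Node k) : Prop := (j : E3) ∉ frontier Ω₀

instance : Fintype {j : 𝒯.Node k // 𝒯.IsInt k j} := instFintypeIntNode 𝒯 k

instance : DecidableEq {j : 𝒯.Node k // 𝒯.IsInt k j} := instDecidableEqIntNode 𝒯 k

lemma stiffMatrix_mulVec (x : 𝒯.Node k → E3) (z : 𝒯.Node k → ℝ) (j : 𝒯.IntNode k) :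
    (𝒯.stiffMatrix x *ᵥ z) j = (𝒯.stiffMatrix22 x *ᵥ fun p => z p) j +
      (𝒯.stiffMatrix21 x *ᵥ fun p => z p) j := by
  classical
  have h := Fintype.sum_subtype_add_sum_subtype (fun p : 𝒯.Node k => (p : E3) ∈ frontier Ω₀)
    fun p => 𝒯.stiffMatrix x j p * z p
  rw [add_comm]
  simp only [mulVec, dotProduct]
  rw [← h]
  congr 1
  · exact Finset.sum_congr (by ext; simp) fun p _ => rfl
  · exact Finset.sum_congr (by ext; simp) fun p _ => rfl

/-- The discrete Laplace equation as a set of rows of the stiffness matrix. -/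
lemma stiff_mulVec_eq_zero (hΛ : 1 ≤ Λ) {x : 𝒯.Node k → E3} (hx : 𝒯.IsRegular Λ x)
    {z : 𝒯.Node k → ℝ}
    (h : 𝒯.stiffMatrix22 x *ᵥ (fun p => z p) = -(𝒯.stiffMatrix21 x *ᵥ fun p => z p))
    {j : 𝒯.Node k} (hj : 𝒯.IsInt k j) : ((𝒯.feSpace k).stiff 𝒯.refMeasure x *ᵥ z) j = 0 := by
  rw [← hx.stiffMatrix_eq hΛ]
  have h1 := stiffMatrix_mulVec x z ⟨j, hj⟩
  rw [h1, h, Pi.neg_apply, neg_add_cancel]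

lemma massMatrix22_transpose (hΛ : 1 ≤ Λ) {x : 𝒯.Node k → E3} (hx : 𝒯.IsRegular Λ x) :
    (𝒯.massMatrix22 x)ᵀ = 𝒯.massMatrix22 x := by
  rw [massMatrix22, transpose_submatrix, hx.massMatrix_eq hΛ, FESpace.mass_transpose]

lemma dotProduct_mul_mul {ι : Type} [Fintype ι] {M P : Matrix ι ι ℝ} (hM : Mᵀ = M) (d : ι → ℝ) :
    d ⬝ᵥ ((M * P * M) *ᵥ d) = (M *ᵥ d) ⬝ᵥ (P *ᵥ (M *ᵥ d)) := by
  rw [← Matrix.mulVec_mulVec, ← Matrix.mulVec_mulVec, Matrix.dotProduct_mulVec,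
    ← Matrix.mulVec_transpose, hM]

/-- The dual norm of the velocity defect. -/
lemma dualNorm₀_sq (hΛ : 1 ≤ Λ) {x v : 𝒯.Node k → E3} (hx : 𝒯.IsRegular Λ x)
    {d : 𝒯.IntNode k → E3}
    (h : ∀ i : Fin 3, 𝒯.stiffMatrix22 x *ᵥ (fun p => v p i) =
      -(𝒯.stiffMatrix21 x *ᵥ fun p => v p i) + 𝒯.massMatrix22 x *ᵥ fun p => d p i)
    (h0 : 0 ≤ (𝒯.feSpace k).velDefectSq 𝒯.refMeasure (𝒯.IsInt k) x v) :
    𝒯.dualNorm₀ x d ^ 2 = (𝒯.feSpace k).velDefectSq 𝒯.refMeasure (𝒯.IsInt k) x v := by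
  -- The residual is `M₂₂ d`, so the outer mass matrices in the dual norm are absorbed and a
  -- quadratic form of `A₂₂⁻¹` in the residual remains.
  have hres : ∀ i, (𝒯.feSpace k).velResidual 𝒯.refMeasure (𝒯.IsInt k) x v i =
      𝒯.massMatrix22 x *ᵥ fun p => d p i := fun i => by
    funext j
    change ((𝒯.feSpace k).stiff 𝒯.refMeasure x *ᵥ fun p => v p i) j.1 = _
    rw [← hx.stiffMatrix_eq hΛ]
    have h1 := stiffMatrix_mulVec x (fun p => v p i) (⟨j.1, j.2⟩ : 𝒯.IntNode k)
    have h2 := congrFun (h i) (⟨j.1, j.2⟩ : 𝒯.IntNode k)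
    simp only [Pi.add_apply, Pi.neg_apply] at h2
    refine h1.trans ?_
    change _ = (𝒯.massMatrix22 x *ᵥ fun p => d p i) (⟨j.1, j.2⟩ : 𝒯.IntNode k)
    linarith
  have hA : 𝒯.stiffMatrix22 x = (𝒯.feSpace k).stiffBlock 𝒯.refMeasure (𝒯.IsInt k) x := by
    rw [stiffMatrix22, hx.stiffMatrix_eq hΛ]; rfl
  have heq : ∑ i : Fin 3, (fun p => d p i) ⬝ᵥ
      ((𝒯.massMatrix22 x * (𝒯.stiffMatrix22 x)⁻¹ * 𝒯.massMatrix22 x) *ᵥ fun p => d p i) =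
      (𝒯.feSpace k).velDefectSq 𝒯.refMeasure (𝒯.IsInt k) x v := by
    refine Finset.sum_congr rfl fun i _ => ?_
    rw [dotProduct_mul_mul (massMatrix22_transpose hΛ hx), hres, hA]
    rfl
  rw [dualNorm₀, heq, Real.sq_sqrt h0]

/-- The dual norm of the defect in the diffusion equation. -/
lemma dualNorm_sq (hΛ : 1 ≤ Λ) {T : ℝ} (hT : 0 < T) {xs vs : ℝ → 𝒯.Node k → E3}
    {us us' : ℝ → 𝒯.Node k → ℝ} {f : ℝ → E3 → ℝ} {d : 𝒯.Node k → ℝ} {t : ℝ} (ht : t ∈ Icc 0 T)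
    (hreg : ∀ s ∈ Icc 0 T, 𝒯.IsRegular Λ (xs s)) (hf : Continuous (f t))
    (hxs : HasDerivWithinAt xs (vs t) (Icc 0 T) t) (hus : HasDerivWithinAt us (us' t) (Icc 0 T) t)
    (h : HasDerivWithinAt (fun s => 𝒯.massMatrix (xs s) *ᵥ us s)
      (𝒯.loadVector (f t) (xs t) + 𝒯.massMatrix (xs t) *ᵥ d - 𝒯.stiffMatrix (xs t) *ᵥ us t)
      (Icc 0 T) t)
    (h0 : 0 ≤ (𝒯.feSpace k).diffDefectSq 𝒯.refMeasure (f t) (xs t) (vs t) (us t) (us' t)) :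
    𝒯.dualNorm (xs t) d ^ 2 =
      (𝒯.feSpace k).diffDefectSq 𝒯.refMeasure (f t) (xs t) (vs t) (us t) (us' t) := by
  have hr := hreg t ht
  have hinv : ∀ y, ((𝒯.feSpace k).jac (xs t) y).IsInvertible := fun y => by
    have := hr.isInvertible hΛ y.1 y.2.2
    rwa [← feSpace_jac] at this
  have h1 := hasDerivWithinAt_mulVec
    (fun j l => (𝒯.feSpace k).hasDerivWithinAt_mass 𝒯.refMeasure hxs hinv j l) hus
  have h2 := h.congr (f₁ := fun s => (𝒯.feSpace k).mass 𝒯.refMeasure (xs s) *ᵥ us s)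
    (fun s hs => by rw [(hreg s hs).massMatrix_eq hΛ]) (by rw [hr.massMatrix_eq hΛ])
  -- The derivative of `M(x*) u*` is computed once by the product rule and once from the definition
  -- of the defect; comparison shows that `M d` is the residual.
  have h3 := (uniqueDiffOn_Icc hT t ht).eq_deriv _ h1 h2
  have hres : (𝒯.feSpace k).diffResidual 𝒯.refMeasure (f t) (xs t) (vs t) (us t) (us' t) =
      𝒯.massMatrix (xs t) *ᵥ d := by
    rw [FESpace.diffResidual, h3, hr.loadVector_eq hΛ hf, hr.stiffMatrix_eq hΛ]
    abel
  have hM : (𝒯.massMatrix (xs t))ᵀ = 𝒯.massMatrix (xs t) := by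
    rw [hr.massMatrix_eq hΛ, FESpace.mass_transpose]
  have heq : d ⬝ᵥ ((𝒯.massMatrix (xs t) * (𝒯.massMatrix (xs t) + 𝒯.stiffMatrix (xs t))⁻¹ *
      𝒯.massMatrix (xs t)) *ᵥ d) =
      (𝒯.feSpace k).diffDefectSq 𝒯.refMeasure (f t) (xs t) (vs t) (us t) (us' t) := by
    rw [dotProduct_mul_mul hM, FESpace.diffDefectSq, hres, ← hr.stiffMatrix_eq hΛ,
      ← hr.massMatrix_eq hΛ]
  rw [dualNorm, heq, Real.sq_sqrt h0]

/-! ### Boundary nodes -/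

/-- The boundary nodes of the semi-discrete solution move like the exact ones. -/
lemma eq_on_boundary {T : ℝ} (hT : 0 < T) {f : ℝ → E3 → ℝ} {vΓ X v : ℝ → E3 → E3}
    {u : ℝ → E3 → ℝ} (hsol : IsExactSolution Ω₀ T f vΓ X v u)
    {x w : ℝ → 𝒯.Node k → E3} {u_h : ℝ → 𝒯.Node k → ℝ} {u₀ : E3 → ℝ}
    (hsd : 𝒯.IsSemidiscreteSolution T f vΓ u₀ x w u_h) {j : 𝒯.Node k} (hj : ¬ 𝒯.IsInt k j) :
    ∀ t ∈ Icc 0 T, x t j = 𝒯.exactPos k X t j ∧ w t j = 𝒯.exactVal k X v t j := by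
  have hjf : (j : E3) ∈ frontier Ω₀ := not_not.1 hj
  have hjc : (j : E3) ∈ closure Ω₀ := frontier_subset_closure hjf
  obtain ⟨U, hU, hUm, hV⟩ := hsol.contDiffOn_vΓ
  have hw : ∀ t ∈ Icc 0 T, w t j = vΓ t (x t j) := fun t ht =>
    hsd.boundary_velocity t ht ⟨j, hjf⟩
  -- Discrete and exact boundary nodes solve the same equation `x' = vΓ(t, x)` with the same initial
  -- value.
  have key := eqOn_of_ode hT hU hV (x := fun t => x t j) (y := fun t => X t j)
    (fun t ht => hUm t ht j hjf)
    (fun t ht => by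
      have := hasDerivWithinAt_pi.1 (hsd.position t ht) j
      rwa [hw t ht] at this)
    (fun t ht => by
      have := hsol.position j hjc t ht
      rwa [hsol.boundary_velocity t ht j hjf] at this)
    (by rw [hsd.x_zero, hsol.X_zero _ hjc])
  intro t ht
  have h1 : x t j = X t j := key t ht
  refine ⟨h1, ?_⟩
  rw [hw t ht, h1]
  exact (hsol.boundary_velocity t ht j hjf).symm

end ExactTriangulation

/-! ### Constants -/

lemma exists_small_rpow {s b θ : ℝ} (hs : 0 < s) (hb : 0 ≤ b) (hθ : 0 < θ) :
    ∃ h₀ : ℝ, 0 < h₀ ∧ ∀ h, 0 < h → h ≤ h₀ → b * h ^ s ≤ θ := by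
  have h1 : 0 < θ / (b + 1) := by positivity
  refine ⟨(θ / (b + 1)) ^ s⁻¹, Real.rpow_pos_of_pos h1 _, fun h hh hle => ?_⟩
  have h2 : h ^ s ≤ θ / (b + 1) := by
    have := Real.rpow_le_rpow hh.le hle hs.le
    rwa [Real.rpow_inv_rpow h1.le hs.ne'] at this
  calc b * h ^ s ≤ (b + 1) * (θ / (b + 1)) :=
        mul_le_mul (by linarith) h2 (Real.rpow_nonneg hh.le _) (by linarith)
    _ = θ := by field_simp

/-- The loss `h⁻³` of the inverse estimate meets the squared defect bound; the resulting exponent `2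
κ - 3` is positive exactly when `κ > 3/2`. -/
lemma div_mul_sq_rpow_le {CJ c κ h d : ℝ} (hCJ : 0 ≤ CJ) (hh : 0 < h) (hd0 : 0 ≤ d)
    (hd : d ≤ c * h ^ κ) : CJ / h ^ 3 * d ^ 2 ≤ CJ * c ^ 2 * h ^ (2 * κ - 3) := by
  have h1 : d ^ 2 ≤ (c * h ^ κ) ^ 2 := pow_le_pow_left₀ hd0 hd 2
  have h2 : h ^ (2 * κ - 3) = (h ^ κ) ^ 2 / h ^ 3 := by
    rw [Real.rpow_sub hh, mul_comm 2 κ, Real.rpow_mul hh.le]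
    norm_cast
  rw [h2]
  calc CJ / h ^ 3 * d ^ 2 ≤ CJ / h ^ 3 * (c * h ^ κ) ^ 2 := by gcongr
    _ = _ := by ring

/-- Keeps the discrete positions in a fixed ball, where `f` is uniformly Lipschitz. The factor 3 is
a crude substitute for the square root of the number of components. -/
lemma FESpace.IsStable.norm_pos_le {Y N : Type} [TopologicalSpace Y] [Fintype N] [CompactSpace Y]
    [MeasurableSpace Y] [OpensMeasurableSpace Y] {ν : Measure Y} [IsFiniteMeasure ν]
    {𝔽 : FESpace Y N} {int : N → Prop} {CP J ε : ℝ} (hS : 𝔽.IsStable ν int CP J) (hCP : 0 ≤ CP)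
    (hε : 0 ≤ ε) {x : N → E3} (hx : ∀ j, ¬ int j → x j = 0) (h : ∀ y, ‖𝔽.jac x y‖ ≤ ε) (y : Y) :
    ‖𝔽.pos x y‖ ≤ 3 * CP * ε := by
  have h1 : ∀ i, 𝔽.val (fun j => x j i) y ^ 2 ≤ (CP * ε) ^ 2 := fun i => by
    refine sq_le_sq' ?_ ?_ <;>
    · have := abs_le.1 (hS.sup_le (fun j => x j i) (fun j hj => by simp [hx j hj]) ε
        (fun y => (𝔽.norm_grad_le x y i).trans (h y)) y)
      linarith [this.1, this.2]
  have h2 : ‖𝔽.pos x y‖ ^ 2 ≤ (3 * CP * ε) ^ 2 := by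
    rw [FESpace.sq_norm_pos]
    refine (Finset.sum_le_sum fun i _ => h1 i).trans ?_
    simp only [Finset.sum_const, Finset.card_univ, Fintype.card_fin, nsmul_eq_mul]
    push_cast
    nlinarith [sq_nonneg (CP * ε)]
  exact le_of_sq_le_sq h2 (by positivity)

/-! ### Bounds on a single mesh and the estimate they imply. -/

namespace ExactTriangulation

variable {Ω₀ : Set E3} {k : ℕ} {T : ℝ}

variable (k) in
/-- The nodal vector of the material derivatives. -/
def materialDeriv (𝒯 : ExactTriangulation Ω₀) (T : ℝ) (X : ℝ → E3 → E3) (u : ℝ → E3 → ℝ)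
    (t : ℝ) : 𝒯.Node k → ℝ :=
  fun j => fderivWithin ℝ (fun z : ℝ × E3 => u z.1 (X z.1 z.2)) (Icc 0 T ×ˢ closure Ω₀)
    (t, j) (1, 0)

/-- The bounds, on a given mesh, that the stability estimate relies on. -/
structure MeshBounds (𝒯 : ExactTriangulation Ω₀) (k : ℕ) (T : ℝ) (f : ℝ → E3 → ℝ)
    (X v : ℝ → E3 → E3) (u : ℝ → E3 → ℝ) (CP J ε Λ K R : ℝ) : Prop where
  stable : (𝒯.feSpace k).IsStable 𝒯.refMeasure (𝒯.IsInt k) CP J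
  jac_pos : ∀ t ∈ Icc 0 T, ∀ S : 𝒯.simplices, ∃ L, GoodMap Λ L ∧ ∀ y : refSimplex,
    ‖(𝒯.feSpace k).jac (𝒯.exactPos k X t) (S, y) - L‖ ≤ (4 * Λ)⁻¹
  norm_jac_vel : ∀ t ∈ Icc 0 T, ∀ y, ‖(𝒯.feSpace k).jac (𝒯.exactVal k X v t) y‖ ≤ K
  abs_val : ∀ t ∈ Icc 0 T, ∀ y, |(𝒯.feSpace k).val (𝒯.exactVal k X u t) y| ≤ K
  abs_val_deriv : ∀ t ∈ Icc 0 T, ∀ y, |(𝒯.feSpace k).val (𝒯.materialDeriv k T X u t) y| ≤ K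
  norm_grad : ∀ t ∈ Icc 0 T, ∀ y, ‖(𝒯.feSpace k).grad (𝒯.exactVal k X u t) y‖ ≤ K
  norm_pos : ∀ t ∈ Icc 0 T, ∀ y, ‖(𝒯.feSpace k).pos (𝒯.exactPos k X t) y‖ ≤ R
  source : ∀ t ∈ Icc 0 T, ∀ p ∈ Metric.closedBall (0 : E3) (R + 3 * CP * ε), ‖f t p‖ ≤ K ∧
    ∀ p' ∈ Metric.closedBall (0 : E3) (R + 3 * CP * ε), ‖f t p' - f t p‖ ≤ K * ‖p' - p‖

lemma hasDerivWithinAt_exactPos {f : ℝ → E3 → ℝ} {vΓ X v : ℝ → E3 → E3} {u : ℝ → E3 → ℝ}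
    (hsol : IsExactSolution Ω₀ T f vΓ X v u) (hk : k ≠ 0) (𝒯 : ExactTriangulation Ω₀)
    {t : ℝ} (ht : t ∈ Icc 0 T) :
    HasDerivWithinAt (𝒯.exactPos k X) (𝒯.exactVal k X v t) (Icc 0 T) t :=
  hasDerivWithinAt_pi.2 fun j => hsol.position j (𝒯.node_mem_closure hk j) t ht

lemma continuousOn_exactVal {V : Type} [NormedAddCommGroup V] [NormedSpace ℝ V] {X : ℝ → E3 → E3}
    {g : ℝ → E3 → V} (hg : ContDiffOn ℝ 1 (fun z : ℝ × E3 => g z.1 (X z.1 z.2))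
      (Icc 0 T ×ˢ closure Ω₀)) (hk : k ≠ 0) (𝒯 : ExactTriangulation Ω₀) :
    ContinuousOn (𝒯.exactVal k X g) (Icc 0 T) :=
  continuousOn_pi.2 fun j => hg.continuousOn.comp (f := fun t : ℝ => (t, (j : E3)))
    (by fun_prop) fun _ ht => ⟨ht, 𝒯.node_mem_closure hk j⟩

lemma hasDerivWithinAt_exactVal {X : ℝ → E3 → E3} {u : ℝ → E3 → ℝ}
    (hu : ContDiffOn ℝ 1 (fun z : ℝ × E3 => u z.1 (X z.1 z.2)) (Icc 0 T ×ˢ closure Ω₀))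
    (hk : k ≠ 0) (𝒯 : ExactTriangulation Ω₀) {t : ℝ} (ht : t ∈ Icc 0 T) :
    HasDerivWithinAt (𝒯.exactVal k X u) (𝒯.materialDeriv k T X u t) (Icc 0 T) t :=
  hasDerivWithinAt_pi.2 fun j =>
    hasDerivWithinAt_time (F := fun t p => u t (X t p)) hu ht (𝒯.node_mem_closure hk j)

lemma continuousOn_materialDeriv {X : ℝ → E3 → E3} {u : ℝ → E3 → ℝ} (hT : 0 < T)
    (hu : ContDiffOn ℝ 1 (fun z : ℝ × E3 => u z.1 (X z.1 z.2)) (Icc 0 T ×ˢ closure Ω₀))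
    (hΩ : UniqueDiffOn ℝ (closure Ω₀)) (hk : k ≠ 0) (𝒯 : ExactTriangulation Ω₀) :
    ContinuousOn (𝒯.materialDeriv k T X u) (Icc 0 T) :=
  continuousOn_pi.2 fun j => by
    have h := hu.continuousOn_fderivWithin (uniqueDiffOn_cylinder hT hΩ) le_rfl
    have h2 := h.comp (f := fun t : ℝ => (t, (j : E3))) (s := Icc 0 T) (by fun_prop)
      fun _ ht => ⟨ht, 𝒯.node_mem_closure hk j⟩
    exact h2.clm_apply continuousOn_const

/-- The stability estimate on a given mesh. -/
theorem MeshBounds.stability {𝒯 : ExactTriangulation Ω₀} {f : ℝ → E3 → ℝ} {vΓ X v : ℝ → E3 → E3}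
    {u : ℝ → E3 → ℝ} {CP J C ε Λ K R : ℝ} (h : 𝒯.MeshBounds k T f X v u CP J ε Λ K R)
    (hT : 0 < T) (hsol : IsExactSolution Ω₀ T f vΓ X v u) (hk : k ≠ 0)
    (hΩ : UniqueDiffOn ℝ (closure Ω₀)) (hCP : 0 ≤ CP) (hJ : 0 ≤ J) (hC : 1 ≤ C) (hΛ : 1 ≤ Λ)
    (hK : 0 ≤ K) (hε : 0 < ε) (hεΛ : ε ≤ (4 * Λ)⁻¹)
    (hFB : ∀ H, GoodMap (2 * Λ) H → ∀ H', ‖H' - H‖ ≤ ε → FormBounds C H H')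
    {x w : ℝ → 𝒯.Node k → E3} {u_h : ℝ → 𝒯.Node k → ℝ}
    (hsd : 𝒯.IsSemidiscreteSolution T f vΓ (u 0) x w u_h)
    {d_u : ℝ → 𝒯.Node k → ℝ} {d_v : ℝ → 𝒯.IntNode k → E3}
    (hdu : 𝒯.IsDiffusionDefect T f X u d_u) (hdv : 𝒯.IsVelocityDefect T X v d_v)
    (hsmall : ∀ t ∈ Icc 0 T, J * 𝒯.dualNorm₀ (𝒯.exactPos k X t) (d_v t) ^ 2 ≤
      min (ε ^ 2 / (2 * (FESpace.posConst T C K * T)))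
        (1 / (FESpace.velConst C K * (FESpace.posConst T C K * T + 1)))) :
    ∀ t ∈ Icc 0 T, matNormSq (𝒯.massMatrix (𝒯.exactPos k X t)) (u_h t - 𝒯.exactVal k X u t)
        + ∫ s in (0 : ℝ)..t,
            matNormSq (𝒯.stiffMatrix (𝒯.exactPos k X s)) (u_h s - 𝒯.exactVal k X u s)
      ≤ C ^ 2 * (FESpace.diffConst CP C K * Real.exp (FESpace.diffConst CP C K * T)) *
          (FESpace.posConst T C K * T + 1) * ∫ s in (0 : ℝ)..t,
          (𝒯.dualNorm (𝒯.exactPos k X s) (d_u s) ^ 2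
            + 𝒯.dualNorm₀ (𝒯.exactPos k X s) (d_v s) ^ 2) := by
  have hC0 : 0 < C := by linarith
  have hΛ0 : 0 < Λ := by linarith
  have ha := FESpace.velConst_pos (K := K) hC0
  have hB := FESpace.posConst_pos (T := T) (K := K) hC0
  -- The tolerance in `IsRegular` is shared equally between the interpolation error of the flow and
  -- the displacement of the nodes from their exact positions.
  have hhalf : (4 * Λ)⁻¹ + (4 * Λ)⁻¹ = (2 * Λ)⁻¹ := by field_simp; norm_num
  have hquarter : (0 : ℝ) < (4 * Λ)⁻¹ := by positivity
  have hf : ∀ t ∈ Icc 0 T, Continuous (f t) := fun t ht => by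
    rw [← continuousOn_univ]
    exact hsol.contDiffOn_f.continuousOn.comp (f := fun x : E3 => (t, x)) (by fun_prop)
      fun x _ => ⟨ht, mem_univ _⟩
  have hxs := fun t ht => hasDerivWithinAt_exactPos (k := k) hsol hk 𝒯 (t := t) ht
  have hvs := continuousOn_exactVal (k := k) hsol.contDiffOn_v hk 𝒯
  have hus := fun t ht => hasDerivWithinAt_exactVal (k := k) hsol.contDiffOn_u hk 𝒯 (t := t) ht
  have hus' := continuousOn_materialDeriv (k := k) hT hsol.contDiffOn_u hΩ hk 𝒯
  have hregs : ∀ t ∈ Icc 0 T, 𝒯.IsRegular Λ (𝒯.exactPos k X t) := fun t ht S => by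
    obtain ⟨L, hL, hd⟩ := h.jac_pos t ht S
    exact ⟨L, hL, fun y => (hd y).trans (by linarith)⟩
  have hreg : ∀ t ∈ Icc 0 T, ∀ x' : 𝒯.Node k → E3,
      (∀ y, ‖(𝒯.feSpace k).jac x' y - (𝒯.feSpace k).jac (𝒯.exactPos k X t) y‖ ≤ ε) →
      𝒯.IsRegular Λ x' := fun t ht x' hx' S => by
    obtain ⟨L, hL, hd⟩ := h.jac_pos t ht S
    refine ⟨L, hL, fun y => ?_⟩
    have h1 := norm_add_le ((𝒯.feSpace k).jac x' (S, y) -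
      (𝒯.feSpace k).jac (𝒯.exactPos k X t) (S, y))
      ((𝒯.feSpace k).jac (𝒯.exactPos k X t) (S, y) - L)
    rw [sub_add_sub_cancel] at h1
    linarith [hx' (S, y), hd y]
  have hFB' : ∀ t ∈ Icc 0 T, ∀ x' : 𝒯.Node k → E3,
      (∀ y, ‖(𝒯.feSpace k).jac x' y - (𝒯.feSpace k).jac (𝒯.exactPos k X t) y‖ ≤ ε) →
      ∀ y, FormBounds C ((𝒯.feSpace k).jac (𝒯.exactPos k X t) y) ((𝒯.feSpace k).jac x' y) :=
    fun t ht x' hx' y => by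
      obtain ⟨L, hL, hd⟩ := hregs t ht y.1
      exact hFB _ (hL.perturb hΛ (hd y.2)) _ (hx' y)
  have hFBs : ∀ t ∈ Icc 0 T, ∀ y, FormBounds C ((𝒯.feSpace k).jac (𝒯.exactPos k X t) y)
      ((𝒯.feSpace k).jac (𝒯.exactPos k X t) y) :=
    fun t ht => hFB' t ht _ fun y => by simpa using hε.le
  have hδv0 : ∀ t ∈ Icc 0 T, 0 ≤ (𝒯.feSpace k).velDefectSq 𝒯.refMeasure (𝒯.IsInt k)
      (𝒯.exactPos k X t) (𝒯.exactVal k X v t) := fun t ht =>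
    h.stable.velDefectSq_nonneg _ _ hC0 (hFBs t ht) _
  have hdual₀ := fun t ht => dualNorm₀_sq hΛ (hregs t ht) (hdv t ht) (hδv0 t ht)
  have hbd := fun t (ht : t ∈ Icc 0 T) (j : 𝒯.Node k) (hj : ¬ 𝒯.IsInt k j) =>
    eq_on_boundary hT hsol hsd hj t ht
  have hpos := h.stable.position_stability (ε := ε) (K := K) hT hC hε hJ hxs hvs hsd.position
    (by funext j; rw [hsd.x_zero]; exact (hsol.X_zero _ (𝒯.node_mem_closure hk j)).symm)
    h.norm_jac_vel hFB'
    (fun t ht hcl i j hj => stiff_mulVec_eq_zero hΛ (hreg t ht _ hcl) (hsd.velocity t ht i) hj)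
    (fun t ht j hj => (hbd t ht j hj).2)
    (fun t ht => by rw [← hdual₀ t ht]; exact (hsmall t ht).trans (min_le_left _ _))
  have hregx : ∀ t ∈ Icc 0 T, 𝒯.IsRegular Λ (x t) := fun t ht => hreg t ht _ (hpos t ht).1
  have hδvc := h.stable.continuousOn_velDefectSq _ _ hC0
    (fun t ht => (hxs t ht).continuousWithinAt) hvs hFBs
  -- The second bound in the minimum in `hsmall` serves this purpose: the inverse estimate turns the
  -- energy of the velocity error into a pointwise gradient bound of one.
  have hw : ∀ t ∈ Icc 0 T, ∀ y, ‖(𝒯.feSpace k).jac (w t) y‖ ≤ K + 1 := fun t ht y => by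
    have h1 := h.stable.sq_norm_jac_le _ _ (w t - 𝒯.exactVal k X v t) y
    have h2 := (hpos t ht).2.2
    have h3 := (hpos t ht).2.1
    set θ := 1 / (FESpace.velConst C K * (FESpace.posConst T C K * T + 1)) with hθ
    have hsub : Icc 0 t ⊆ Icc 0 T := Icc_subset_Icc_right ht.2
    have h4 : ∀ s ∈ Icc 0 T, J * (𝒯.feSpace k).velDefectSq 𝒯.refMeasure (𝒯.IsInt k)
        (𝒯.exactPos k X s) (𝒯.exactVal k X v s) ≤ θ := fun s hs => by
      rw [← hdual₀ s hs]; exact (hsmall s hs).trans (min_le_right _ _)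
    have hθ0 : 0 ≤ θ := by positivity
    have h5 : J * ∫ s in (0 : ℝ)..t, (𝒯.feSpace k).velDefectSq 𝒯.refMeasure (𝒯.IsInt k)
        (𝒯.exactPos k X s) (𝒯.exactVal k X v s) ≤ T * θ := by
      rw [← intervalIntegral.integral_const_mul]
      calc _ ≤ ∫ _ in (0 : ℝ)..t, θ := by
            refine intervalIntegral.integral_mono_on ht.1 ?_ intervalIntegrable_const
              fun s hs => h4 s (hsub hs)
            refine ContinuousOn.intervalIntegrable ?_
            rw [uIcc_of_le ht.1]
            exact continuousOn_const.mul (hδvc.mono hsub)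
        _ ≤ _ := by
            rw [intervalIntegral.integral_const, smul_eq_mul, sub_zero]
            gcongr
            exact ht.2
    have h6 : ‖(𝒯.feSpace k).jac (w t - 𝒯.exactVal k X v t) y‖ ^ 2 ≤ 1 ^ 2 := by
      refine h1.trans ?_
      calc _ ≤ J * (FESpace.velConst C K * (FESpace.posConst T C K *
              (∫ s in (0 : ℝ)..t, (𝒯.feSpace k).velDefectSq 𝒯.refMeasure (𝒯.IsInt k)
                (𝒯.exactPos k X s) (𝒯.exactVal k X v s)) +
              (𝒯.feSpace k).velDefectSq 𝒯.refMeasure (𝒯.IsInt k)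
                (𝒯.exactPos k X t) (𝒯.exactVal k X v t))) := by
            gcongr
            refine h2.trans ?_
            gcongr
        _ = FESpace.velConst C K * (FESpace.posConst T C K *
              (J * ∫ s in (0 : ℝ)..t, (𝒯.feSpace k).velDefectSq 𝒯.refMeasure (𝒯.IsInt k)
                (𝒯.exactPos k X s) (𝒯.exactVal k X v s)) +
              J * (𝒯.feSpace k).velDefectSq 𝒯.refMeasure (𝒯.IsInt k)
                (𝒯.exactPos k X t) (𝒯.exactVal k X v t)) := by ring
        _ ≤ FESpace.velConst C K * (FESpace.posConst T C K * (T * θ) + θ) := by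
            gcongr
            exact h4 t ht
        _ = 1 ^ 2 := by rw [hθ]; field_simp
    have h7 := le_of_sq_le_sq h6 zero_le_one
    rw [FESpace.jac_sub] at h7
    have h8 := norm_add_le ((𝒯.feSpace k).jac (w t) y - (𝒯.feSpace k).jac (𝒯.exactVal k X v t) y)
      ((𝒯.feSpace k).jac (𝒯.exactVal k X v t) y)
    rw [sub_add_cancel] at h8
    linarith [h.norm_jac_vel t ht y]
  have hmem : ∀ t ∈ Icc 0 T, ∀ y, (𝒯.feSpace k).pos (𝒯.exactPos k X t) y ∈
      Metric.closedBall (0 : E3) (R + 3 * CP * ε) := fun t ht y => by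
    rw [mem_closedBall_zero_iff]
    have : 0 ≤ 3 * CP * ε := by positivity
    linarith [h.norm_pos t ht y]
  have hmemx : ∀ t ∈ Icc 0 T, ∀ y, (𝒯.feSpace k).pos (x t) y ∈
      Metric.closedBall (0 : E3) (R + 3 * CP * ε) := fun t ht y => by
    rw [mem_closedBall_zero_iff]
    have h1 := h.stable.norm_pos_le hCP hε.le (x := x t - 𝒯.exactPos k X t)
      (fun j hj => by rw [Pi.sub_apply, (hbd t ht j hj).1, sub_self])
      (fun y => by rw [FESpace.jac_sub]; exact (hpos t ht).1 y) y
    rw [FESpace.pos_sub] at h1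
    have h2 := norm_add_le ((𝒯.feSpace k).pos (x t) y - (𝒯.feSpace k).pos (𝒯.exactPos k X t) y)
      ((𝒯.feSpace k).pos (𝒯.exactPos k X t) y)
    rw [sub_add_cancel] at h2
    linarith [h.norm_pos t ht y]
  have hmain := h.stable.diffusion_stability hT hC hCP hK hB.le hxs hvs hsd.position hus hus'
    hsol.contDiffOn_f.continuousOn
    (u := u_h)
    (by
      funext j
      rw [hsd.u_zero]
      change u 0 j = u 0 (X 0 j)
      rw [hsol.X_zero _ (𝒯.node_mem_closure hk j)])
    hFBs (fun t ht => hFB' t ht _ (hpos t ht).1) h.norm_jac_vel hw h.abs_val h.abs_val_deriv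
    h.norm_grad (fun t ht y => (h.source t ht _ (hmem t ht y)).1)
    (fun t ht y => (h.source t ht _ (hmem t ht y)).2 _ (hmemx t ht y))
    (fun t ht j hj => (hbd t ht j hj).1) (fun t ht => (hpos t ht).2.1)
    (fun t ht => (hpos t ht).2.2)
    (fun t ht => by
      have h1 := hsd.diffusion t ht
      rw [(hregx t ht).loadVector_eq hΛ (hf t ht), (hregx t ht).stiffMatrix_eq hΛ] at h1
      exact h1.congr (fun s hs => by rw [(hregx s hs).massMatrix_eq hΛ])
        (by rw [(hregx t ht).massMatrix_eq hΛ]))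
  have hdual : ∀ t ∈ Icc 0 T, 𝒯.dualNorm (𝒯.exactPos k X t) (d_u t) ^ 2 =
      (𝒯.feSpace k).diffDefectSq 𝒯.refMeasure (f t) (𝒯.exactPos k X t) (𝒯.exactVal k X v t)
        (𝒯.exactVal k X u t) (𝒯.materialDeriv k T X u t) := fun t ht =>
    dualNorm_sq hΛ hT ht hregs (hf t ht) (hxs t ht) (hus t ht) (hdu t ht) (by
      have hpd := (h.stable.mass_posDef (𝒯.feSpace k) 𝒯.refMeasure hC0 (hFBs t ht)).add_posSemidef
        ((𝒯.feSpace k).stiff_posSemidef 𝒯.refMeasure hC0 (hFBs t ht))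
      have := hpd.posSemidef.inv.dotProduct_mulVec_nonneg
        ((𝒯.feSpace k).diffResidual 𝒯.refMeasure (f t) (𝒯.exactPos k X t) (𝒯.exactVal k X v t)
        (𝒯.exactVal k X u t) (𝒯.materialDeriv k T X u t))
      rwa [star_trivial] at this)
  intro t ht
  have hsub : uIcc 0 t ⊆ Icc 0 T := by
    rw [uIcc_of_le ht.1]; exact Icc_subset_Icc_right ht.2
  convert hmain t ht using 2
  · rw [matNormSq, (hregs t ht).massMatrix_eq hΛ]
  · refine intervalIntegral.integral_congr fun s hs => ?_
    simp only [matNormSq]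
    rw [(hregs s (hsub hs)).stiffMatrix_eq hΛ]
  · refine intervalIntegral.integral_congr fun s hs => ?_
    rw [hdual s (hsub hs), hdual₀ s (hsub hs)]

end ExactTriangulation
end HarmonicFEM

namespace HarmonicFEM
namespace ExactTriangulation

lemma feSpace_val_eq {Ω₀ : Set E3} {𝒯 : ExactTriangulation Ω₀} {k : ℕ} (z : 𝒯.Node k → ℝ)
    (S : 𝒯.simplices) (y : refSimplex) :
    (𝒯.feSpace k).val z (S, y) = ∑ α : LocalNode k, shape α y • z (𝒯.dof S α) := by
  rw [feSpace_val, shapeSum]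
  exact Finset.sum_congr rfl fun α _ => mul_comm _ _

/-- The bounds hold uniformly on fine quasi-uniform meshes, with an inverse estimate of the order
that is optimal in three dimensions. -/
lemma exists_meshBounds {Ω₀ : Set E3} {k : ℕ} {T σ q : ℝ} {f : ℝ → E3 → ℝ} {vΓ X v : ℝ → E3 → E3}
    {u : ℝ → E3 → ℝ} (hk : k ≠ 0) (hT : 0 < T) (hσ : 0 < σ) (hq : q < 1)
    (hΩ : UniqueDiffOn ℝ (closure Ω₀)) (hΩc : IsCompact (closure Ω₀))
    (hsol : IsExactSolution Ω₀ T f vΓ X v u) :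
    ∃ CP, 0 ≤ CP ∧ ∃ CJ, 0 ≤ CJ ∧ ∃ Λ, 1 ≤ Λ ∧ ∀ ε : ℝ, ∃ K, 0 ≤ K ∧ ∃ R h₁ : ℝ, 0 < h₁ ∧
      ∀ 𝒯 : ExactTriangulation Ω₀, 𝒯.IsQuasiUniform σ q → 𝒯.width ≤ h₁ →
        𝒯.MeshBounds k T f X v u CP (CJ / 𝒯.width ^ 3) ε Λ K R := by
  obtain ⟨R₀, hR₀, hR₀s⟩ := hΩc.isBounded.subset_closedBall_lt 0 0
  obtain ⟨CP, CJ, hCP, hCJ, hstab⟩ := exists_isStable Ω₀ (q := q) hk hσ hR₀.le hR₀s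
  obtain ⟨Λ, hΛ, hgood⟩ := exists_exactPos_good Ω₀ hk hT hσ hq hΩ hΩc hsol.contDiffOn_X
    hsol.nondegenerate
  -- These constants precede `ε`, since `ε` will be chosen in terms of `Λ`. The constant `K` comes
  -- after it: the ball on which `f` is estimated grows with `ε`.
  refine ⟨CP, hCP, CJ, hCJ, Λ, hΛ, fun ε => ?_⟩
  obtain ⟨h₁, hh₁, hgood⟩ := hgood (4 * Λ)⁻¹ (by positivity)
  obtain ⟨Kv, hKv0, h₂, hh₂, hKv⟩ := exists_interpolation_bound Ω₀
    (F := fun t p => v t (X t p)) hk hT hσ hq hΩ hΩc hsol.contDiffOn_v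
  obtain ⟨Ku, hKu0, h₃, hh₃, hKu⟩ := exists_interpolation_bound Ω₀
    (F := fun t p => u t (X t p)) hk hT hσ hq hΩ hΩc hsol.contDiffOn_u
  obtain ⟨R, hR0, h₄, hh₄, hR⟩ := exists_interpolation_bound Ω₀
    (F := X) hk hT hσ hq hΩ hΩc hsol.contDiffOn_X
  obtain ⟨Kf, hKf0, hKf⟩ := exists_lipschitz_of_contDiffOn hT hsol.contDiffOn_f (R + 3 * CP * ε)
  refine ⟨Kv + Ku + Kf, by positivity, R, min (min h₁ h₂) (min h₃ h₄), by positivity,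
    fun 𝒯 h𝒯 hw => ?_⟩
  simp only [le_min_iff] at hw
  obtain ⟨⟨hw₁, hw₂⟩, hw₃, hw₄⟩ := hw
  refine ⟨hstab 𝒯 h𝒯, hgood 𝒯 h𝒯 hw₁, ?_, ?_, ?_, ?_, ?_, ?_⟩
  · rintro t ht ⟨S, y⟩
    refine ContinuousLinearMap.opNorm_le_bound _ (by positivity) fun e => ?_
    rw [feSpace_jac_apply]
    refine ((hKv 𝒯 h𝒯 hw₂ S t ht y y.2).1 e).trans ?_
    gcongr
    linarith
  · rintro t ht ⟨S, y⟩
    have h1 := (hKu 𝒯 h𝒯 hw₃ S t ht y y.2).2.1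
    rw [feSpace_val_eq, ← Real.norm_eq_abs]
    refine h1.trans ?_
    linarith
  · rintro t ht ⟨S, y⟩
    have h1 := (hKu 𝒯 h𝒯 hw₃ S t ht y y.2).2.2
    rw [feSpace_val_eq, ← Real.norm_eq_abs]
    refine h1.trans ?_
    linarith
  · rintro t ht ⟨S, y⟩
    refine ContinuousLinearMap.opNorm_le_bound _ (by positivity) fun e => ?_
    rw [feSpace_grad_apply]
    refine ((hKu 𝒯 h𝒯 hw₃ S t ht y y.2).1 e).trans ?_
    gcongr
    linarith
  · rintro t ht ⟨S, y⟩
    rw [feSpace_pos]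
    exact (hR 𝒯 h𝒯 hw₄ S t ht y y.2).2.1
  · intro t ht p hp
    obtain ⟨h1, h2⟩ := hKf t ht p hp
    refine ⟨h1.trans (by linarith), fun p' hp' => (h2 p' hp').trans ?_⟩
    gcongr
    linarith

end ExactTriangulation
end HarmonicFEM

end

theorem mainTheorem3
    (Ω₀ : Set E3) (hΩ_open : IsOpen Ω₀) (hΩ_bdd : Bornology.IsBounded Ω₀)
    (hΩ_conn : IsConnected Ω₀) (hΩ_smooth : HasSmoothBoundary Ω₀)
    (T : ℝ) (hT : 0 < T)
    (f : ℝ → E3 → ℝ) (vΓ : ℝ → E3 → E3) (X v : ℝ → E3 → E3) (u : ℝ → E3 → ℝ)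
    (hsol : IsExactSolution Ω₀ T f vΓ X v u)
    (k : ℕ) (hk : 2 ≤ k) (σ q : ℝ) (hσ : 0 < σ) (hq : q < 1)
    (κ : ℝ) (hκ : 3 / 2 < κ) (c : ℝ) :
    ∃ h₀ : ℝ, 0 < h₀ ∧ ∃ C : ℝ,
      ∀ 𝒯 : ExactTriangulation Ω₀, 𝒯.IsQuasiUniform σ q → 𝒯.width ≤ h₀ →
      ∀ (x w : ℝ → 𝒯.Node k → E3) (u_h : ℝ → 𝒯.Node k → ℝ),
        𝒯.IsSemidiscreteSolution T f vΓ (u 0) x w u_h →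
      ∀ (d_u : ℝ → 𝒯.Node k → ℝ) (d_v : ℝ → 𝒯.IntNode k → E3),
        𝒯.IsDiffusionDefect T f X u d_u → 𝒯.IsVelocityDefect T X v d_v →
        (∀ t ∈ Set.Icc 0 T, 𝒯.dualNorm (𝒯.exactPos k X t) (d_u t) ≤ c * 𝒯.width ^ κ) →
        (∀ t ∈ Set.Icc 0 T, 𝒯.dualNorm₀ (𝒯.exactPos k X t) (d_v t) ≤ c * 𝒯.width ^ κ) →
        ∀ t ∈ Set.Icc 0 T,
          matNormSq (𝒯.massMatrix (𝒯.exactPos k X t)) (u_h t - 𝒯.exactVal k X u t)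
            + ∫ s in (0 : ℝ)..t,
                matNormSq (𝒯.stiffMatrix (𝒯.exactPos k X s)) (u_h s - 𝒯.exactVal k X u s)
          ≤ C * ∫ s in (0 : ℝ)..t,
              (𝒯.dualNorm (𝒯.exactPos k X s) (d_u s) ^ 2
                + 𝒯.dualNorm₀ (𝒯.exactPos k X s) (d_v s) ^ 2) := by
  have hk0 : k ≠ 0 := by omega
  -- Without admissible meshes the assertion is vacuous. Otherwise a single mesh shows that the
  -- closed domain has unique derivatives, before any mesh-dependent choice is made.
  by_cases hex : ∃ 𝒯 : ExactTriangulation Ω₀, 𝒯.IsQuasiUniform σ q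
  swap
  · exact ⟨1, one_pos, 0, fun 𝒯 h𝒯 => absurd ⟨𝒯, h𝒯⟩ hex⟩
  obtain ⟨𝒯₀, h𝒯₀⟩ := hex
  have hΩ := h𝒯₀.uniqueDiffOn hq
  obtain ⟨CP, hCP, CJ, hCJ, Λ, hΛ, hmesh⟩ := ExactTriangulation.exists_meshBounds hk0 hT hσ hq hΩ
    hΩ_bdd.isCompact_closure hsol
  -- The Jacobians of the interpolated flow are perturbations of `GoodMap Λ` maps, hence themselves
  -- good with `2 * Λ`.
  obtain ⟨C, hC, ε₀, hε₀, hFB⟩ := exists_formBounds (Λ := 2 * Λ) (by linarith)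
  have hε : 0 < min ε₀ (4 * Λ)⁻¹ := by positivity
  obtain ⟨K, hK, R, h₁, hh₁, hmesh⟩ := hmesh (min ε₀ (4 * Λ)⁻¹)
  have hC0 : 0 < C := by linarith
  have ha := FESpace.velConst_pos (K := K) hC0
  have hB := FESpace.posConst_pos (T := T) (K := K) hC0
  -- The threshold `θ` depends on the data but not on the mesh, and `h ^ (2 κ - 3)` tends to zero
  -- with `h`.
  obtain ⟨h₂, hh₂, hsmall⟩ := exists_small_rpow (s := 2 * κ - 3) (b := CJ * c ^ 2)
    (θ := min ((min ε₀ (4 * Λ)⁻¹) ^ 2 / (2 * (FESpace.posConst T C K * T)))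
      (1 / (FESpace.velConst C K * (FESpace.posConst T C K * T + 1))))
    (by linarith) (by positivity) (by positivity)
  refine ⟨min h₁ h₂, by positivity,
    C ^ 2 * (FESpace.diffConst CP C K * Real.exp (FESpace.diffConst CP C K * T)) *
      (FESpace.posConst T C K * T + 1), fun 𝒯 h𝒯 hw x w u_h hsd d_u d_v hdu hdv _ hdvs => ?_⟩
  obtain ⟨S⟩ := 𝒯.simplices_nonempty hΩ_conn.nonempty
  have hw0 := 𝒯.width_pos S
  exact (hmesh 𝒯 h𝒯 (hw.trans (min_le_left _ _))).stability hT hsol hk0 hΩ hCP (by positivity) hC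
    hΛ hK hε (min_le_right _ _)
    (fun H hH H' hH' => hFB H hH H' (hH'.trans (min_le_left _ _))) hsd hdu hdv
    fun t ht => (div_mul_sq_rpow_le hCJ hw0 (Real.sqrt_nonneg _) (hdvs t ht)).trans
      (hsmall _ hw0 (hw.trans (min_le_right _ _)))
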